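/- Let $V\cong\mathbf C^{16}$ be the space of pairs $(f_2,f_3)$ of polynomials in $\mathbf C[x,y]$ with $\deg f_2\le 2$ and $\deg f_3\le 3$, with coordinates the $6+10$ coefficients. A pair defines the curve of torus type $C=\{f=0\}$, $f=f_2^3+f_3^2$. A point $P\in\mathbf C^2$ is an outer singularity of $C$ if $C$ is singular at $P$ and $f_2(P)\neq 0$. It is of type $A_n$, $D_k$ ($k\ge4$) or $E_6$ if the germ $(C,P)$ is analytically equivalent to the germ at the origin of $y^2+x^{n+1}=0$, $y^2x+x^{k-1}=0$ or $y^3+x^4=0$ respectively, that is, if $f\circ\varphi=u\cdot g$ near $0$, where $g$ is the normal form, $\varphi:(\mathbf C^2,0)\to(\mathbf C^2,P)$ is a local biholomorphism and $u$ is a holomorphic function with $u(0)\ne0$. Let $U\subseteq V$ be any set of pairs that contains all pairs with $\deg f_2=2$, $\deg f_3=3$, $\deg f=6$ and $f$ irreducible (for example, the set of exactly these pairs, or all of $V$). For a type $\sigma$ and $P\in\mathbf C^2$, let $\text{o-codim}(\sigma)$ be the number of conditions that an outer singularity of type $\sigma$ at $P$ imposes on the coefficients, minus $2$ (the freedom to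 choose $P$); here the number of conditions is the codimension in $V$ of the Zariski closure of the set of all $(f_2,f_3)\in U$ for which $P$ is an outer singularity of type $\sigma$. Then, for every $P\in\mathbf C^2$ and every such $U$, $$\text{o-codim}(A_i)=i\ (1\le i\le5),\qquad \text{o-codim}(D_i)=i\ (i=4,5),\qquad \text{o-codim}(E_6)=6.$$ Moreover, for each of these types $\sigma$ and every $(f_2,f_3)\in V$ for which $P$ is an outer singularity of type $\sigma$, $\text{o-codim}(\sigma)$ is equal to the Milnor number $\dim_{\mathbf C}\mathcal O_{\mathbf C^2,P}/(f_x,f_y)$ of $(C,P)$. -/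

import Mathlib

open scoped Topology

namespace TorusSextic

/-- Exponents `(p, q)` of the monomials `x ^ p * y ^ q` of degree at most `d`. -/
abbrev Mon (d : ℕ) : Type := {m : Fin (d + 1) × Fin (d + 1) // (m.1 : ℕ) + (m.2 : ℕ) ≤ d}

/-- The polynomial in `x = X 0`, `y = X 1` of degree at most `d` with given coefficients. -/
noncomputable def planePoly (d : ℕ) (a : Mon d → ℂ) : MvPolynomial (Fin 2) ℂ :=
  ∑ m : Mon d,
    MvPolynomial.C (a m) * MvPolynomial.X 0 ^ (m.1.1 : ℕ) * MvPolynomial.X 1 ^ (m.1.2 : ℕ)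

/-- The indices of the `6 + 10 = 16` coefficients of a pair `(f₂, f₃)`. -/
abbrev CoeffIndex : Type := Mon 2 ⊕ Mon 3

/-- The 16-dimensional vector space of pairs `(f₂, f₃)`, in coordinates. -/
abbrev Pair : Type := CoeffIndex → ℂ

/-- The polynomial `f₂` of a pair. -/
noncomputable def conic (c : Pair) : MvPolynomial (Fin 2) ℂ :=
  planePoly 2 fun m => c (Sum.inl m)

/-- The polynomial `f₃` of a pair. -/
noncomputable def cubic (c : Pair) : MvPolynomial (Fin 2) ℂ :=
  planePoly 3 fun m => c (Sum.inr m)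

/-- The defining polynomial `f = f₂ ^ 3 + f₃ ^ 2` of the curve of torus type. -/
noncomputable def sextic (c : Pair) : MvPolynomial (Fin 2) ℂ :=
  conic c ^ 3 + cubic c ^ 2

/-- The pairs that define irreducible sextics, the line at infinity being a component of none of
the conic, the cubic and the sextic. -/
def irreducibleSextics : Set Pair :=
  {c | (conic c).totalDegree = 2 ∧ (cubic c).totalDegree = 3 ∧
    (sextic c).totalDegree = 6 ∧ Irreducible (sextic c)}

/-- `P` is a singular point of the curve `f = 0`. -/
def IsSingularPoint (f : MvPolynomial (Fin 2) ℂ) (P : Fin 2 → ℂ) : Prop :=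
  MvPolynomial.eval P f = 0 ∧ ∀ i, MvPolynomial.eval P (MvPolynomial.pderiv i f) = 0

/-- `P` is an outer singularity: a singular point of the curve off the conic. -/
def IsOuterSingularity (c : Pair) (P : Fin 2 → ℂ) : Prop :=
  IsSingularPoint (sextic c) P ∧ MvPolynomial.eval P (conic c) ≠ 0

/-- The germs at `P` of `f = 0` and at `Q` of `g = 0` are equivalent: there are a local
biholomorphism `φ` with `φ Q = P` (an analytic map with invertible derivative) and an analytic
unit `u` such that `f ∘ φ = u * g` near `Q`. -/
def GermEquiv (f : MvPolynomial (Fin 2) ℂ) (P : Fin 2 → ℂ)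
    (g : MvPolynomial (Fin 2) ℂ) (Q : Fin 2 → ℂ) : Prop :=
  ∃ (φ : (Fin 2 → ℂ) → (Fin 2 → ℂ)) (φ' : (Fin 2 → ℂ) ≃L[ℂ] (Fin 2 → ℂ))
    (u : (Fin 2 → ℂ) → ℂ),
    AnalyticAt ℂ φ Q ∧ φ Q = P ∧ HasFDerivAt φ (φ' : (Fin 2 → ℂ) →L[ℂ] (Fin 2 → ℂ)) Q ∧
    AnalyticAt ℂ u Q ∧ u Q ≠ 0 ∧
    ∀ᶠ z in 𝓝 Q, MvPolynomial.eval (φ z) f = u z * MvPolynomial.eval z g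

/-- Names of simple plane curve singularities. -/
inductive SingType : Type
  | A (n : ℕ)
  | D (k : ℕ)
  | E6

/-- Normal forms: `A_n : y² + xⁿ⁺¹`, `D_k : y² x + xᵏ⁻¹` (for `k ≥ 4`), `E₆ : y³ + x⁴`. -/
noncomputable def SingType.normalForm : SingType → MvPolynomial (Fin 2) ℂ
  | .A n => MvPolynomial.X 1 ^ 2 + MvPolynomial.X 0 ^ (n + 1)
  | .D k => MvPolynomial.X 1 ^ 2 * MvPolynomial.X 0 + MvPolynomial.X 0 ^ (k - 1)
  | .E6 => MvPolynomial.X 1 ^ 3 + MvPolynomial.X 0 ^ 4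

/-- The pairs `(f₂, f₃)` for which `P` is an outer singularity of type `σ`. -/
def outerLocus (σ : SingType) (P : Fin 2 → ℂ) : Set Pair :=
  {c | IsOuterSingularity c P ∧ GermEquiv (sextic c) P σ.normalForm 0}

/-- The number of independent conditions that define a set of pairs: the codimension of its
Zariski closure in the 16-dimensional space of coefficients, that is, the height of the ideal of
the polynomials in the coefficients that vanish on it (`⊤` for the empty set). -/
noncomputable def numConditions (S : Set Pair) : ℕ∞ :=
  (MvPolynomial.vanishingIdeal ℂ S : Ideal (MvPolynomial CoeffIndex ℂ)).height

/-- The o-codimension of the type `σ` at `P` among the pairs in `U`: the number of conditions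
minus `2`. The subtraction is truncated, which makes no difference to a value that is positive. -/
noncomputable def oCodim (U : Set Pair) (σ : SingType) (P : Fin 2 → ℂ) : ℕ∞ :=
  numConditions (U ∩ outerLocus σ P) - 2

/-- The functions that are analytic at `P`. Two of them are the same germ if they agree near
`P`. -/
def analyticFunctions (P : Fin 2 → ℂ) : Subalgebra ℂ ((Fin 2 → ℂ) → ℂ) where
  carrier := {h | AnalyticAt ℂ h P}
  mul_mem' ha hb := AnalyticAt.mul ha hb
  add_mem' ha hb := AnalyticAt.add ha hb
  algebraMap_mem' _ := analyticAt_const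

/-- The functions, analytic at `P`, whose germ lies in the ideal generated by the germs of the
partial derivatives of `f`. -/
def jacobianIdeal (f : MvPolynomial (Fin 2) ℂ) (P : Fin 2 → ℂ) :
    Ideal (analyticFunctions P) where
  carrier := {h | ∃ a b : analyticFunctions P, ∀ᶠ z in 𝓝 P,
    h.1 z = a.1 z * MvPolynomial.eval z (MvPolynomial.pderiv 0 f) +
      b.1 z * MvPolynomial.eval z (MvPolynomial.pderiv 1 f)}
  zero_mem' := ⟨0, 0, Filter.Eventually.of_forall fun z => by simp⟩
  add_mem' := by
    rintro h k ⟨a, b, h1⟩ ⟨a', b', h2⟩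
    refine ⟨a + a', b + b', ?_⟩
    filter_upwards [h1, h2] with z e1 e2
    simp only [Subalgebra.coe_add, Pi.add_apply, e1, e2]
    ring
  smul_mem' := by
    rintro r h ⟨a, b, h1⟩
    refine ⟨r * a, r * b, ?_⟩
    filter_upwards [h1] with z e1
    simp only [smul_eq_mul, Subalgebra.coe_mul, Pi.mul_apply, e1]
    ring

/-- The Milnor number of `f` at `P`: the complex dimension of the ring of analytic germs at `P`
modulo the partial derivatives of `f`. Functions that vanish near `P` lie in `jacobianIdeal f P`,
so that the quotient below is that quotient of the ring of germs. -/
noncomputable def milnorNumber (f : MvPolynomial (Fin 2) ℂ) (P : Fin 2 → ℂ) : ℕ :=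
  Module.finrank ℂ (analyticFunctions P ⧸ jacobianIdeal f P)

/-- The types `A₁, …, A₅, D₄, D₅, E₆`. -/
def outerTypes : Set SingType :=
  {σ | (∃ i, 1 ≤ i ∧ i ≤ 5 ∧ σ = .A i) ∨ (∃ i, 4 ≤ i ∧ i ≤ 5 ∧ σ = .D i) ∨ σ = .E6}

end TorusSextic

/-! The number of conditions imposed on a set of pairs is the height of its vanishing ideal. For
the image of a polynomial map this ideal consists of the relations between the coordinates of the
map, and its height is `16` minus the transcendence degree of these coordinates
(`exists_algebraicIndependent_height_ker`). So a locus that is covered by families with `m`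
parameters imposes at least `16 - m` conditions (`le_numConditions`), and one that contains an open
piece of a family whose `m` parameters are algebraic over the coefficients of the pair imposes at
most `16 - m` (`numConditions_le`). The counting takes place at the origin, to which a translation
moves `P` (`oCodim_eq`). There it has to be shown that the locus of all pairs imposes `i + 2`
conditions at least, and the locus of irreducible sextics at most as many.

A pair has an outer singularity at the origin exactly if `f₂ = -t² (m² + 2 q)` and
`f₃ = t³ (m³ + 3 m q + m h₂ + h₃)` with `t ≠ 0`, `m = 1 + α x + β y`, a quadratic form `q`, and
forms `h₂`, `h₃` of degrees `2` and `3` (`exists_jet_of_isOuterSingularity`). These are `13`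
parameters, collected in the structure `TorusJet`. In the projective coordinates `x / m`, `y / m`
the sextic becomes, up to a unit, `(2 + 6 q + h) h - (3 + 8 q) q²` with `h = h₂ + h₃`
(`TorusJet.funGermEquiv_sextic_germ`), so the type of the singularity depends on `q`, `h₂`, `h₃`
only. After a shear that makes a tangent horizontal, the types are described by equations: for
`A₂`, `h₂` is a multiple of `y²`; for `A₃`, moreover, `h₃` has no term in `x³`; for `A₄` the part
of weighted degree `4`, with weights `1` and `2`, is a multiple of `(y - s x²)²`; for `A₅` the term
in `x⁵` along `y = s x²` vanishes, too; for `D₄`, `D₅`, `E₆` we have `h₂ = 0`, and `h₃` vanishes on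
`y = 0` to the order `1`, `2`, `3` at least. Each equation removes one parameter, and the parameter
of the shear adds one (`familyA2` to `familyE6`). Only for `A₅` there is a second family, of the
same dimension: the sextics that contain the tangent line of the singularity as a component.

That these equations are sufficient on an open set follows by bringing the germ into normal form
with the analytic inverse and implicit function theorems (`funGermEquiv_A` to `funGermEquiv_E6`).
That they are necessary follows from a comparison of leading terms along curves: the local
biholomorphism that brings the germ to normal form has, after a shear of its target, the linear
part `(a X + b Y, d Y)`, and the restrictions of the equality to curves determine the low order
coefficients (`TorusJet.NormalPullback`). The parameters of a family are algebraic over the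
coefficients of the pair: these determine `t` and the jet up to finitely many choices, and the
shear moves a root of the sheared form `h₂` or `h₃` to `y = 0` (`TorusJet.isAlgebraicOver_of_pair`,
`TorusJet.isAlgebraicOver_of_shear`). Finally, irreducibility in degree `6` is an open condition,
because the products of polynomials of given degrees form a closed set (`isOpen_irreducible`), and
it holds for the explicit jets `baseA` and `baseE`, which lie in the families.

The Milnor number is invariant under equivalence with a quasi-homogeneous normal form `g`: such a
`g` is its own derivative along a vector field, so that a unit factor does not change the Jacobian
ideal (`milnorNumber_eq_of_germEquiv`). For the normal forms it is computed by exhibiting a basis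
of the local algebra: Hadamard's lemma shows that the monomials span, and restriction to curves
that they are independent. -/

/-! ### Heights of vanishing ideals of parametrised sets -/

namespace TorusSextic

open MvPolynomial

lemma height_eq_of_isMaximal_fin {K : Type*} [Field K] (n : ℕ)
    (P : Ideal (MvPolynomial (Fin n) K)) [hP : P.IsMaximal] : P.height = n := by
  induction n with
  | zero =>
    have h := Ideal.height_le_ringKrullDim_of_isPrime (I := P)
    rw [MvPolynomial.ringKrullDim_of_isNoetherianRing] at h
    simpa using h
  | succ n ih =>
    let e := (finSuccEquiv K n).toRingEquiv
    have hmax : (P.map e).IsMaximal := Ideal.map_isMaximal_of_equiv e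
    have hc : ((P.map e).comap
        (Polynomial.C : MvPolynomial (Fin n) K →+*
          Polynomial (MvPolynomial (Fin n) K))).IsMaximal :=
      Polynomial.isMaximal_comap_C_of_isJacobsonRing _
    have : (P.map e).LiesOver ((P.map e).comap
        (Polynomial.C : MvPolynomial (Fin n) K →+* Polynomial (MvPolynomial (Fin n) K))) := ⟨rfl⟩
    have h1 := Polynomial.height_eq_height_add_one ((P.map e).comap
        (Polynomial.C : MvPolynomial (Fin n) K →+* Polynomial (MvPolynomial (Fin n) K))) (P.map e)
    rw [ih _ (hP := hc), e.height_map] at h1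
    simpa using h1

/-- Every maximal ideal of a polynomial ring over a field has height the number of variables. -/
lemma height_eq_of_isMaximal {K τ : Type*} [Field K] [Finite τ]
    (P : Ideal (MvPolynomial τ K)) [hP : P.IsMaximal] : P.height = Nat.card τ := by
  let e := (renameEquiv K (Finite.equivFin τ)).toRingEquiv
  have hmax : (P.map e).IsMaximal := Ideal.map_isMaximal_of_equiv e
  rw [← e.height_map P, height_eq_of_isMaximal_fin]

lemma ker_isMaximal_of_isIntegral {K τ A : Type*} [Field K] [CommRing A] [IsDomain A]
    [Algebra K A] (π : MvPolynomial τ K →ₐ[K] A) (hπ : Function.Surjective π)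
    (h : ∀ i, IsIntegral K (π (X i))) : (RingHom.ker π).IsMaximal := by
  have hint : Algebra.IsIntegral K A := by
    constructor
    intro x
    obtain ⟨p, rfl⟩ := hπ x
    induction p using MvPolynomial.induction_on with
    | C a => rw [← algebraMap_eq, AlgHom.commutes]; exact isIntegral_algebraMap
    | add p r hp hr => rw [map_add]; exact hp.add hr
    | mul_X p i hp => rw [map_mul]; exact hp.mul (h i)
  have hfield : IsField A := isField_of_isIntegral_of_isField' (Field.toIsField K)
  let _ := hfield.toField
  exact RingHom.ker_isMaximal_of_surjective π hπ

attribute [local instance] MvPolynomial.algebraMvPolynomial in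
/-- A prime of a polynomial ring over a domain `R` that meets `R` in zero, and modulo which every
variable is algebraic over `R`, becomes a maximal ideal over the fraction field of `R`. -/
lemma height_eq_card_of_algebraic (K : Type*) {R τ : Type*} [CommRing R] [IsDomain R]
    [Field K] [Algebra R K] [IsFractionRing R K] [Finite τ] (q : Ideal (MvPolynomial τ R))
    [q.IsPrime] (h0 : ∀ r : R, C r ∈ q → r = 0)
    (halg : ∀ i : τ, ∃ g : Polynomial R, g ≠ 0 ∧ Polynomial.aeval (X i : MvPolynomial τ R) g ∈ q) :
    q.height = Nat.card τ := by
  let M := (nonZeroDivisors R).map (C (σ := τ) (R := R))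
  have hloc : IsLocalization M (MvPolynomial τ K) :=
    MvPolynomial.isLocalization (nonZeroDivisors R) K
  have hdisj : Disjoint (M : Set (MvPolynomial τ R)) (q : Set (MvPolynomial τ R)) := by
    rw [Set.disjoint_left]
    rintro _ ⟨r, hr, rfl⟩ hrq
    exact nonZeroDivisors.ne_zero hr (h0 r hrq)
  rw [← IsLocalization.height_map_of_disjoint (S := MvPolynomial τ K) M q hdisj]
  set q' := q.map (algebraMap (MvPolynomial τ R) (MvPolynomial τ K)) with hq'
  have hprime : q'.IsPrime := IsLocalization.isPrime_of_isPrime_disjoint M _ q ‹_› hdisj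
  have hmax : q'.IsMaximal := by
    let π := Ideal.Quotient.mkₐ K q'
    have hπ : Function.Surjective π := Ideal.Quotient.mkₐ_surjective K q'
    have hk : RingHom.ker π = q' := Ideal.Quotient.mkₐ_ker K q'
    rw [← hk]
    refine ker_isMaximal_of_isIntegral π hπ fun i => ?_
    refine isAlgebraic_iff_isIntegral.1 ?_
    obtain ⟨g, hg, hgq⟩ := halg i
    refine ⟨g.map (algebraMap R K),
      (Polynomial.map_ne_zero_iff (IsFractionRing.injective R K)).2 hg, ?_⟩
    have h1 : algebraMap (MvPolynomial τ R) (MvPolynomial τ K)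
        (Polynomial.aeval (X i : MvPolynomial τ R) g) ∈ q' := Ideal.mem_map_of_mem _ hgq
    have h2 : algebraMap (MvPolynomial τ R) (MvPolynomial τ K)
        (Polynomial.aeval (X i : MvPolynomial τ R) g)
        = Polynomial.aeval (X i : MvPolynomial τ K) (g.map (algebraMap R K)) := by
      rw [Polynomial.aeval_map_algebraMap, ← Polynomial.aeval_algebraMap_apply]
      have hX : algebraMap (MvPolynomial τ R) (MvPolynomial τ K) (X i) = X i := map_X _ _
      rw [hX]
    rw [h2] at h1
    rw [Polynomial.aeval_algHom_apply π (X i) (g.map (algebraMap R K))]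
    exact Ideal.Quotient.eq_zero_iff_mem.2 h1
  exact height_eq_of_isMaximal q'

/-- The height of the ideal of relations between finitely many elements of a domain over a field:
the number of elements minus the transcendence degree, the latter being the size of a maximal
algebraically independent subfamily. -/
lemma exists_algebraicIndependent_height_ker {k ι T : Type*} [Field k] [Finite ι] [CommRing T]
    [IsDomain T] [Algebra k T] (ψ : ι → T) :
    ∃ B : Set ι, AlgebraicIndependent k (fun b : B => ψ b) ∧
      (∀ i, IsAlgebraic (Algebra.adjoin k (Set.range fun b : B => ψ b)) (ψ i)) ∧
      (RingHom.ker (aeval ψ : MvPolynomial ι k →ₐ[k] T)).height = Nat.card ↥(Bᶜ) := by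
  classical
  have hfin : {B : Set ι | AlgebraicIndependent k (fun b : B => ψ b)}.Finite := Set.toFinite _
  obtain ⟨B, hB⟩ := hfin.exists_maximal
    ⟨∅, by
      simp only [Set.mem_ofPred_eq]
      exact (algebraicIndependent_empty_type_iff).2 (FaithfulSMul.algebraMap_injective k T)⟩
  have hBi : AlgebraicIndependent k (fun b : B => ψ b) := hB.prop
  have hopt : ∀ i, i ∉ B → ¬ AlgebraicIndependent k
      (fun o : Option B => o.elim (ψ i) (fun b : B => ψ b)) := by
    intro i hi hind
    have h1 : AlgebraicIndepOn k ψ (insert i B) := by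
      rw [AlgebraicIndepOn.insert_iff hi]
      refine ⟨hBi, ?_⟩
      have := (hBi.option_iff_transcendental (ψ i)).1 hind
      rwa [Set.image_eq_range]
    exact hi (hB.le_of_ge h1 (Set.subset_insert i B) (Set.mem_insert i B))
  refine ⟨B, hBi, fun i => ?_, ?_⟩
  · by_cases hi : i ∈ B
    · exact isAlgebraic_algebraMap
        (⟨ψ i, Algebra.subset_adjoin ⟨⟨i, hi⟩, rfl⟩⟩ :
          Algebra.adjoin k (Set.range fun b : B => ψ b))
    · have := hopt i hi
      rw [hBi.option_iff_transcendental (ψ i)] at this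
      exact not_not.1 this
  · let e : MvPolynomial ι k ≃ₐ[k] MvPolynomial ↥(Bᶜ) (MvPolynomial B k) :=
      (renameEquiv k ((Equiv.Set.sumCompl B).symm.trans (Equiv.sumComm _ _))).trans
        (sumAlgEquiv k _ _)
    let Ψ : MvPolynomial ↥(Bᶜ) (MvPolynomial B k) →+* T :=
      eval₂Hom (aeval (fun b : B => ψ b) : MvPolynomial B k →ₐ[k] T).toRingHom
        (fun b : ↥(Bᶜ) => ψ b)
    have hcomp : ∀ p, Ψ (e p) = aeval ψ p := by
      intro p
      induction p using MvPolynomial.induction_on with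
      | C a => simp [Ψ, e]
      | add p r hp hr => simp [map_add, hp, hr]
      | mul_X p i hp =>
        rw [map_mul, map_mul, map_mul, hp, aeval_X]
        congr 1
        by_cases hi : i ∈ B
        · simp only [e, AlgEquiv.trans_apply, renameEquiv_apply, rename_X, Equiv.trans_apply,
            Equiv.Set.sumCompl_symm_apply_of_mem hi, Equiv.sumComm_apply, Sum.swap_inl]
          rw [sumAlgEquiv_X_inr]
          simp [Ψ]
        · simp only [e, AlgEquiv.trans_apply, renameEquiv_apply, rename_X, Equiv.trans_apply,
            Equiv.Set.sumCompl_symm_apply_of_notMem hi, Equiv.sumComm_apply, Sum.swap_inr]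
          rw [sumAlgEquiv_X_inl]
          simp [Ψ]
    have hker : RingHom.ker (aeval ψ : MvPolynomial ι k →ₐ[k] T)
        = (RingHom.ker Ψ).comap e.toRingEquiv := by
      ext p
      simp only [RingHom.mem_ker, Ideal.mem_comap]
      rw [← hcomp]; rfl
    rw [hker, e.toRingEquiv.height_comap]
    have : (RingHom.ker Ψ).IsPrime := RingHom.ker_isPrime Ψ
    apply height_eq_card_of_algebraic (FractionRing (MvPolynomial B k))
    · intro r hr
      have : aeval (fun b : B => ψ b) r = 0 := by simpa [Ψ, RingHom.mem_ker] using hr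
      exact hBi.eq_zero_of_aeval_eq_zero _ this
    · rintro ⟨i, hi⟩
      have := hopt i hi
      rw [algebraicIndependent_iff] at this
      push Not at this
      obtain ⟨p, hp, hp0⟩ := this
      refine ⟨optionEquivLeft k B p, by simpa using hp0, ?_⟩
      rw [RingHom.mem_ker, ← hp]
      clear hp hp0
      induction p using MvPolynomial.induction_on with
      | C a =>
        rw [optionEquivLeft_C, Polynomial.aeval_C, MvPolynomial.algebraMap_eq]
        simp [Ψ]
      | add p r hp hr => simp [map_add, hp, hr]
      | mul_X p i hp =>
        rw [map_mul, map_mul, map_mul, map_mul, hp, aeval_X]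
        congr 1
        rcases i with _ | b
        · rw [optionEquivLeft_X_none, Polynomial.aeval_X]; simp [Ψ]
        · rw [optionEquivLeft_X_some, Polynomial.aeval_C, MvPolynomial.algebraMap_eq]; simp [Ψ]

/-- A set of pairs parametrised by `m` parameters imposes at least `16 - m` conditions. -/
lemma le_numConditions {m : ℕ} {S : Set Pair} (ψ : CoeffIndex → MvPolynomial (Fin m) ℂ)
    (hS : ∀ c ∈ S, ∃ s : Fin m → ℂ, ∀ i, c i = eval s (ψ i)) :
    ((16 - m : ℕ) : ℕ∞) ≤ numConditions S := by
  obtain ⟨B, hB, -, hht⟩ := exists_algebraicIndependent_height_ker (k := ℂ) ψ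
  have hle : RingHom.ker (aeval ψ : MvPolynomial CoeffIndex ℂ →ₐ[ℂ] _) ≤ vanishingIdeal ℂ S := by
    intro p hp c hc
    obtain ⟨s, hs⟩ := hS c hc
    have h1 : aeval ψ p = 0 := hp
    have h2 : c = fun i => aeval s (ψ i) := funext fun i => by rw [hs i]; rfl
    have h3 := congrArg (aeval s) h1
    rw [← AlgHom.comp_apply, comp_aeval] at h3
    rw [h2, h3, map_zero]
  refine le_trans ?_ (Ideal.height_mono hle)
  rw [hht]
  norm_cast
  have hcard : Nat.card B ≤ m := by
    have h1 := hB.lift_cardinalMk_le_trdeg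
    rw [MvPolynomial.trdeg_of_isDomain] at h1
    have h2 : Cardinal.mk B ≤ m := by simpa using h1
    have h3 := Cardinal.toNat_le_toNat h2 (Cardinal.natCast_lt_aleph0)
    simpa [Nat.card] using h3
  classical
  have htot : Nat.card B + Nat.card ↥(Bᶜ) = 16 := by
    rw [← Nat.card_sum, Nat.card_congr (Equiv.Set.sumCompl B)]
    rw [Nat.card_eq_fintype_card]; rfl
  omega

/-- A polynomial that vanishes on a nonempty open set is zero. -/
lemma eq_zero_of_eval_eq_zero_on_open {m : ℕ} {O : Set (Fin m → ℂ)} (hO : IsOpen O)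
    (hne : O.Nonempty) (p : MvPolynomial (Fin m) ℂ) (hp : ∀ s ∈ O, eval s p = 0) : p = 0 := by
  obtain ⟨s₀, hs₀⟩ := hne
  obtain ⟨ε, hε, hball⟩ := Metric.isOpen_iff.1 hO s₀ hs₀
  refine funext_set (fun i => Metric.ball (s₀ i) ε) (fun i => ?_) (fun s hs => ?_)
  · exact infinite_of_mem_nhds (s₀ i) (Metric.ball_mem_nhds _ hε)
  · rw [map_zero]
    refine hp s (hball ?_)
    rw [Metric.mem_ball, dist_pi_lt_iff hε]
    exact fun i => hs i (Set.mem_univ i)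

/-- A set of pairs that contains the image of a generically finite parametrisation by `m`
parameters, restricted to a nonempty open set minus a hypersurface, imposes at most `16 - m`
conditions. -/
lemma numConditions_le {m : ℕ} {S : Set Pair} (ψ : CoeffIndex → MvPolynomial (Fin m) ℂ)
    (halg : ∀ x : MvPolynomial (Fin m) ℂ, IsAlgebraic (Algebra.adjoin ℂ (Set.range ψ)) x)
    {O : Set (Fin m → ℂ)} (hO : IsOpen O) (hne : O.Nonempty) {N : MvPolynomial (Fin m) ℂ}
    (hN : N ≠ 0) (hS : ∀ s ∈ O, eval s N ≠ 0 → (fun i => eval s (ψ i)) ∈ S) :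
    numConditions S ≤ ((16 - m : ℕ) : ℕ∞) := by
  obtain ⟨B, hB, hBalg, hht⟩ := exists_algebraicIndependent_height_ker (k := ℂ) ψ
  have hle : vanishingIdeal ℂ S ≤ RingHom.ker (aeval ψ : MvPolynomial CoeffIndex ℂ →ₐ[ℂ] _) := by
    intro p hp
    have h0 : aeval ψ p * N = 0 := by
      refine eq_zero_of_eval_eq_zero_on_open hO hne _ fun s hs => ?_
      rw [map_mul]
      by_cases hsN : eval s N = 0
      · rw [hsN, mul_zero]
      · have h1 := hp _ (hS s hs hsN)
        have h2 : eval s (aeval ψ p) = 0 := by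
          rw [← h1]
          change aeval s (aeval ψ p) = aeval (fun i => aeval s (ψ i)) p
          rw [← AlgHom.comp_apply, comp_aeval]
        rw [h2, zero_mul]
    exact (mul_eq_zero.1 h0).resolve_right hN
  refine (Ideal.height_mono hle).trans ?_
  rw [hht]
  norm_cast
  have hcard : m ≤ Nat.card B := by
    have halg2 : Algebra.IsAlgebraic (Algebra.adjoin ℂ (Set.range fun b : B => ψ b))
        (MvPolynomial (Fin m) ℂ) := by
      constructor
      intro x
      refine IsAlgebraic.adjoin_of_forall_isAlgebraic (s := Set.range ψ) ?_ (halg x)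
      rintro _ ⟨⟨i, rfl⟩, -⟩
      exact hBalg i
    have hbasis : IsTranscendenceBasis ℂ (fun b : B => ψ b) :=
      (hB.isTranscendenceBasis_iff_isAlgebraic).2 halg2
    have h1 := hbasis.lift_cardinalMk_eq_trdeg
    rw [MvPolynomial.trdeg_of_isDomain] at h1
    have h2 : Cardinal.mk B = m := by simpa using h1
    have h3 := congrArg Cardinal.toNat h2
    simp only [Cardinal.toNat_natCast] at h3
    exact h3.ge
  classical
  have htot : Nat.card B + Nat.card ↥(Bᶜ) = 16 := by
    rw [← Nat.card_sum, Nat.card_congr (Equiv.Set.sumCompl B)]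
    rw [Nat.card_eq_fintype_card]; rfl
  omega

lemma numConditions_mono {S T : Set Pair} (h : S ⊆ T) : numConditions T ≤ numConditions S :=
  Ideal.height_mono (vanishingIdeal_anti_mono h)

/-- Conditions on a union are counted on the part with the fewest: a minimal prime over the
intersection of the two ideals contains one of them. -/
lemma le_numConditions_union {S T : Set Pair} {n : ℕ∞} (hS : n ≤ numConditions S)
    (hT : n ≤ numConditions T) : n ≤ numConditions (S ∪ T) := by
  unfold numConditions
  rw [Ideal.height_eq_inf_minimalPrimes]
  refine le_iInf₂ fun J hJ => ?_
  have hJp : J.IsPrime := hJ.1.1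
  have hinf : vanishingIdeal ℂ S ⊓ vanishingIdeal ℂ T ≤ J := by
    refine le_trans (fun p hp => ?_) hJ.1.2
    rintro c (hc | hc)
    · exact hp.1 c hc
    · exact hp.2 c hc
  rcases hJp.inf_le.1 hinf with h | h
  · exact hS.trans (Ideal.height_mono h)
  · exact hT.trans (Ideal.height_mono h)

end TorusSextic

/-! ### Equivalence of germs -/

namespace TorusSextic

open MvPolynomial

/-- Contact equivalence of germs of functions on the plane: `GermEquiv` for arbitrary functions in
place of polynomials. -/
def FunGermEquiv (F : (Fin 2 → ℂ) → ℂ) (P : Fin 2 → ℂ) (G : (Fin 2 → ℂ) → ℂ) (Q : Fin 2 → ℂ) :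
    Prop :=
  ∃ (φ : (Fin 2 → ℂ) → (Fin 2 → ℂ)) (φ' : (Fin 2 → ℂ) ≃L[ℂ] (Fin 2 → ℂ))
    (u : (Fin 2 → ℂ) → ℂ),
    AnalyticAt ℂ φ Q ∧ φ Q = P ∧ HasFDerivAt φ (φ' : (Fin 2 → ℂ) →L[ℂ] (Fin 2 → ℂ)) Q ∧
    AnalyticAt ℂ u Q ∧ u Q ≠ 0 ∧ ∀ᶠ z in 𝓝 Q, F (φ z) = u z * G z

/-- The analytic inverse function theorem. -/
lemma exists_analytic_local_inverse {φ : (Fin 2 → ℂ) → (Fin 2 → ℂ)}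
    {φ' : (Fin 2 → ℂ) ≃L[ℂ] (Fin 2 → ℂ)} {Q : Fin 2 → ℂ} (hφ : AnalyticAt ℂ φ Q)
    (hφ' : HasFDerivAt φ (φ' : (Fin 2 → ℂ) →L[ℂ] (Fin 2 → ℂ)) Q) :
    ∃ ψ : (Fin 2 → ℂ) → (Fin 2 → ℂ), AnalyticAt ℂ ψ (φ Q) ∧ ψ (φ Q) = Q ∧
      HasFDerivAt ψ (φ'.symm : (Fin 2 → ℂ) →L[ℂ] (Fin 2 → ℂ)) (φ Q) ∧
      (∀ᶠ z in 𝓝 Q, ψ (φ z) = z) ∧ ∀ᶠ p in 𝓝 (φ Q), φ (ψ p) = p := by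
  have hs : HasStrictFDerivAt φ (φ' : (Fin 2 → ℂ) →L[ℂ] (Fin 2 → ℂ)) Q := by
    have := hφ.hasStrictFDerivAt
    rwa [hφ'.fderiv] at this
  refine ⟨hs.localInverse φ φ' Q, ?_, hs.localInverse_apply_image, hs.to_localInverse.hasFDerivAt,
    hs.eventually_left_inverse, hs.eventually_right_inverse⟩
  have h1 : ContDiffAt ℂ ⊤ φ Q := hφ.contDiffAt
  have h2 := h1.to_localInverse hφ' (by simp)
  exact h2.analyticAt

lemma FunGermEquiv.symm {F G : (Fin 2 → ℂ) → ℂ} {P Q : Fin 2 → ℂ} (h : FunGermEquiv F P G Q) :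
    FunGermEquiv G Q F P := by
  obtain ⟨φ, φ', u, hφ, rfl, hφ', hu, hu0, he⟩ := h
  obtain ⟨ψ, hψ, hψQ, hψ', hl, hr⟩ := exists_analytic_local_inverse hφ hφ'
  have huψ : AnalyticAt ℂ (fun p => u (ψ p)) (φ Q) :=
    AnalyticAt.comp (by rwa [hψQ]) hψ
  have hu0' : u (ψ (φ Q)) ≠ 0 := by rwa [hψQ]
  refine ⟨ψ, φ'.symm, fun p => (u (ψ p))⁻¹, hψ, hψQ, hψ', huψ.inv hu0', inv_ne_zero hu0', ?_⟩
  have ht : Filter.Tendsto ψ (𝓝 (φ Q)) (𝓝 Q) := by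
    have := hψ.continuousAt.tendsto
    rwa [hψQ] at this
  filter_upwards [hr, ht.eventually he, huψ.continuousAt.eventually_ne hu0'] with p h1 h2 h3
  rw [h1] at h2
  rw [h2]
  field_simp

lemma FunGermEquiv.trans {F G H : (Fin 2 → ℂ) → ℂ} {P Q R : Fin 2 → ℂ}
    (h₁ : FunGermEquiv F P G Q) (h₂ : FunGermEquiv G Q H R) : FunGermEquiv F P H R := by
  obtain ⟨φ, φ', u, hφ, rfl, hφ', hu, hu0, he⟩ := h₁
  obtain ⟨χ, χ', v, hχ, rfl, hχ', hv, hv0, he'⟩ := h₂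
  refine ⟨φ ∘ χ, χ'.trans φ', fun z => u (χ z) * v z, hφ.comp hχ, rfl, ?_,
    AnalyticAt.mul (AnalyticAt.comp hu hχ) hv, mul_ne_zero hu0 hv0, ?_⟩
  · exact hφ'.comp R hχ'
  · filter_upwards [he', hχ.continuousAt.tendsto.eventually he] with z h1 h2
    simp only [Function.comp_apply]
    rw [h2, h1]; ring

/-- The components of a local analytic change of coordinates at the origin, in Hadamard form. -/
lemma hasFDerivAt_of_eq_linear_combination {X Y A B C D : (Fin 2 → ℂ) → ℂ}
    (hA : AnalyticAt ℂ A 0) (hB : AnalyticAt ℂ B 0) (hC : AnalyticAt ℂ C 0)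
    (hD : AnalyticAt ℂ D 0) (hX : ∀ z, X z = z 0 * A z + z 1 * B z)
    (hY : ∀ z, Y z = z 0 * C z + z 1 * D z) (hdet : A 0 * D 0 - B 0 * C 0 ≠ 0) :
    AnalyticAt ℂ (fun z => ![X z, Y z]) 0 ∧
    ∃ φ' : (Fin 2 → ℂ) ≃L[ℂ] (Fin 2 → ℂ),
      HasFDerivAt (fun z => ![X z, Y z]) (φ' : (Fin 2 → ℂ) →L[ℂ] (Fin 2 → ℂ)) 0 := by
  have hx0 : AnalyticAt ℂ (fun z : Fin 2 → ℂ => z 0) 0 :=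
    (ContinuousLinearMap.proj (R := ℂ) (φ := fun _ : Fin 2 => ℂ) 0).analyticAt 0
  have hx1 : AnalyticAt ℂ (fun z : Fin 2 → ℂ => z 1) 0 :=
    (ContinuousLinearMap.proj (R := ℂ) (φ := fun _ : Fin 2 => ℂ) 1).analyticAt 0
  have hXa : AnalyticAt ℂ X 0 := by
    rw [funext hX]; exact (hx0.mul hA).add (hx1.mul hB)
  have hYa : AnalyticAt ℂ Y 0 := by
    rw [funext hY]; exact (hx0.mul hC).add (hx1.mul hD)
  refine ⟨?_, ?_⟩
  · refine AnalyticAt.pi fun i => ?_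
    fin_cases i
    · exact hXa
    · exact hYa
  · let M : Matrix (Fin 2) (Fin 2) ℂ := !![A 0, B 0; C 0, D 0]
    have hM : IsUnit M.det := by
      rw [Matrix.det_fin_two]
      simpa [M] using hdet
    let e : (Fin 2 → ℂ) ≃ₗ[ℂ] (Fin 2 → ℂ) := Matrix.toLinearEquiv' M
      ((Matrix.isUnit_iff_isUnit_det M).2 hM).invertible
    refine ⟨e.toContinuousLinearEquiv, ?_⟩
    rw [hasFDerivAt_pi']
    have hp0 : HasFDerivAt (fun z : Fin 2 → ℂ => z 0)
        (ContinuousLinearMap.proj (R := ℂ) (φ := fun _ : Fin 2 => ℂ) 0) 0 :=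
      (ContinuousLinearMap.proj (R := ℂ) (φ := fun _ : Fin 2 => ℂ) 0).hasFDerivAt
    have hp1 : HasFDerivAt (fun z : Fin 2 → ℂ => z 1)
        (ContinuousLinearMap.proj (R := ℂ) (φ := fun _ : Fin 2 => ℂ) 1) 0 :=
      (ContinuousLinearMap.proj (R := ℂ) (φ := fun _ : Fin 2 => ℂ) 1).hasFDerivAt
    intro i
    fin_cases i
    · have := (hp0.mul hA.differentiableAt.hasFDerivAt).add
        (hp1.mul hB.differentiableAt.hasFDerivAt)
      simp only [Fin.zero_eta, Matrix.cons_val_zero]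
      rw [funext hX]
      refine this.congr_fderiv ?_
      ext v
      have he : (e v) 0 = (M.mulVec v) 0 := rfl
      simp [he, M, Matrix.mulVec, dotProduct, Fin.sum_univ_two]
    · have := (hp0.mul hC.differentiableAt.hasFDerivAt).add
        (hp1.mul hD.differentiableAt.hasFDerivAt)
      simp only [Fin.mk_one, Matrix.cons_val_one]
      rw [funext hY]
      refine this.congr_fderiv ?_
      ext v
      have he : (e v) 1 = (M.mulVec v) 1 := rfl
      simp [he, M, Matrix.mulVec, dotProduct, Fin.sum_univ_two]

/-- If `F = v * G(X, Y)` near the origin, `(X, Y)` being analytic coordinates and `v` a unit, then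
the germs of `F` and `G` are equivalent. -/
lemma funGermEquiv_of_coordinates {F G X Y A B C D v : (Fin 2 → ℂ) → ℂ}
    (hA : AnalyticAt ℂ A 0) (hB : AnalyticAt ℂ B 0) (hC : AnalyticAt ℂ C 0)
    (hD : AnalyticAt ℂ D 0) (hX : ∀ z, X z = z 0 * A z + z 1 * B z)
    (hY : ∀ z, Y z = z 0 * C z + z 1 * D z) (hdet : A 0 * D 0 - B 0 * C 0 ≠ 0)
    (hv : AnalyticAt ℂ v 0) (hv0 : v 0 ≠ 0)
    (he : ∀ᶠ z in 𝓝 0, F z = v z * G ![X z, Y z]) : FunGermEquiv F 0 G 0 := by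
  obtain ⟨h1, φ', h2⟩ := hasFDerivAt_of_eq_linear_combination hA hB hC hD hX hY hdet
  refine FunGermEquiv.symm ⟨_, φ', fun z => (v z)⁻¹, h1, ?_, h2, hv.inv hv0, inv_ne_zero hv0, ?_⟩
  · ext i; fin_cases i
    · simp [hX]
    · simp [hY]
  · filter_upwards [he, hv.continuousAt.eventually_ne hv0] with z h3 h4
    rw [h3]; field_simp

/-- Hadamard's lemma for analytic functions of two variables. -/
lemma exists_hadamard {h : (Fin 2 → ℂ) → ℂ} (hh : AnalyticAt ℂ h 0) :
    ∃ a b : (Fin 2 → ℂ) → ℂ, AnalyticAt ℂ a 0 ∧ AnalyticAt ℂ b 0 ∧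
      ∀ᶠ z in 𝓝 0, h z = h 0 + z 0 * a z + z 1 * b z := by
  obtain ⟨p, r, hp⟩ := hh
  have hr : 0 < p.shift.radius := by
    rw [p.radius_shift]; exact hp.r_pos.trans_le hp.r_le
  have hq := (p.shift.hasFPowerSeriesOnBall hr).analyticAt
  have happ : ∀ v : Fin 2 → ℂ, AnalyticAt ℂ (fun z => p.shift.sum z v) 0 := fun v =>
    ((ContinuousLinearMap.apply ℂ ℂ v).analyticAt _).comp hq
  refine ⟨fun z => p.shift.sum z (Pi.single 0 1), fun z => p.shift.sum z (Pi.single 1 1),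
    happ _, happ _, ?_⟩
  have h1 := (p.shift.hasFPowerSeriesOnBall hr).unshift (z := h 0)
  have h2 : p.shift.unshift (h 0) = p := by
    funext n
    rcases n with _ | n
    · ext v
      simp only [FormalMultilinearSeries.unshift]
      rw [Subsingleton.elim v 0]
      simpa using (hp.coeff_zero 0).symm
    · ext v
      simp [FormalMultilinearSeries.unshift, FormalMultilinearSeries.shift]
  rw [h2] at h1
  have h3 : ∀ᶠ z in 𝓝 (0 : Fin 2 → ℂ), h z = h 0 + p.shift.sum z (z - 0) := by
    have e1 : ∀ᶠ z in 𝓝 (0 : Fin 2 → ℂ), z ∈ Metric.eball (0 : Fin 2 → ℂ) r :=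
      Metric.eball_mem_nhds _ hp.r_pos
    have e2 : ∀ᶠ z in 𝓝 (0 : Fin 2 → ℂ), z ∈ Metric.eball (0 : Fin 2 → ℂ) p.shift.radius :=
      Metric.eball_mem_nhds _ hr
    filter_upwards [e1, e2] with z hz1 hz2
    have s1 := hp.hasSum hz1
    have s2 := h1.hasSum hz2
    simp only [zero_add] at s1 s2
    exact s1.unique s2
  filter_upwards [h3] with z hz
  have hz2 : z - 0 = z 0 • (Pi.single 0 1 : Fin 2 → ℂ) + z 1 • (Pi.single 1 1 : Fin 2 → ℂ) := by
    ext i; fin_cases i <;> simp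
  rw [hz, hz2, map_add, map_smul, map_smul, smul_eq_mul, smul_eq_mul]
  ring

/-- A nonvanishing analytic germ has analytic roots. -/
lemma exists_analytic_root {A : (Fin 2 → ℂ) → ℂ} (hA : AnalyticAt ℂ A 0) (hA0 : A 0 ≠ 0) {n : ℕ}
    (hn : n ≠ 0) :
    ∃ r : (Fin 2 → ℂ) → ℂ, AnalyticAt ℂ r 0 ∧ r 0 ≠ 0 ∧ ∀ z, r z ^ n = A z := by
  obtain ⟨c, hc⟩ := IsAlgClosed.exists_pow_nat_eq (A 0) (Nat.pos_of_ne_zero hn)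
  have hc0 : c ≠ 0 := by
    rintro rfl
    rw [zero_pow hn] at hc
    exact hA0 hc.symm
  have hpow : ∀ z, (c * (A z / A 0) ^ ((n : ℂ)⁻¹)) ^ n = A z := by
    intro z
    rw [mul_pow, hc, Complex.cpow_nat_inv_pow _ hn]
    field_simp
  refine ⟨fun z => c * (A z / A 0) ^ ((n : ℂ)⁻¹), ?_, ?_, hpow⟩
  · refine analyticAt_const.mul (AnalyticAt.cpow (hA.div_const) analyticAt_const ?_)
    rw [div_self hA0]
    exact Complex.one_mem_slitPlane
  · intro h
    have := hpow 0
    simp only at h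
    rw [h, zero_pow hn] at this
    exact hA0 this.symm

/-- The analytic implicit function theorem for one scalar unknown. -/
lemma exists_analytic_implicit {G : (Fin 2 → ℂ) × ℂ → ℂ} {s₀ g' : ℂ}
    (hG : AnalyticAt ℂ G (0, s₀)) (h0 : G (0, s₀) = 0)
    (hg : HasDerivAt (fun s => G (0, s)) g' s₀) (hg0 : g' ≠ 0) :
    ∃ s : (Fin 2 → ℂ) → ℂ, AnalyticAt ℂ s 0 ∧ s 0 = s₀ ∧ ∀ᶠ z in 𝓝 0, G (z, s z) = 0 := by
  have hc : ContDiffAt ℂ ⊤ G (0, s₀) := hG.contDiffAt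
  have hinv : (fderiv ℂ G (0, s₀) ∘L .inr ℂ (Fin 2 → ℂ) ℂ).IsInvertible := by
    refine ⟨ContinuousLinearEquiv.unitsEquivAut ℂ (Units.mk0 g' hg0), ?_⟩
    have h1 : HasFDerivAt (fun s => G (0, s))
        (fderiv ℂ G (0, s₀) ∘L .inr ℂ (Fin 2 → ℂ) ℂ) s₀ := by
      have h2 : HasFDerivAt (fun s : ℂ => ((0 : Fin 2 → ℂ), s)) (.inr ℂ (Fin 2 → ℂ) ℂ) s₀ :=
        hasFDerivAt_prodMk_right _ _
      exact hG.differentiableAt.hasFDerivAt.comp s₀ h2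
    rw [h1.unique hg.hasFDerivAt]
    ext
    simp
  refine ⟨hc.implicitFunction (by simp) hinv, ?_, hc.implicitFunction_apply_self (by simp) hinv, ?_⟩
  · exact (hc.contDiffAt_implicitFunction (by simp) hinv).analyticAt
  · have := hc.eventually_apply_implicitFunction (by simp) hinv
    rw [h0] at this
    exact this

end TorusSextic

/-! ### Recognition of simple singularities -/

namespace TorusSextic

open MvPolynomial

lemma analyticAt_coord (i : Fin 2) (z₀ : Fin 2 → ℂ) :
    AnalyticAt ℂ (fun z : Fin 2 → ℂ => z i) z₀ :=
  (ContinuousLinearMap.proj (R := ℂ) (φ := fun _ : Fin 2 => ℂ) i).analyticAt z₀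

/-- Recognition of `A_n`: after completing the square, `A x ^ (n + 1) + B x ^ M y + C y ^ 2` with
`n + 1 ≤ 2 M` is the sum of a square and of an `(n + 1)`-st power. -/
lemma funGermEquiv_A {F A B C : (Fin 2 → ℂ) → ℂ} {n M : ℕ} (hM : 1 ≤ M) (hMn : n + 1 ≤ 2 * M)
    (hA : AnalyticAt ℂ A 0) (hB : AnalyticAt ℂ B 0) (hC : AnalyticAt ℂ C 0) (hC0 : C 0 ≠ 0)
    (hnd : A 0 - B 0 ^ 2 * 0 ^ (2 * M - (n + 1)) / (4 * C 0) ≠ 0)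
    (he : ∀ᶠ z in 𝓝 0, F z = A z * z 0 ^ (n + 1) + B z * z 0 ^ M * z 1 + C z * z 1 ^ 2) :
    FunGermEquiv F 0 (fun z => eval z (SingType.A n).normalForm) 0 := by
  have hx := analyticAt_coord 0 0
  have h4C : AnalyticAt ℂ (fun z => B z ^ 2 * z 0 ^ (2 * M - (n + 1)) / (4 * C z)) 0 :=
    ((hB.pow 2).mul (hx.pow _)).div (analyticAt_const.mul hC) (by simpa using hC0)
  obtain ⟨q, hq, hq0, hqC⟩ := exists_analytic_root hC hC0 two_ne_zero
  obtain ⟨r, hr, hr0, hrA⟩ := exists_analytic_root (hA.sub h4C) (by simpa using hnd)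
    (Nat.succ_ne_zero n)
  have h2C : AnalyticAt ℂ (fun z => q z * (B z * z 0 ^ (M - 1)) / (2 * C z)) 0 :=
    (hq.mul (hB.mul (hx.pow _))).div (analyticAt_const.mul hC) (by simpa using hC0)
  refine funGermEquiv_of_coordinates (X := fun z => z 0 * r z + z 1 * 0)
    (Y := fun z => z 0 * (q z * (B z * z 0 ^ (M - 1)) / (2 * C z)) + z 1 * q z)
    hr analyticAt_const h2C hq (fun _ => rfl) (fun _ => rfl) ?_
    (analyticAt_const (v := (1 : ℂ))) one_ne_zero ?_
  · simpa using mul_ne_zero hr0 hq0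
  filter_upwards [he, hC.continuousAt.eventually_ne hC0] with z h1 h2
  have h3 : z 0 ^ M = z 0 * z 0 ^ (M - 1) := by rw [← pow_succ']; congr 1; omega
  have h4 : (z 0 * z 0 ^ (M - 1)) ^ 2 = z 0 ^ (n + 1) * z 0 ^ (2 * M - (n + 1)) := by
    rw [← h3, ← pow_mul, ← pow_add]; congr 1; omega
  have h5 := hqC z
  have h6 := hrA z
  simp only [Nat.succ_eq_add_one, Pi.sub_apply] at h6
  simp only [SingType.normalForm, map_add, map_pow, eval_X, Matrix.cons_val_zero,
    Matrix.cons_val_one, mul_zero, add_zero, one_mul]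
  rw [mul_pow, h6, h1, h3]
  have h7 : z 0 * (q z * (B z * z 0 ^ (M - 1)) / (2 * C z)) + z 1 * q z
      = q z * (B z * (z 0 * z 0 ^ (M - 1)) / (2 * C z) + z 1) := by ring
  rw [h7, mul_pow, h5]
  have h8 : C z * (B z * (z 0 * z 0 ^ (M - 1)) / (2 * C z) + z 1) ^ 2
      = B z ^ 2 * (z 0 * z 0 ^ (M - 1)) ^ 2 / (4 * C z) + B z * (z 0 * z 0 ^ (M - 1)) * z 1
        + C z * z 1 ^ 2 := by
    field_simp; ring
  rw [h8, h4]
  ring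

/-- Recognition of `D_k`, `k = j + 4`, from a factorisation with a smooth branch
`X = x - y ^ 2 s = 0`. -/
lemma funGermEquiv_D_of_factor {F A B C s : (Fin 2 → ℂ) → ℂ} {j : ℕ}
    (hA : AnalyticAt ℂ A 0) (hB : AnalyticAt ℂ B 0) (hC : AnalyticAt ℂ C 0)
    (hs : AnalyticAt ℂ s 0) (hC0 : C 0 ≠ 0)
    (hnd : A 0 - B 0 ^ 2 * 0 ^ j / (4 * C 0) ≠ 0)
    (he : ∀ᶠ z in 𝓝 0, F z = (z 0 - z 1 ^ 2 * s z) * (A z * (z 0 - z 1 ^ 2 * s z) ^ (j + 2) +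
      B z * (z 0 - z 1 ^ 2 * s z) ^ (j + 1) * z 1 + C z * z 1 ^ 2)) :
    FunGermEquiv F 0 (fun z => eval z (SingType.D (j + 4)).normalForm) 0 := by
  have hx := analyticAt_coord 0 0
  have hy := analyticAt_coord 1 0
  let X : (Fin 2 → ℂ) → ℂ := fun z => z 0 - z 1 ^ 2 * s z
  have hX : AnalyticAt ℂ X 0 := hx.sub ((hy.pow 2).mul hs)
  have hX0 : X 0 = 0 := by simp [X]
  have h4C : AnalyticAt ℂ (fun z => B z ^ 2 * X z ^ j / (4 * C z)) 0 :=
    ((hB.pow 2).mul (hX.pow _)).div (analyticAt_const.mul hC) (by simpa using hC0)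
  obtain ⟨r, hr, hr0, hrA⟩ := exists_analytic_root (hA.sub h4C) (by simpa [hX0] using hnd)
    (Nat.succ_ne_zero (j + 2))
  obtain ⟨q, hq, hq0, hqC⟩ := exists_analytic_root (hC.div hr hr0)
    (by simpa using ⟨hC0, hr0⟩) two_ne_zero
  have h2C : AnalyticAt ℂ (fun z => q z * (B z * X z ^ j) / (2 * C z)) 0 :=
    (hq.mul (hB.mul (hX.pow _))).div (analyticAt_const.mul hC) (by simpa using hC0)
  refine funGermEquiv_of_coordinates (X := fun z => z 0 * r z + z 1 * (-(z 1 * s z) * r z))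
    (Y := fun z => z 0 * (q z * (B z * X z ^ j) / (2 * C z)) +
      z 1 * (q z - z 1 * s z * (q z * (B z * X z ^ j) / (2 * C z))))
    hr ((hy.mul hs).neg.mul hr) h2C (hq.sub ((hy.mul hs).mul h2C)) (fun _ => rfl) (fun _ => rfl) ?_
    (analyticAt_const (v := (1 : ℂ))) one_ne_zero ?_
  · simpa using mul_ne_zero hr0 hq0
  filter_upwards [he, hC.continuousAt.eventually_ne hC0, hr.continuousAt.eventually_ne hr0]
    with z h1 h2 h3
  have h5 : q z ^ 2 = C z / r z := hqC z
  have h6 : r z ^ (j + 3) = A z - B z ^ 2 * X z ^ j / (4 * C z) := hrA z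
  have h7 : z 0 * r z + z 1 * (-(z 1 * s z) * r z) = X z * r z := by simp only [X]; ring
  have h8 : z 0 * (q z * (B z * X z ^ j) / (2 * C z)) +
      z 1 * (q z - z 1 * s z * (q z * (B z * X z ^ j) / (2 * C z)))
      = q z * (B z * X z ^ (j + 1) / (2 * C z) + z 1) := by
    simp only [X]; ring
  have hk : j + 4 - 1 = j + 3 := by omega
  simp only [SingType.normalForm, map_add, map_mul, map_pow, eval_X, Matrix.cons_val_zero,
    Matrix.cons_val_one, one_mul, h7, h8, hk]
  change F z = X z * (A z * X z ^ (j + 2) + B z * X z ^ (j + 1) * z 1 + C z * z 1 ^ 2) at h1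
  rw [h1, mul_pow, mul_pow, h5, h6]
  field_simp
  ring

/-- Recognition of `D₄`; the term `D y ^ 4` is absorbed into the smooth branch by the implicit
function theorem. -/
lemma funGermEquiv_D4 {F A B C D : (Fin 2 → ℂ) → ℂ}
    (hA : AnalyticAt ℂ A 0) (hB : AnalyticAt ℂ B 0) (hC : AnalyticAt ℂ C 0)
    (hD : AnalyticAt ℂ D 0) (hC0 : C 0 ≠ 0)
    (hnd : 4 * A 0 * C 0 ≠ B 0 ^ 2)
    (he : ∀ᶠ z in 𝓝 0, F z = A z * z 0 ^ 3 + B z * z 0 ^ 2 * z 1 + C z * z 0 * z 1 ^ 2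
      + D z * z 1 ^ 4) :
    FunGermEquiv F 0 (fun z => eval z (SingType.D 4).normalForm) 0 := by
  have hy := analyticAt_coord 1 0
  -- `G = 0` says that `F` vanishes formally at `x = y ^ 2 s`, the coefficients being frozen.
  let G : (Fin 2 → ℂ) × ℂ → ℂ := fun w => A w.1 * w.1 1 ^ 2 * w.2 ^ 3 + B w.1 * w.1 1 * w.2 ^ 2
    + C w.1 * w.2 + D w.1
  have hfst : ∀ {f : (Fin 2 → ℂ) → ℂ} (s₀ : ℂ), AnalyticAt ℂ f 0 →
      AnalyticAt ℂ (fun w : (Fin 2 → ℂ) × ℂ => f w.1) (0, s₀) := fun s₀ hf =>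
    AnalyticAt.comp (g := _) (f := Prod.fst) (by exact hf) analyticAt_fst
  have hG : AnalyticAt ℂ G (0, -D 0 / C 0) :=
    ((((hfst _ hA).mul ((hfst _ hy).pow 2)).mul (analyticAt_snd.pow 3)).add
      (((hfst _ hB).mul (hfst _ hy)).mul (analyticAt_snd.pow 2))).add
      ((hfst _ hC).mul analyticAt_snd) |>.add (hfst _ hD)
  have hder : HasDerivAt (fun s => G (0, s)) (C 0) (-D 0 / C 0) := by
    have : (fun s => G (0, s)) = fun s => C 0 * s + D 0 := by
      funext s; simp [G]
    rw [this]
    simpa using ((hasDerivAt_id (-D 0 / C 0)).const_mul (C 0)).add_const (D 0)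
  obtain ⟨s, hs, -, hGs⟩ := exists_analytic_implicit hG
    (by simp [G]; field_simp; ring) hder hC0
  refine funGermEquiv_D_of_factor (j := 0) (A := A) (B := fun z => B z + 3 * A z * z 1 * s z)
    (C := fun z => C z + 2 * B z * z 1 * s z + 3 * A z * z 1 ^ 2 * s z ^ 2) hA
    (hB.add (((analyticAt_const.mul hA).mul hy).mul hs))
    ((hC.add (((analyticAt_const.mul hB).mul hy).mul hs)).add
      (((analyticAt_const.mul hA).mul (hy.pow 2)).mul (hs.pow 2))) hs (by simpa using hC0) ?_ ?_
  · simp only [Pi.zero_apply, mul_zero, zero_mul, add_zero, pow_zero, mul_one]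
    intro h
    apply hnd
    simp only [ne_eq, OfNat.ofNat_ne_zero, not_false_eq_true, zero_pow, mul_zero, zero_mul,
      add_zero] at h
    field_simp at h
    linear_combination h
  · filter_upwards [he, hGs] with z h1 h2
    rw [h1]
    linear_combination (z 1 ^ 4) * h2

/-- Recognition of `D₅`, by the same elimination of `D y ^ 4`. -/
lemma funGermEquiv_D5 {F A B C D : (Fin 2 → ℂ) → ℂ}
    (hA : AnalyticAt ℂ A 0) (hB : AnalyticAt ℂ B 0) (hC : AnalyticAt ℂ C 0)
    (hD : AnalyticAt ℂ D 0) (hC0 : C 0 ≠ 0) (hA0 : A 0 ≠ 0)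
    (he : ∀ᶠ z in 𝓝 0, F z = A z * z 0 ^ 4 + B z * z 0 ^ 3 * z 1 + C z * z 0 * z 1 ^ 2
      + D z * z 1 ^ 4) :
    FunGermEquiv F 0 (fun z => eval z (SingType.D 5).normalForm) 0 := by
  have hy := analyticAt_coord 1 0
  have hx := analyticAt_coord 0 0
  let G : (Fin 2 → ℂ) × ℂ → ℂ := fun w => A w.1 * w.1 1 ^ 4 * w.2 ^ 4
    + B w.1 * w.1 1 ^ 3 * w.2 ^ 3 + C w.1 * w.2 + D w.1
  have hfst : ∀ {f : (Fin 2 → ℂ) → ℂ} (s₀ : ℂ), AnalyticAt ℂ f 0 →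
      AnalyticAt ℂ (fun w : (Fin 2 → ℂ) × ℂ => f w.1) (0, s₀) := fun s₀ hf =>
    AnalyticAt.comp (g := _) (f := Prod.fst) (by exact hf) analyticAt_fst
  have hG : AnalyticAt ℂ G (0, -D 0 / C 0) :=
    ((((hfst _ hA).mul ((hfst _ hy).pow 4)).mul (analyticAt_snd.pow 4)).add
      (((hfst _ hB).mul ((hfst _ hy).pow 3)).mul (analyticAt_snd.pow 3))).add
      ((hfst _ hC).mul analyticAt_snd) |>.add (hfst _ hD)
  have hder : HasDerivAt (fun s => G (0, s)) (C 0) (-D 0 / C 0) := by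
    have : (fun s => G (0, s)) = fun s => C 0 * s + D 0 := by
      funext s; simp [G]
    rw [this]
    simpa using ((hasDerivAt_id (-D 0 / C 0)).const_mul (C 0)).add_const (D 0)
  obtain ⟨s, hs, -, hGs⟩ := exists_analytic_implicit hG
    (by simp [G]; field_simp; ring) hder hC0
  have hX : AnalyticAt ℂ (fun z => z 0 - z 1 ^ 2 * s z) 0 := hx.sub ((hy.pow 2).mul hs)
  refine funGermEquiv_D_of_factor (j := 1) (A := A) (B := fun z => B z + 4 * A z * z 1 * s z)
    (C := fun z => C z + 6 * A z * (z 0 - z 1 ^ 2 * s z) * z 1 ^ 2 * s z ^ 2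
      + 4 * A z * z 1 ^ 4 * s z ^ 3 + 3 * B z * (z 0 - z 1 ^ 2 * s z) * z 1 * s z
      + 3 * B z * z 1 ^ 3 * s z ^ 2) hA
    (hB.add (((analyticAt_const.mul hA).mul hy).mul hs))
    ((((hC.add ((((analyticAt_const.mul hA).mul hX).mul (hy.pow 2)).mul (hs.pow 2))).add
      (((analyticAt_const.mul hA).mul (hy.pow 4)).mul (hs.pow 3))).add
      ((((analyticAt_const.mul hB).mul hX).mul hy).mul hs)).add
      (((analyticAt_const.mul hB).mul (hy.pow 3)).mul (hs.pow 2))) hs (by simpa using hC0)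
      (by simpa using hA0) ?_
  filter_upwards [he, hGs] with z h1 h2
  rw [h1]
  linear_combination (z 1 ^ 4) * h2

/-- Recognition of `E₆`: completing the fourth power in `x` and then the cube in `y`. -/
lemma funGermEquiv_E6 {F A B C D : (Fin 2 → ℂ) → ℂ}
    (hA : AnalyticAt ℂ A 0) (hB : AnalyticAt ℂ B 0) (hC : AnalyticAt ℂ C 0)
    (hD : AnalyticAt ℂ D 0) (hA0 : A 0 ≠ 0) (hD0 : D 0 ≠ 0)
    (he : ∀ᶠ z in 𝓝 0, F z = A z * z 0 ^ 4 + B z * z 0 ^ 3 * z 1 + C z * z 0 ^ 2 * z 1 ^ 2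
      + D z * z 1 ^ 3) :
    FunGermEquiv F 0 (fun z => eval z SingType.E6.normalForm) 0 := by
  have hx := analyticAt_coord 0 0
  have hy := analyticAt_coord 1 0
  let e : (Fin 2 → ℂ) → ℂ := fun z => B z / (4 * A z)
  have hea : AnalyticAt ℂ e 0 := hB.div (analyticAt_const.mul hA) (by simpa using hA0)
  let X : (Fin 2 → ℂ) → ℂ := fun z => z 0 + e z * z 1
  have hX : AnalyticAt ℂ X 0 := hx.add (hea.mul hy)
  have hX0 : X 0 = 0 := by simp [X]
  let C' : (Fin 2 → ℂ) → ℂ := fun z => C z - 6 * A z * e z ^ 2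
  have hC' : AnalyticAt ℂ C' 0 := hC.sub ((analyticAt_const.mul hA).mul (hea.pow 2))
  let D' : (Fin 2 → ℂ) → ℂ := fun z => D z - 4 * A z * e z ^ 3 * z 0 - A z * e z ^ 4 * z 1
    - 2 * C' z * e z * X z + C' z * e z ^ 2 * z 1
  have hD' : AnalyticAt ℂ D' 0 :=
    (((hD.sub (((analyticAt_const.mul hA).mul (hea.pow 3)).mul hx)).sub
      ((hA.mul (hea.pow 4)).mul hy)).sub
      (((analyticAt_const.mul hC').mul hea).mul hX)).add ((hC'.mul (hea.pow 2)).mul hy)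
  have hD'0 : D' 0 ≠ 0 := by simpa [D', hX0] using hD0
  let c : (Fin 2 → ℂ) → ℂ := fun z => C' z / (3 * D' z)
  have hca : AnalyticAt ℂ c 0 := hC'.div (analyticAt_const.mul hD') (by simpa using hD'0)
  let A' : (Fin 2 → ℂ) → ℂ := fun z => A z - C' z * c z * z 1 - D' z * c z ^ 3 * X z ^ 2
  have hA' : AnalyticAt ℂ A' 0 := (hA.sub ((hC'.mul hca).mul hy)).sub
    ((hD'.mul (hca.pow 3)).mul (hX.pow 2))
  obtain ⟨r, hr, hr0, hrA⟩ := exists_analytic_root hA' (by simpa [A', hX0] using hA0)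
    (n := 4) (by norm_num)
  obtain ⟨q, hq, hq0, hqD⟩ := exists_analytic_root hD' hD'0 (n := 3) (by norm_num)
  refine funGermEquiv_of_coordinates (X := fun z => z 0 * r z + z 1 * (e z * r z))
    (Y := fun z => z 0 * (q z * (c z * X z)) + z 1 * (q z + q z * (c z * X z * e z)))
    hr (hea.mul hr) (hq.mul (hca.mul hX)) (hq.add (hq.mul ((hca.mul hX).mul hea)))
    (fun _ => rfl) (fun _ => rfl) ?_ (analyticAt_const (v := (1 : ℂ))) one_ne_zero ?_
  · simpa [hX0] using mul_ne_zero hr0 hq0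
  filter_upwards [he, hA.continuousAt.eventually_ne hA0, hD'.continuousAt.eventually_ne hD'0]
    with z h1 h2 h3
  have h4 : B z = 4 * A z * e z := by simp only [e]; field_simp
  have h5 : C' z = 3 * D' z * c z := by simp only [c]; field_simp
  have h6 : z 0 * r z + z 1 * (e z * r z) = X z * r z := by simp only [X]; ring
  have h7 : z 0 * (q z * (c z * X z)) + z 1 * (q z + q z * (c z * X z * e z))
      = q z * (z 1 + c z * X z ^ 2) := by simp only [X]; ring
  have h8 : F z = A z * X z ^ 4 + C' z * X z ^ 2 * z 1 ^ 2 + D' z * z 1 ^ 3 := by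
    rw [h1, h4]; simp only [D', C', X]; ring
  have h9 : r z ^ 4 = A z - C' z * c z * z 1 - D' z * c z ^ 3 * X z ^ 2 := hrA z
  have h10 : q z ^ 3 = D' z := hqD z
  simp only [SingType.normalForm, map_add, map_pow, eval_X, Matrix.cons_val_zero,
    Matrix.cons_val_one, one_mul, h6, h7]
  rw [h8, mul_pow, mul_pow, h9, h10, h5]
  ring

end TorusSextic

/-! ### Invariance of the Milnor number -/

namespace TorusSextic

open MvPolynomial

lemma hasFDerivAt_eval (f : MvPolynomial (Fin 2) ℂ) (z : Fin 2 → ℂ) :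
    HasFDerivAt (fun z => eval z f)
      (eval z (pderiv 0 f) • ContinuousLinearMap.proj (R := ℂ) (φ := fun _ : Fin 2 => ℂ) 0 +
        eval z (pderiv 1 f) • ContinuousLinearMap.proj (R := ℂ) (φ := fun _ : Fin 2 => ℂ) 1) z := by
  induction f using MvPolynomial.induction_on with
  | C a =>
    simp only [eval_C, pderiv_C, map_zero]
    exact (hasFDerivAt_const (𝕜 := ℂ) a z).congr_fderiv (by ext v; simp)
  | add p q hp hq =>
    simp only [map_add]
    refine (hp.add hq).congr_fderiv ?_
    ext v
    simp
    ring
  | mul_X p i hp =>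
    have hX : HasFDerivAt (fun z : Fin 2 → ℂ => z i)
        (ContinuousLinearMap.proj (R := ℂ) (φ := fun _ : Fin 2 => ℂ) i) z :=
      (ContinuousLinearMap.proj (R := ℂ) (φ := fun _ : Fin 2 => ℂ) i).hasFDerivAt
    simp only [map_mul, eval_X]
    refine (hp.mul hX).congr_fderiv ?_
    ext v
    fin_cases i
    · simp [pderiv_X]; ring
    · simp [pderiv_X]; ring

lemma analyticAt_eval (f : MvPolynomial (Fin 2) ℂ) (P : Fin 2 → ℂ) :
    AnalyticAt ℂ (fun z => eval z f) P := by
  induction f using MvPolynomial.induction_on with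
  | C a => simpa using analyticAt_const
  | add p q hp hq => simp only [map_add]; exact hp.add hq
  | mul_X p i hp => simp only [map_mul, eval_X]; exact hp.mul (analyticAt_coord i P)

/-- `h` lies in the Jacobian ideal of the function `F` at `P`: near `P` it is the derivative of `F`
along an analytic vector field. -/
def InJacobian (F : (Fin 2 → ℂ) → ℂ) (P : Fin 2 → ℂ) (h : (Fin 2 → ℂ) → ℂ) : Prop :=
  ∃ W : (Fin 2 → ℂ) → (Fin 2 → ℂ), AnalyticAt ℂ W P ∧ ∀ᶠ z in 𝓝 P, h z = fderiv ℂ F z (W z)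

lemma mem_jacobianIdeal_iff {f : MvPolynomial (Fin 2) ℂ} {P : Fin 2 → ℂ}
    {h : analyticFunctions P} :
    h ∈ jacobianIdeal f P ↔ InJacobian (fun z => eval z f) P h.1 := by
  constructor
  · rintro ⟨a, b, hab⟩
    refine ⟨fun z => ![a.1 z, b.1 z], AnalyticAt.pi fun i => ?_, ?_⟩
    · fin_cases i
      · exact a.2
      · exact b.2
    · filter_upwards [hab] with z hz
      rw [(hasFDerivAt_eval f z).fderiv, hz]
      simp
      ring
  · rintro ⟨W, hW, hab⟩
    refine ⟨⟨fun z => W z 0, (analyticAt_coord 0 _).comp hW⟩,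
      ⟨fun z => W z 1, (analyticAt_coord 1 _).comp hW⟩, ?_⟩
    filter_upwards [hab] with z hz
    rw [(hasFDerivAt_eval f z).fderiv] at hz
    rw [hz]
    simp
    ring

lemma InJacobian.congr {F h k : (Fin 2 → ℂ) → ℂ} {P : Fin 2 → ℂ} (hh : InJacobian F P h)
    (hk : ∀ᶠ z in 𝓝 P, k z = h z) : InJacobian F P k := by
  obtain ⟨W, hW, hWe⟩ := hh
  refine ⟨W, hW, ?_⟩
  filter_upwards [hWe, hk] with z h1 h2
  rw [h2, h1]

lemma analyticAt_clm_apply {F : Type*} [NormedAddCommGroup F] [NormedSpace ℂ F] [CompleteSpace F]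
    {L : (Fin 2 → ℂ) → ((Fin 2 → ℂ) →L[ℂ] F)} {W : (Fin 2 → ℂ) → (Fin 2 → ℂ)} {P : Fin 2 → ℂ}
    (hL : AnalyticAt ℂ L P) (hW : AnalyticAt ℂ W P) : AnalyticAt ℂ (fun z => L z (W z)) P :=
  ((hL.contDiffAt (n := ⊤)).clm_apply (hW.contDiffAt (n := ⊤))).analyticAt

/-- The Jacobian ideal is transported by analytic changes of coordinates. -/
lemma InJacobian.comp {F G h : (Fin 2 → ℂ) → ℂ} {φ ψ : (Fin 2 → ℂ) → (Fin 2 → ℂ)}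
    {P Q : Fin 2 → ℂ} (hh : InJacobian F P h) (hG : AnalyticAt ℂ G Q) (hφ : AnalyticAt ℂ φ Q)
    (hψ : AnalyticAt ℂ ψ P) (hφQ : φ Q = P) (hl : ∀ᶠ z in 𝓝 Q, ψ (φ z) = z)
    (hF : ∀ᶠ p in 𝓝 P, F p = G (ψ p)) : InJacobian G Q (h ∘ φ) := by
  obtain ⟨W, hW, hWe⟩ := hh
  have hψ2 : AnalyticAt ℂ (fun z => fderiv ℂ ψ (φ z)) Q :=
    AnalyticAt.comp (by rw [hφQ]; exact hψ.fderiv) hφ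
  have hW2 : AnalyticAt ℂ (fun z => W (φ z)) Q := AnalyticAt.comp (by rwa [hφQ]) hφ
  refine ⟨fun z => fderiv ℂ ψ (φ z) (W (φ z)), analyticAt_clm_apply hψ2 hW2, ?_⟩
  have ht : Filter.Tendsto φ (𝓝 Q) (𝓝 P) := by
    have := hφ.continuousAt.tendsto; rwa [hφQ] at this
  filter_upwards [hl, ht.eventually hWe, ht.eventually hF.eventually_nhds,
    hG.eventually_analyticAt, ht.eventually hψ.eventually_analyticAt] with z h1 h2 h3 h4 h5
  simp only [Function.comp_apply]
  have h6 : F =ᶠ[𝓝 (φ z)] G ∘ ψ := h3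
  rw [h2, h6.fderiv_eq, fderiv_comp _ (by rw [h1]; exact h4.differentiableAt) h5.differentiableAt,
    h1]
  rfl

/-- For a function `g` that is the derivative of itself along a vector field `E` vanishing at the
origin (such as a quasi-homogeneous polynomial), multiplication by a unit does not change the
Jacobian ideal. -/
lemma inJacobian_unit_mul_iff {g u h : (Fin 2 → ℂ) → ℂ} {E : (Fin 2 → ℂ) → (Fin 2 → ℂ)}
    (hg : AnalyticAt ℂ g 0) (hu : AnalyticAt ℂ u 0) (hu0 : u 0 ≠ 0) (hE : AnalyticAt ℂ E 0)
    (hE0 : E 0 = 0) (hEuler : ∀ z, g z = fderiv ℂ g z (E z)) :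
    InJacobian (fun z => u z * g z) 0 h ↔ InJacobian g 0 h := by
  have hder : ∀ᶠ z in 𝓝 (0 : Fin 2 → ℂ), ∀ v, fderiv ℂ (fun z => u z * g z) z v
      = fderiv ℂ g z (u z • v + (fderiv ℂ u z v) • E z) := by
    filter_upwards [hg.eventually_analyticAt, hu.eventually_analyticAt] with z h1 h2 v
    rw [fderiv_fun_mul h2.differentiableAt h1.differentiableAt, map_add, map_smul, map_smul,
      ← hEuler z]
    simp
    ring
  constructor
  · rintro ⟨W, hW, hWe⟩
    refine ⟨fun z => u z • W z + (fderiv ℂ u z (W z)) • E z,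
      (hu.smul hW).add ((analyticAt_clm_apply hu.fderiv hW).smul hE), ?_⟩
    filter_upwards [hWe, hder] with z h1 h2
    rw [h1, h2]
  · rintro ⟨W, hW, hWe⟩
    have hd : AnalyticAt ℂ (fun z => u z + fderiv ℂ u z (E z)) 0 :=
      hu.add (analyticAt_clm_apply hu.fderiv hE)
    have hd0 : u 0 + fderiv ℂ u 0 (E 0) ≠ 0 := by simpa [hE0] using hu0
    -- `W' = (W - m E) / u` solves `u W' + (D u W') E = W` when `m = D u W / (u + D u E)`.
    have hm : AnalyticAt ℂ (fun z => fderiv ℂ u z (W z) / (u z + fderiv ℂ u z (E z))) 0 :=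
      (analyticAt_clm_apply hu.fderiv hW).div hd hd0
    refine ⟨fun z => (u z)⁻¹ •
      (W z - (fderiv ℂ u z (W z) / (u z + fderiv ℂ u z (E z))) • E z),
      (hu.inv hu0).smul (hW.sub (hm.smul hE)), ?_⟩
    filter_upwards [hWe, hder, hu.continuousAt.eventually_ne hu0,
      hd.continuousAt.eventually_ne hd0] with z h1 h2 h3 h4
    rw [h1, h2]
    congr 1
    rw [map_smul, map_sub, map_smul]
    ext i
    simp only [Pi.add_apply, Pi.smul_apply, Pi.sub_apply, smul_eq_mul]
    field_simp
    ring

/-- Composition with an analytic map, as a homomorphism of rings of analytic functions. -/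
def compHom {φ : (Fin 2 → ℂ) → (Fin 2 → ℂ)} {P Q : Fin 2 → ℂ} (hφ : AnalyticAt ℂ φ Q)
    (hφQ : φ Q = P) : analyticFunctions P →ₐ[ℂ] analyticFunctions Q where
  toFun h := ⟨fun z => h.1 (φ z), AnalyticAt.comp (g := h.1) (by rw [hφQ]; exact h.2) hφ⟩
  map_one' := rfl
  map_mul' _ _ := rfl
  map_zero' := rfl
  map_add' _ _ := rfl
  commutes' _ := rfl

lemma inJacobian_of_eventually_eq_zero {F h : (Fin 2 → ℂ) → ℂ} {P : Fin 2 → ℂ}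
    (hh : ∀ᶠ z in 𝓝 P, h z = 0) : InJacobian F P h :=
  ⟨0, analyticAt_const, by filter_upwards [hh] with z hz; simp [hz]⟩

/-- Two equivalent germs have the same Milnor number if the second one is quasi-homogeneous. -/
lemma milnorNumber_eq_of_germEquiv {f g : MvPolynomial (Fin 2) ℂ} {P : Fin 2 → ℂ}
    (h : GermEquiv f P g 0) {E : (Fin 2 → ℂ) → (Fin 2 → ℂ)} (hE : AnalyticAt ℂ E 0)
    (hE0 : E 0 = 0) (hEuler : ∀ z, eval z g = fderiv ℂ (fun z => eval z g) z (E z)) :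
    milnorNumber f P = milnorNumber g 0 := by
  obtain ⟨φ, φ', u, hφ, hφ0, hφ', hu, hu0, he⟩ := h
  obtain ⟨ψ, hψ, hψP, -, hl, hr⟩ := exists_analytic_local_inverse hφ hφ'
  rw [hφ0] at hψ hψP hr
  have htψ : Filter.Tendsto ψ (𝓝 P) (𝓝 0) := by
    have := hψ.continuousAt.tendsto; rwa [hψP] at this
  have hG : AnalyticAt ℂ (fun z => u z * eval z g) 0 := hu.mul (analyticAt_eval g 0)
  have hFG : ∀ᶠ p in 𝓝 P, eval p f = u (ψ p) * eval (ψ p) g := by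
    filter_upwards [htψ.eventually he, hr] with p h1 h2
    rw [h2] at h1
    exact h1
  have key : ∀ k : (Fin 2 → ℂ) → ℂ, InJacobian (fun z => eval z f) P k ↔
      InJacobian (fun z => eval z g) 0 (k ∘ φ) := by
    intro k
    rw [← inJacobian_unit_mul_iff (analyticAt_eval g 0) hu hu0 hE hE0 hEuler]
    constructor
    · intro hk
      exact hk.comp hG hφ hψ hφ0 hl hFG
    · intro hk
      have hk2 : InJacobian (fun z => eval z f) P ((k ∘ φ) ∘ ψ) :=
        hk.comp (analyticAt_eval f P) hψ hφ hψP hr (by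
          filter_upwards [he] with z hz using hz.symm)
      refine hk2.congr ?_
      filter_upwards [hr] with p hp
      simp [hp]
  let π : analyticFunctions P →ₐ[ℂ] (analyticFunctions (0 : Fin 2 → ℂ) ⧸ jacobianIdeal g 0) :=
    (Ideal.Quotient.mkₐ ℂ (jacobianIdeal g 0)).comp (compHom hφ hφ0)
  have hπ : Function.Surjective π := by
    intro y
    obtain ⟨k, rfl⟩ := Ideal.Quotient.mk_surjective y
    refine ⟨compHom hψ hψP k, ?_⟩
    refine Ideal.Quotient.eq.2 (mem_jacobianIdeal_iff.2 (inJacobian_of_eventually_eq_zero ?_))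
    filter_upwards [hl] with z hz
    change k.1 (ψ (φ z)) - k.1 z = 0
    rw [hz, sub_self]
  have hker : RingHom.ker π = jacobianIdeal f P := by
    ext k
    rw [mem_jacobianIdeal_iff, key, RingHom.mem_ker]
    change Ideal.Quotient.mk _ (compHom hφ hφ0 k) = 0 ↔ _
    rw [Ideal.Quotient.eq_zero_iff_mem, mem_jacobianIdeal_iff]
    rfl
  unfold milnorNumber
  rw [← hker]
  exact (Ideal.quotientKerAlgEquivOfSurjective hπ).toLinearEquiv.finrank_eq

/-- The coordinate functions as elements of the ring of functions analytic at the origin. -/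
def coordFun (i : Fin 2) : analyticFunctions (0 : Fin 2 → ℂ) := ⟨fun z => z i, analyticAt_coord i 0⟩

/-- Hadamard's lemma in the local algebra of `g`. -/
lemma exists_hadamard_quotient (g : MvPolynomial (Fin 2) ℂ)
    (h : analyticFunctions (0 : Fin 2 → ℂ) ⧸ jacobianIdeal g 0) :
    ∃ (c : ℂ) (a b : analyticFunctions (0 : Fin 2 → ℂ) ⧸ jacobianIdeal g 0),
      h = algebraMap ℂ _ c + Ideal.Quotient.mk _ (coordFun 0) * a +
        Ideal.Quotient.mk _ (coordFun 1) * b := by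
  obtain ⟨k, rfl⟩ := Ideal.Quotient.mk_surjective h
  obtain ⟨a, b, ha, hb, hk⟩ := exists_hadamard k.2
  refine ⟨k.1 0, Ideal.Quotient.mk _ ⟨a, ha⟩, Ideal.Quotient.mk _ ⟨b, hb⟩, ?_⟩
  rw [← map_mul, ← map_mul, ← Ideal.Quotient.mk_algebraMap, ← map_add, ← map_add]
  refine Ideal.Quotient.eq.2 (mem_jacobianIdeal_iff.2 (inJacobian_of_eventually_eq_zero ?_))
  filter_upwards [hk] with z hz
  change k.1 z - (k.1 0 + z 0 * a z + z 1 * b z) = 0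
  rw [hz, sub_self]

/-- Descending induction step for spanning sets of a local algebra generated by `X` and `Y`. -/
lemma mul_mem_of_hadamard {B : Type*} [CommRing B] [Algebra ℂ B] {X Y : B}
    (had : ∀ h : B, ∃ (c : ℂ) (a b : B), h = algebraMap ℂ B c + X * a + Y * b)
    {S : Submodule ℂ B} {m : B} (hm : m ∈ S) (hX : ∀ a, m * X * a ∈ S) (hY : ∀ a, m * Y * a ∈ S)
    (h : B) : m * h ∈ S := by
  obtain ⟨c, a, b, rfl⟩ := had h
  have : m * (algebraMap ℂ B c + X * a + Y * b) = c • m + m * X * a + m * Y * b := by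
    rw [Algebra.smul_def]; ring
  rw [this]
  exact S.add_mem (S.add_mem (S.smul_mem c hm) (hX a)) (hY b)

/-- A polynomial of degree less than `n` that is `O(t ^ n)` is zero. -/
lemma coeff_eq_zero_of_isBigO {n : ℕ} (c : Fin n → ℂ)
    (h : (fun t : ℂ => ∑ i, c i * t ^ (i : ℕ)) =O[𝓝[≠] 0] (fun t => t ^ n)) : ∀ i, c i = 0 := by
  induction n with
  | zero => exact fun i => i.elim0
  | succ n ih =>
    have hS : ∀ t : ℂ, ∑ i : Fin (n + 1), c i * t ^ (i : ℕ)
        = c 0 + t * ∑ i : Fin n, c i.succ * t ^ (i : ℕ) := by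
      intro t
      rw [Fin.sum_univ_succ, Finset.mul_sum]
      simp only [Fin.val_zero, pow_zero, mul_one, Fin.val_succ]
      congr 1
      refine Finset.sum_congr rfl fun i _ => by ring
    have h0 : c 0 = 0 := by
      have h1 : Filter.Tendsto (fun t : ℂ => ∑ i, c i * t ^ (i : ℕ)) (𝓝[≠] 0) (𝓝 0) := by
        refine h.trans_tendsto ?_
        have : Filter.Tendsto (fun t : ℂ => t ^ (n + 1)) (𝓝 0) (𝓝 (0 ^ (n + 1))) :=
          (continuous_pow (n + 1)).tendsto 0
        rw [zero_pow (Nat.succ_ne_zero n)] at this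
        exact this.mono_left nhdsWithin_le_nhds
      have h2 : Filter.Tendsto (fun t : ℂ => ∑ i, c i * t ^ (i : ℕ)) (𝓝[≠] 0) (𝓝 (c 0)) := by
        have hc : Continuous (fun t : ℂ => ∑ i, c i * t ^ (i : ℕ)) := by fun_prop
        have := hc.tendsto 0
        simp only [hS, zero_mul, add_zero] at this
        refine Filter.Tendsto.mono_left ?_ nhdsWithin_le_nhds
        simpa only [hS] using this
      exact tendsto_nhds_unique h2 h1
    have h3 : (fun t : ℂ => ∑ i : Fin n, c i.succ * t ^ (i : ℕ)) =O[𝓝[≠] 0] (fun t => t ^ n) := by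
      have h4 := (Asymptotics.isBigO_refl (fun t : ℂ => t⁻¹) (𝓝[≠] 0)).mul h
      refine h4.congr' ?_ ?_
      · filter_upwards [self_mem_nhdsWithin] with t ht
        have ht : t ≠ 0 := ht
        rw [hS, h0]
        field_simp
        ring
      · filter_upwards [self_mem_nhdsWithin] with t ht
        have ht : t ≠ 0 := ht
        rw [pow_succ]
        field_simp
    intro i
    refine Fin.cases h0 (fun j => ?_) i
    exact ih (fun j => c j.succ) h3 j

/-- Two functions that agree off the origin and are continuous there agree at the origin. -/
lemma eq_at_zero_of_eventually_eq {f g : ℂ → ℂ} (hf : ContinuousAt f 0) (hg : ContinuousAt g 0)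
    (h : ∀ᶠ t in 𝓝[≠] (0 : ℂ), f t = g t) : f 0 = g 0 :=
  tendsto_nhds_unique (hf.tendsto.mono_left nhdsWithin_le_nhds)
    ((hg.tendsto.mono_left nhdsWithin_le_nhds).congr'
        (by filter_upwards [h] with t ht using ht.symm))

end TorusSextic

/-! ### Milnor numbers of the normal forms -/

namespace TorusSextic

open MvPolynomial

/-- The Milnor number is read off from functions that are independent modulo the partial
derivatives and span the local algebra. -/
lemma milnorNumber_eq_card {g : MvPolynomial (Fin 2) ℂ} {ι : Type*} [Fintype ι]
    (b : ι → analyticFunctions (0 : Fin 2 → ℂ))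
    (li : ∀ (c : ι → ℂ) (p q : (Fin 2 → ℂ) → ℂ), AnalyticAt ℂ p 0 → AnalyticAt ℂ q 0 →
      (∀ᶠ z in 𝓝 0, ∑ i, c i * (b i).1 z
        = p z * eval z (pderiv 0 g) + q z * eval z (pderiv 1 g)) → ∀ i, c i = 0)
    (sp : ∀ h : analyticFunctions (0 : Fin 2 → ℂ) ⧸ jacobianIdeal g 0, ∃ c : ι → ℂ,
      h = ∑ i, algebraMap ℂ _ (c i) * Ideal.Quotient.mk (jacobianIdeal g 0) (b i)) :
    milnorNumber g 0 = Fintype.card ι := by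
  have hli : LinearIndependent ℂ (fun i => Ideal.Quotient.mk (jacobianIdeal g 0) (b i)) := by
    rw [Fintype.linearIndependent_iff]
    intro c hc
    have h1 : Ideal.Quotient.mk (jacobianIdeal g 0) (∑ i, c i • b i) = 0 := by
      rw [map_sum, ← hc]
      rfl
    obtain ⟨p, q, hpq⟩ := Ideal.Quotient.eq_zero_iff_mem.1 h1
    refine li c p.1 q.1 p.2 q.2 ?_
    filter_upwards [hpq] with z hz
    rw [← hz]
    have : (∑ i, c i • b i).1 = ∑ i, c i • (b i).1 := by
      rw [← Subalgebra.coe_val, map_sum]; rfl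
    rw [this, Finset.sum_apply]
    rfl
  refine Module.finrank_eq_card_basis (Module.Basis.mk hli fun h _ => ?_)
  obtain ⟨c, rfl⟩ := sp h
  refine Submodule.sum_mem _ fun i _ => ?_
  have : algebraMap ℂ (analyticFunctions (0 : Fin 2 → ℂ) ⧸ jacobianIdeal g 0) (c i)
      * Ideal.Quotient.mk (jacobianIdeal g 0) (b i)
      = c i • Ideal.Quotient.mk (jacobianIdeal g 0) (b i) := by
    rw [← Algebra.smul_def]
  rw [this]
  exact Submodule.smul_mem _ _ (Submodule.subset_span ⟨i, rfl⟩)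

lemma eventually_curve {p : (Fin 2 → ℂ) → Prop} (h : ∀ᶠ z in 𝓝 (0 : Fin 2 → ℂ), p z)
    {γ : ℂ → (Fin 2 → ℂ)} (hγ : Continuous γ) (hγ0 : γ 0 = 0) : ∀ᶠ t in 𝓝[≠] (0 : ℂ), p (γ t) := by
  have := hγ.tendsto 0
  rw [hγ0] at this
  exact (this.mono_left nhdsWithin_le_nhds).eventually h

lemma isBigO_pow_mul {α : ℂ → ℂ} (hα : ContinuousAt α 0) (n : ℕ) :
    (fun t => t ^ n * α t) =O[𝓝[≠] 0] (fun t : ℂ => t ^ n) := by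
  have h1 : α =O[𝓝[≠] 0] (fun _ => (1 : ℂ)) :=
    (hα.tendsto.mono_left nhdsWithin_le_nhds).isBigO_one ℂ
  simpa using (Asymptotics.isBigO_refl (fun t : ℂ => t ^ n) (𝓝[≠] 0)).mul h1

/-- A spanning set of the local algebra of `A_n`, where `X` and `Y` are the classes of the
coordinates. -/
lemma mem_of_spanning_A {B : Type*} [CommRing B] [Algebra ℂ B] {X Y : B}
    (had : ∀ h : B, ∃ (c : ℂ) (a b : B), h = algebraMap ℂ B c + X * a + Y * b) {n : ℕ}
    (hX : X ^ n = 0) (hY : Y = 0) {S : Submodule ℂ B} (hS : ∀ i < n, X ^ i ∈ S) (h : B) :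
    h ∈ S := by
  have hdesc : ∀ k ≤ n, ∀ h, X ^ (n - k) * h ∈ S := by
    intro k
    induction k with
    | zero => intro _ h; rw [Nat.sub_zero, hX, zero_mul]; exact S.zero_mem
    | succ k ih =>
      intro hk
      refine mul_mem_of_hadamard had (hS _ (by omega)) ?_ ?_
      · intro a
        rw [← pow_succ]
        have : n - (k + 1) + 1 = n - k := by omega
        rw [this]
        exact ih (by omega) a
      · intro a
        rw [hY, mul_zero, zero_mul]
        exact S.zero_mem
  simpa using hdesc n le_rfl h

/-- A spanning set of the local algebra of `D_k`, `k = j + 4`. -/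
lemma mem_of_spanning_D {B : Type*} [CommRing B] [Algebra ℂ B] {X Y r : B}
    (had : ∀ h : B, ∃ (c : ℂ) (a b : B), h = algebraMap ℂ B c + X * a + Y * b) {j : ℕ}
    (hX : X ^ (j + 3) = 0) (hXY : X * Y = 0) (hY : Y ^ 2 = X ^ (j + 2) * r)
    {S : Submodule ℂ B} (hS : ∀ i < j + 3, X ^ i ∈ S) (hYS : Y ∈ S) (h : B) : h ∈ S := by
  have hdesc : ∀ k ≤ j + 2, ∀ h, X ^ (j + 3 - k) * h ∈ S := by
    intro k
    induction k with
    | zero => intro _ h; rw [Nat.sub_zero, hX, zero_mul]; exact S.zero_mem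
    | succ k ih =>
      intro hk
      refine mul_mem_of_hadamard had (hS _ (by omega)) ?_ ?_
      · intro a
        rw [← pow_succ]
        have : j + 3 - (k + 1) + 1 = j + 3 - k := by omega
        rw [this]
        exact ih (by omega) a
      · intro a
        have : j + 3 - (k + 1) = (j + 3 - (k + 1) - 1) + 1 := by omega
        rw [this, pow_succ, mul_assoc (X ^ _), hXY, mul_zero, zero_mul]
        exact S.zero_mem
  have hYm : ∀ h, Y * h ∈ S := by
    refine mul_mem_of_hadamard had hYS ?_ ?_
    · intro a
      rw [mul_comm Y, hXY, zero_mul]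
      exact S.zero_mem
    · intro a
      rw [← pow_two, hY, mul_assoc]
      exact hdesc 1 (by omega) (r * a)
  have := mul_mem_of_hadamard (m := 1) (S := S) had
    (by simpa using hS 0 (by omega)) (fun a => ?_) (fun a => ?_) h
  · simpa using this
  · have := hdesc (j + 2) le_rfl a
    have h5 : j + 3 - (j + 2) = 1 := by omega
    rw [h5, pow_one] at this
    simpa using this
  · simpa using hYm a

/-- A spanning set of the local algebra of `E₆`. -/
lemma mem_of_spanning_E6 {B : Type*} [CommRing B] [Algebra ℂ B] {X Y : B}
    (had : ∀ h : B, ∃ (c : ℂ) (a b : B), h = algebraMap ℂ B c + X * a + Y * b)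
    (hX : X ^ 3 = 0) (hY : Y ^ 2 = 0) {S : Submodule ℂ B} (hl : ∀ i < 3, X ^ i ∈ S)
    (hr : ∀ i < 3, X ^ i * Y ∈ S) (h : B) : h ∈ S := by
  have step := fun m : B => mul_mem_of_hadamard had (S := S) (m := m)
  have hzero : ∀ {w : B}, w = 0 → w ∈ S := by
    rintro _ rfl; exact S.zero_mem
  have a5 : ∀ h, X ^ 2 * Y * h ∈ S := step _ (hr 2 (by norm_num))
    (fun a => hzero (by linear_combination (Y * a) * hX))
    (fun a => hzero (by linear_combination (X ^ 2 * a) * hY))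
  have a4 : ∀ h, X ^ 1 * Y * h ∈ S := step _ (hr 1 (by norm_num))
    (fun a => by convert a5 a using 1; ring)
    (fun a => hzero (by linear_combination (X * a) * hY))
  have a3 : ∀ h, X ^ 0 * Y * h ∈ S := step _ (hr 0 (by norm_num))
    (fun a => by convert a4 a using 1; ring)
    (fun a => hzero (by linear_combination a * hY))
  have a2 : ∀ h, X ^ 2 * h ∈ S := step _ (hl 2 (by norm_num))
    (fun a => hzero (by linear_combination a * hX)) a5
  have a1 : ∀ h, X ^ 1 * h ∈ S := step _ (hl 1 (by norm_num))
    (fun a => by convert a2 a using 1; ring) a4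
  have a0 : ∀ h, X ^ 0 * h ∈ S := step _ (hl 0 (by norm_num))
    (fun a => by convert a1 a using 1; ring) a3
  simpa using a0 h

lemma exists_eq_sum_of_mem_span {B ι : Type*} [CommRing B] [Algebra ℂ B] [Fintype ι] {v : ι → B}
    {h : B} (hh : h ∈ Submodule.span ℂ (Set.range v)) :
    ∃ c : ι → ℂ, h = ∑ i, algebraMap ℂ B (c i) * v i := by
  obtain ⟨c, rfl⟩ := (Submodule.mem_span_range_iff_exists_fun ℂ).1 hh
  exact ⟨c, Finset.sum_congr rfl fun i _ => Algebra.smul_def _ _⟩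

lemma exists_eq_sum_A {A B : Type*} [CommRing A] [CommRing B] [Algebra ℂ B] (π : A →+* B) {x y : A}
    (had : ∀ h : B, ∃ (c : ℂ) (a b : B), h = algebraMap ℂ B c + π x * a + π y * b) {n : ℕ}
    (hX : π (x ^ n) = 0) (hY : π y = 0) (h : B) :
    ∃ c : Fin n → ℂ, h = ∑ i, algebraMap ℂ B (c i) * π (x ^ (i : ℕ)) :=
  exists_eq_sum_of_mem_span <| mem_of_spanning_A had (by rw [← map_pow]; exact hX) hY
    (fun i hi => by
      rw [← map_pow]
      exact Submodule.subset_span (Set.mem_range_self (⟨i, hi⟩ : Fin n))) h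

lemma exists_eq_sum_D {A B : Type*} [CommRing A] [CommRing B] [Algebra ℂ B] (π : A →+* B)
    {x y r : A}
    (had : ∀ h : B, ∃ (c : ℂ) (a b : B), h = algebraMap ℂ B c + π x * a + π y * b) {j : ℕ}
    (hX : π (x ^ (j + 3)) = 0) (hXY : π (x * y) = 0) (hY : π (y ^ 2) = π (x ^ (j + 2) * r))
    (h : B) :
    ∃ c : Option (Fin (j + 3)) → ℂ,
      h = ∑ o, algebraMap ℂ B (c o) * π (o.elim y fun i => x ^ (i : ℕ)) := by
  refine exists_eq_sum_of_mem_span (mem_of_spanning_D (j := j) (r := π r) had ?_ ?_ ?_ ?_ ?_ h)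
  · rw [← map_pow]; exact hX
  · rw [← map_mul]; exact hXY
  · rw [← map_pow, ← map_pow, ← map_mul]; exact hY
  · intro i hi
    rw [← map_pow]
    exact Submodule.subset_span ⟨some ⟨i, hi⟩, rfl⟩
  · exact Submodule.subset_span ⟨none, rfl⟩

lemma exists_eq_sum_E6 {A B : Type*} [CommRing A] [CommRing B] [Algebra ℂ B] (π : A →+* B) {x y : A}
    (had : ∀ h : B, ∃ (c : ℂ) (a b : B), h = algebraMap ℂ B c + π x * a + π y * b)
    (hX : π (x ^ 3) = 0) (hY : π (y ^ 2) = 0) (h : B) :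
    ∃ c : Fin 3 ⊕ Fin 3 → ℂ, h = ∑ o, algebraMap ℂ B (c o) *
      π (Sum.elim (fun i : Fin 3 => x ^ (i : ℕ)) (fun i : Fin 3 => x ^ (i : ℕ) * y) o) :=
  exists_eq_sum_of_mem_span <| mem_of_spanning_E6 had (by rw [← map_pow]; exact hX)
    (by rw [← map_pow]; exact hY)
    (fun i hi => by rw [← map_pow]; exact Submodule.subset_span ⟨Sum.inl ⟨i, hi⟩, rfl⟩)
    (fun i hi => by rw [← map_pow, ← map_mul]; exact Submodule.subset_span ⟨Sum.inr ⟨i, hi⟩, rfl⟩) h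

lemma exists_eq_sum_quotient_A {g : MvPolynomial (Fin 2) ℂ} {n : ℕ}
    (hX : Ideal.Quotient.mk (jacobianIdeal g 0) (coordFun 0 ^ n) = 0)
    (hY : Ideal.Quotient.mk (jacobianIdeal g 0) (coordFun 1) = 0)
    (h : analyticFunctions (0 : Fin 2 → ℂ) ⧸ jacobianIdeal g 0) : ∃ c : Fin n → ℂ,
      h = ∑ i, algebraMap ℂ _ (c i) * Ideal.Quotient.mk (jacobianIdeal g 0)
        (coordFun 0 ^ (i : ℕ)) := by
  have had := exists_hadamard_quotient g
  have := exists_eq_sum_A (Ideal.Quotient.mk (jacobianIdeal g 0)) (x := coordFun 0)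
    (y := coordFun 1) had hX hY h
  exact this

lemma exists_eq_sum_quotient_D {g : MvPolynomial (Fin 2) ℂ} {j : ℕ}
    {r : analyticFunctions (0 : Fin 2 → ℂ)}
    (hX : Ideal.Quotient.mk (jacobianIdeal g 0) (coordFun 0 ^ (j + 3)) = 0)
    (hXY : Ideal.Quotient.mk (jacobianIdeal g 0) (coordFun 0 * coordFun 1) = 0)
    (hY : Ideal.Quotient.mk (jacobianIdeal g 0) (coordFun 1 ^ 2)
      = Ideal.Quotient.mk _ (coordFun 0 ^ (j + 2) * r))
    (h : analyticFunctions (0 : Fin 2 → ℂ) ⧸ jacobianIdeal g 0) : ∃ c : Option (Fin (j + 3)) → ℂ,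
      h = ∑ o, algebraMap ℂ _ (c o) * Ideal.Quotient.mk (jacobianIdeal g 0)
        (o.elim (coordFun 1) fun i => coordFun 0 ^ (i : ℕ)) := by
  have had := exists_hadamard_quotient g
  have := exists_eq_sum_D (Ideal.Quotient.mk (jacobianIdeal g 0)) (x := coordFun 0)
    (y := coordFun 1) had hX hXY hY h
  exact this

lemma exists_eq_sum_quotient_E6 {g : MvPolynomial (Fin 2) ℂ}
    (hX : Ideal.Quotient.mk (jacobianIdeal g 0) (coordFun 0 ^ 3) = 0)
    (hY : Ideal.Quotient.mk (jacobianIdeal g 0) (coordFun 1 ^ 2) = 0)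
    (h : analyticFunctions (0 : Fin 2 → ℂ) ⧸ jacobianIdeal g 0) : ∃ c : Fin 3 ⊕ Fin 3 → ℂ,
      h = ∑ o, algebraMap ℂ _ (c o) * Ideal.Quotient.mk (jacobianIdeal g 0)
        (Sum.elim (fun i : Fin 3 => coordFun 0 ^ (i : ℕ))
          (fun i : Fin 3 => coordFun 0 ^ (i : ℕ) * coordFun 1) o) := by
  have had := exists_hadamard_quotient g
  have := exists_eq_sum_E6 (Ideal.Quotient.mk (jacobianIdeal g 0)) (x := coordFun 0)
    (y := coordFun 1) had hX hY h
  exact this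

lemma milnorNumber_A {n : ℕ} (hn : 1 ≤ n) : milnorNumber (SingType.A n).normalForm 0 = n := by
  obtain ⟨n, rfl⟩ : ∃ k, n = k + 1 := ⟨n - 1, by omega⟩
  have h0 : ∀ z : Fin 2 → ℂ, eval z (pderiv 0 (SingType.A (n + 1)).normalForm)
      = (n + 2) * z 0 ^ (n + 1) := fun z => by
    simp only [SingType.normalForm, map_add, Derivation.leibniz_pow, pderiv_X, smul_eq_mul, map_mul,
      map_pow, eval_X, nsmul_eq_mul, map_natCast]
    simp
    left
    ring
  have h1 : ∀ z : Fin 2 → ℂ, eval z (pderiv 1 (SingType.A (n + 1)).normalForm) = 2 * z 1 :=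
    fun z => by simp [SingType.normalForm, pderiv_X]
  rw [milnorNumber_eq_card (ι := Fin (n + 1)) (fun i => coordFun 0 ^ (i : ℕ)), Fintype.card_fin]
  · intro c p q hp hq hpq
    have hγ : Continuous (fun t : ℂ => (![t, 0] : Fin 2 → ℂ)) := by fun_prop
    have hγ0 : (![(0 : ℂ), 0] : Fin 2 → ℂ) = 0 := by ext i; fin_cases i <;> rfl
    have h2 := eventually_curve hpq hγ hγ0
    have hpc : ContinuousAt (fun t : ℂ => ((n : ℂ) + 2) * p ![t, 0]) 0 :=
      continuousAt_const.mul (ContinuousAt.comp (by rw [hγ0]; exact hp.continuousAt)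
        hγ.continuousAt)
    refine coeff_eq_zero_of_isBigO c ((isBigO_pow_mul hpc (n + 1)).congr' ?_
        Filter.EventuallyEq.rfl)
    filter_upwards [h2] with t ht
    rw [h0, h1] at ht
    simp only [Matrix.cons_val_zero, Matrix.cons_val_one] at ht
    have ht' : ∑ i : Fin (n + 1), c i * t ^ (i : ℕ) = p ![t, 0] * ((n + 2) * t ^ (n + 1))
      + q ![t, 0] * (2 * 0) := ht
    rw [ht']
    ring
  · have hY : Ideal.Quotient.mk (jacobianIdeal (SingType.A (n + 1)).normalForm 0) (coordFun 1)
        = 0 := by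
      refine Ideal.Quotient.eq_zero_iff_mem.2
        ⟨0, ⟨fun _ => 2⁻¹, analyticAt_const⟩, Filter.Eventually.of_forall fun z => ?_⟩
      rw [h1]
      change z 1 = 0 * _ + 2⁻¹ * (2 * z 1)
      ring
    have hX : Ideal.Quotient.mk (jacobianIdeal (SingType.A (n + 1)).normalForm 0)
        (coordFun 0 ^ (n + 1)) = 0 := by
      refine Ideal.Quotient.eq_zero_iff_mem.2
        ⟨⟨fun _ => ((n : ℂ) + 2)⁻¹, analyticAt_const⟩, 0, Filter.Eventually.of_forall fun z => ?_⟩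
      rw [h0]
      change z 0 ^ (n + 1) = ((n : ℂ) + 2)⁻¹ * ((n + 2) * z 0 ^ (n + 1)) + 0 * _
      have : (n : ℂ) + 2 ≠ 0 := by norm_cast
      field_simp
      ring
    exact exists_eq_sum_quotient_A hX hY

lemma milnorNumber_D (j : ℕ) : milnorNumber (SingType.D (j + 4)).normalForm 0 = j + 4 := by
  have h0 : ∀ z : Fin 2 → ℂ, eval z (pderiv 0 (SingType.D (j + 4)).normalForm)
      = z 1 ^ 2 + (j + 3) * z 0 ^ (j + 2) := fun z => by
    simp [SingType.normalForm, pderiv_X]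
  have h1 : ∀ z : Fin 2 → ℂ, eval z (pderiv 1 (SingType.D (j + 4)).normalForm) = 2 * z 0 * z 1 :=
    fun z => by
    simp [SingType.normalForm, pderiv_X]
    ring
  rw [milnorNumber_eq_card (ι := Option (Fin (j + 3)))
    (fun o => o.elim (coordFun 1) fun i => coordFun 0 ^ (i : ℕ)), Fintype.card_option,
    Fintype.card_fin]
  · intro c p q hp hq hpq
    have hγ : Continuous (fun t : ℂ => (![t, 0] : Fin 2 → ℂ)) := by fun_prop
    have hδ : Continuous (fun t : ℂ => (![0, t] : Fin 2 → ℂ)) := by fun_prop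
    have hγ0 : (![(0 : ℂ), 0] : Fin 2 → ℂ) = 0 := by ext i; fin_cases i <;> rfl
    have hpγ : ContinuousAt (fun t : ℂ => p ![t, 0]) 0 :=
      ContinuousAt.comp (by rw [hγ0]; exact hp.continuousAt) hγ.continuousAt
    have hpδ : ContinuousAt (fun t : ℂ => p ![0, t]) 0 :=
      ContinuousAt.comp (by rw [hγ0]; exact hp.continuousAt) hδ.continuousAt
    have h2 : ∀ᶠ t in 𝓝[≠] (0 : ℂ), ∑ i : Fin (j + 3), c (some i) * t ^ (i : ℕ)
        = (j + 3) * t ^ (j + 2) * p ![t, 0] := by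
      filter_upwards [eventually_curve hpq hγ hγ0] with t ht
      rw [h0, h1, Fintype.sum_option] at ht
      have ht' : c none * 0 + ∑ i : Fin (j + 3), c (some i) * t ^ (i : ℕ)
        = p ![t, 0] * (0 ^ 2 + (j + 3) * t ^ (j + 2)) + q ![t, 0] * (2 * t * 0) := ht
      linear_combination ht'
    have h3 : ∀ᶠ t in 𝓝[≠] (0 : ℂ), c (some 0) + c none * t = t ^ 2 * p ![0, t] := by
      filter_upwards [eventually_curve hpq hδ hγ0] with t ht
      rw [h0, h1, Fintype.sum_option] at ht
      have ht' : c none * t + ∑ i : Fin (j + 3), c (some i) * 0 ^ (i : ℕ)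
        = p ![0, t] * (t ^ 2 + (j + 3) * 0 ^ (j + 2)) + q ![0, t] * (2 * 0 * t) := ht
      rw [Fin.sum_univ_succ] at ht'
      simp only [Fin.val_zero, pow_zero, Fin.val_succ, zero_pow (Nat.succ_ne_zero _), mul_zero,
        Finset.sum_const_zero] at ht'
      linear_combination ht'
    have h4 := coeff_eq_zero_of_isBigO ![c (some 0), c none]
      ((isBigO_pow_mul hpδ 2).congr' (by
        filter_upwards [h3] with t ht
        rw [← ht, Fin.sum_univ_two]
        simp) Filter.EventuallyEq.rfl)
    have hc0 : c (some 0) = 0 := h4 0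
    have hcn : c none = 0 := h4 1
    have hp0 : p 0 = 0 := by
      rw [← hγ0]
      refine eq_at_zero_of_eventually_eq hpδ (continuousAt_const (y := (0 : ℂ))) ?_
      filter_upwards [h3, self_mem_nhdsWithin] with t ht ht0
      have ht0 : t ≠ 0 := ht0
      rw [hc0, hcn, zero_mul, add_zero] at ht
      exact (mul_eq_zero.1 ht.symm).resolve_left (pow_ne_zero 2 ht0)
    have hlow : ∀ i : Fin (j + 2), c (some i.castSucc) = 0 := by
      refine coeff_eq_zero_of_isBigO (fun i : Fin (j + 2) => c (some i.castSucc))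
        ((isBigO_pow_mul (α := fun t => (j + 3) * p ![t, 0] - c (some (Fin.last (j + 2))))
          ((continuousAt_const.mul hpγ).sub continuousAt_const) (j + 2)).congr' ?_
          Filter.EventuallyEq.rfl)
      filter_upwards [h2] with t ht
      rw [Fin.sum_univ_castSucc] at ht
      simp only [Fin.val_castSucc, Fin.val_last] at ht
      linear_combination -ht
    have hlast : c (some (Fin.last (j + 2))) = 0 := by
      have : (fun _ : ℂ => c (some (Fin.last (j + 2)))) 0
          = (fun t : ℂ => ((j : ℂ) + 3) * p ![t, 0]) 0 := by
        have hc : ContinuousAt (fun t : ℂ => ((j : ℂ) + 3) * p ![t, 0]) 0 :=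
          continuousAt_const.mul hpγ
        refine eq_at_zero_of_eventually_eq continuousAt_const hc ?_
        filter_upwards [h2, self_mem_nhdsWithin] with t ht ht0
        have ht0 : t ≠ 0 := ht0
        rw [Fin.sum_univ_castSucc] at ht
        simp only [hlow, zero_mul, Finset.sum_const_zero, zero_add, Fin.val_last] at ht
        refine mul_right_cancel₀ (pow_ne_zero (j + 2) ht0) ?_
        linear_combination ht
      simpa [hγ0, hp0] using this
    intro o
    rcases o with _ | i
    · exact hcn
    · refine Fin.lastCases hlast (fun i => hlow i) i
  · have hXY : Ideal.Quotient.mk (jacobianIdeal (SingType.D (j + 4)).normalForm 0)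
        (coordFun 0 * coordFun 1) = 0 := by
      refine Ideal.Quotient.eq_zero_iff_mem.2
        ⟨0, ⟨fun _ => 2⁻¹, analyticAt_const⟩, Filter.Eventually.of_forall fun z => ?_⟩
      rw [h1]
      change z 0 * z 1 = 0 * _ + 2⁻¹ * (2 * z 0 * z 1)
      ring
    have hX : Ideal.Quotient.mk (jacobianIdeal (SingType.D (j + 4)).normalForm 0)
        (coordFun 0 ^ (j + 3)) = 0 := by
      refine Ideal.Quotient.eq_zero_iff_mem.2
        ⟨⟨fun z => ((j : ℂ) + 3)⁻¹ * z 0, analyticAt_const.mul (analyticAt_coord 0 0)⟩,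
        ⟨fun z => -(((j : ℂ) + 3)⁻¹ * 2⁻¹) * z 1, analyticAt_const.mul (analyticAt_coord 1 0)⟩,
        Filter.Eventually.of_forall fun z => ?_⟩
      rw [h0, h1]
      change z 0 ^ (j + 3) = ((j : ℂ) + 3)⁻¹ * z 0 * (z 1 ^ 2 + (j + 3) * z 0 ^ (j + 2))
        + -(((j : ℂ) + 3)⁻¹ * 2⁻¹) * z 1 * (2 * z 0 * z 1)
      have : (j : ℂ) + 3 ≠ 0 := by norm_cast
      field_simp
      ring
    have hY : Ideal.Quotient.mk (jacobianIdeal (SingType.D (j + 4)).normalForm 0) (coordFun 1 ^ 2)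
        = Ideal.Quotient.mk _ (coordFun 0 ^ (j + 2) * algebraMap ℂ _ (-(j + 3))) := by
      refine Ideal.Quotient.eq.2 ⟨1, 0, Filter.Eventually.of_forall fun z => ?_⟩
      rw [h0]
      change z 1 ^ 2 - z 0 ^ (j + 2) * (-((j : ℂ) + 3)) = 1 * _ + 0 * _
      ring
    exact exists_eq_sum_quotient_D hX hXY hY

lemma milnorNumber_E6 : milnorNumber SingType.E6.normalForm 0 = 6 := by
  have h0 : ∀ z : Fin 2 → ℂ, eval z (pderiv 0 SingType.E6.normalForm) = 4 * z 0 ^ 3 := fun z => by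
    simp [SingType.normalForm, pderiv_X]
  have h1 : ∀ z : Fin 2 → ℂ, eval z (pderiv 1 SingType.E6.normalForm) = 3 * z 1 ^ 2 :=
    fun z => by simp [SingType.normalForm, pderiv_X]
  rw [milnorNumber_eq_card (ι := Fin 3 ⊕ Fin 3)
    (Sum.elim (fun i : Fin 3 => coordFun 0 ^ (i : ℕ))
        (fun i : Fin 3 => coordFun 0 ^ (i : ℕ) * coordFun 1))]
  · rfl
  · intro c p q hp hq hpq
    have hγ : Continuous (fun t : ℂ => (![t, 0] : Fin 2 → ℂ)) := by fun_prop
    have hδ : Continuous (fun t : ℂ => (![t, t ^ 3] : Fin 2 → ℂ)) := by fun_prop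
    have hγ0 : (![(0 : ℂ), 0] : Fin 2 → ℂ) = 0 := by ext i; fin_cases i <;> rfl
    have hδ0 : (![(0 : ℂ), 0 ^ 3] : Fin 2 → ℂ) = 0 := by ext i; fin_cases i <;> simp
    have hpγ : ContinuousAt (fun t : ℂ => 4 * p ![t, 0]) 0 :=
      continuousAt_const.mul
        (ContinuousAt.comp (by rw [hγ0]; exact hp.continuousAt) hγ.continuousAt)
    have hqδ : ContinuousAt (fun t : ℂ => 3 * q ![t, t ^ 3]) 0 :=
      continuousAt_const.mul
        (ContinuousAt.comp (by rw [hδ0]; exact hq.continuousAt) hδ.continuousAt)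
    have h2 : ∀ᶠ t in 𝓝[≠] (0 : ℂ), ∑ i : Fin 3, c (Sum.inl i) * t ^ (i : ℕ)
        = t ^ 3 * (4 * p ![t, 0]) := by
      filter_upwards [eventually_curve hpq hγ hγ0] with t ht
      rw [h0, h1, Fintype.sum_sum_type] at ht
      have ht' : ∑ i : Fin 3, c (Sum.inl i) * t ^ (i : ℕ)
        + ∑ i : Fin 3, c (Sum.inr i) * (t ^ (i : ℕ) * 0)
        = p ![t, 0] * (4 * t ^ 3) + q ![t, 0] * (3 * 0 ^ 2) := ht
      simp only [mul_zero, Finset.sum_const_zero, add_zero] at ht'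
      rw [ht']
      ring
    have hl : ∀ i, c (Sum.inl i) = 0 := coeff_eq_zero_of_isBigO (fun i => c (Sum.inl i))
      ((isBigO_pow_mul hpγ 3).congr' (by filter_upwards [h2] with t ht using ht.symm)
        Filter.EventuallyEq.rfl)
    have h3 : ∀ᶠ t in 𝓝[≠] (0 : ℂ), p ![t, 0] = 0 := by
      filter_upwards [h2, self_mem_nhdsWithin] with t ht ht0
      have ht0 : t ≠ 0 := ht0
      simp only [hl, zero_mul, Finset.sum_const_zero] at ht
      simpa [ht0] using ht.symm
    have h4 : ∀ᶠ t in 𝓝[≠] (0 : ℂ), ∑ i : Fin 3, c (Sum.inr i) * t ^ (i : ℕ)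
        = 4 * (p ![t, t ^ 3] - p ![t, 0]) + t ^ 3 * (3 * q ![t, t ^ 3]) := by
      filter_upwards [eventually_curve hpq hδ hδ0, h3, self_mem_nhdsWithin] with t ht ht3 ht0
      have ht0 : t ≠ 0 := ht0
      rw [h0, h1, Fintype.sum_sum_type] at ht
      have ht' : ∑ i : Fin 3, c (Sum.inl i) * t ^ (i : ℕ)
        + ∑ i : Fin 3, c (Sum.inr i) * (t ^ (i : ℕ) * t ^ 3)
        = p ![t, t ^ 3] * (4 * t ^ 3) + q ![t, t ^ 3] * (3 * (t ^ 3) ^ 2) := ht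
      simp only [hl, zero_mul, Finset.sum_const_zero, zero_add] at ht'
      rw [ht3]
      refine mul_right_cancel₀ (pow_ne_zero 3 ht0) ?_
      rw [Finset.sum_mul]
      simp only [mul_assoc] at ht' ⊢
      rw [ht']
      ring
    have h5 : (fun t : ℂ => p ![t, t ^ 3] - p ![t, 0]) =O[𝓝[≠] 0] (fun t => t ^ 3) := by
      have e1 := hp.hasStrictFDerivAt.isBigO_sub
      have e2 : Filter.Tendsto (fun t : ℂ => ((![t, t ^ 3] : Fin 2 → ℂ), (![t, 0] : Fin 2 → ℂ)))
          (𝓝[≠] 0) (𝓝 (0, 0)) := by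
        have e3 := (hδ.prodMk hγ).tendsto 0
        rw [hγ0, hδ0] at e3
        exact e3.mono_left nhdsWithin_le_nhds
      refine (e1.comp_tendsto e2).trans (Asymptotics.isBigO_of_le _ fun t => ?_)
      rw [pi_norm_le_iff_of_nonneg (norm_nonneg _)]
      intro i
      fin_cases i
      · simp
      · simp
    have hr : ∀ i, c (Sum.inr i) = 0 := coeff_eq_zero_of_isBigO (fun i => c (Sum.inr i))
      (((h5.const_mul_left 4).add (isBigO_pow_mul hqδ 3)).congr'
        (by filter_upwards [h4] with t ht using ht.symm) Filter.EventuallyEq.rfl)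
    rintro (i | i)
    · exact hl i
    · exact hr i
  · have hX : Ideal.Quotient.mk (jacobianIdeal SingType.E6.normalForm 0) (coordFun 0 ^ 3) = 0 := by
      refine Ideal.Quotient.eq_zero_iff_mem.2
        ⟨⟨fun _ => 4⁻¹, analyticAt_const⟩, 0, Filter.Eventually.of_forall fun z => ?_⟩
      rw [h0]
      change z 0 ^ 3 = 4⁻¹ * (4 * z 0 ^ 3) + 0 * _
      ring
    have hY : Ideal.Quotient.mk (jacobianIdeal SingType.E6.normalForm 0) (coordFun 1 ^ 2) = 0 := by
      refine Ideal.Quotient.eq_zero_iff_mem.2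
        ⟨0, ⟨fun _ => 3⁻¹, analyticAt_const⟩, Filter.Eventually.of_forall fun z => ?_⟩
      rw [h1]
      change z 1 ^ 2 = 0 * _ + 3⁻¹ * (3 * z 1 ^ 2)
      ring
    exact exists_eq_sum_quotient_E6 hX hY

/-- The Milnor number of a singularity of one of the types under consideration. -/
lemma milnorNumber_of_germEquiv_A {f : MvPolynomial (Fin 2) ℂ} {P : Fin 2 → ℂ} {n : ℕ} (hn : 1 ≤ n)
    (h : GermEquiv f P (SingType.A n).normalForm 0) : milnorNumber f P = n := by
  rw [← milnorNumber_A hn]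
  refine milnorNumber_eq_of_germEquiv h (E := fun z => ![z 0 / (n + 1), z 1 / 2])
    (AnalyticAt.pi fun i => ?_) ?_ fun z => ?_
  · fin_cases i
    · exact (analyticAt_coord 0 0).div_const
    · exact (analyticAt_coord 1 0).div_const
  · ext i; fin_cases i <;> simp
  · have : (n : ℂ) + 1 ≠ 0 := by norm_cast
    rw [(hasFDerivAt_eval _ z).fderiv]
    simp [SingType.normalForm, pderiv_X]
    field_simp
    ring

lemma milnorNumber_of_germEquiv_D {f : MvPolynomial (Fin 2) ℂ} {P : Fin 2 → ℂ} {k : ℕ} (hk : 4 ≤ k)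
    (h : GermEquiv f P (SingType.D k).normalForm 0) : milnorNumber f P = k := by
  obtain ⟨j, rfl⟩ : ∃ j, k = j + 4 := ⟨k - 4, by omega⟩
  rw [← milnorNumber_D j]
  -- weights `2` of `x`, `j + 2` of `y` and degree `2 (j + 3)`
  refine milnorNumber_eq_of_germEquiv h
    (E := fun z => ![z 0 / (j + 3), z 1 * (j + 2) / (2 * (j + 3))])
    (AnalyticAt.pi fun i => ?_) ?_ fun z => ?_
  · fin_cases i
    · exact (analyticAt_coord 0 0).div_const
    · exact ((analyticAt_coord 1 0).mul analyticAt_const).div_const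
  · ext i; fin_cases i <;> simp
  · have : (j : ℂ) + 3 ≠ 0 := by norm_cast
    have hk : j + 4 - 1 = j + 3 := by omega
    rw [(hasFDerivAt_eval _ z).fderiv]
    simp [SingType.normalForm, pderiv_X]
    field_simp
    ring

lemma milnorNumber_of_germEquiv_E6 {f : MvPolynomial (Fin 2) ℂ} {P : Fin 2 → ℂ}
    (h : GermEquiv f P SingType.E6.normalForm 0) : milnorNumber f P = 6 := by
  rw [← milnorNumber_E6]
  refine milnorNumber_eq_of_germEquiv h (E := fun z => ![z 0 / 4, z 1 / 3])
    (AnalyticAt.pi fun i => ?_) ?_ fun z => ?_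
  · fin_cases i
    · exact (analyticAt_coord 0 0).div_const
    · exact (analyticAt_coord 1 0).div_const
  · ext i; fin_cases i <;> simp
  · rw [(hasFDerivAt_eval _ z).fderiv]
    simp [SingType.normalForm, pderiv_X]
    field_simp
    ring

end TorusSextic

/-! ### Jets of pairs with an outer singularity at the origin -/

namespace TorusSextic

open MvPolynomial

lemma analyticAt_of_contDiff {f : (Fin 2 → ℂ) → ℂ} (h : ContDiff ℂ ⊤ f) (P : Fin 2 → ℂ) :
    AnalyticAt ℂ f P :=
  ContDiffAt.analyticAt h.contDiffAt

/-- The data that describe a pair with an outer singularity at the origin: with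
`m = 1 + α x + β y`, a quadratic form `q`, and forms `h₂`, `h₃` of degrees `2` and `3`,
it is `f₂ = -t² (m² + 2 q)`, `f₃ = t³ (m³ + 3 m q + m h₂ + h₃)`. -/
@[ext]
structure TorusJet (R : Type*) where
  (t α β q20 q11 q02 h20 h11 h02 h30 h21 h12 h03 : R)

namespace TorusJet

variable {R S : Type*} [CommRing R] [CommRing S]

/-- Extension of scalars. -/
def map (f : R →+* S) (J : TorusJet R) : TorusJet S :=
  ⟨f J.t, f J.α, f J.β, f J.q20, f J.q11, f J.q02, f J.h20, f J.h11, f J.h02, f J.h30, f J.h21,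
    f J.h12, f J.h03⟩

/-- The quadratic form `q`. -/
def q (J : TorusJet R) (x y : R) : R := J.q20 * x ^ 2 + J.q11 * x * y + J.q02 * y ^ 2

/-- The sum of the forms `h₂` and `h₃`. -/
def h (J : TorusJet R) (x y : R) : R :=
  J.h20 * x ^ 2 + J.h11 * x * y + J.h02 * y ^ 2 +
    (J.h30 * x ^ 3 + J.h21 * x ^ 2 * y + J.h12 * x * y ^ 2 + J.h03 * y ^ 3)

/-- The equation of the sextic in the projective coordinates that make `m` constant. -/
def germ (J : TorusJet R) (x y : R) : R :=
  (2 + 6 * J.q x y + J.h x y) * J.h x y - (3 + 8 * J.q x y) * J.q x y ^ 2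

/-- The coefficients of the conic. -/
def conicMatrix (J : TorusJet R) : Fin 3 → Fin 3 → R :=
  ![![-J.t ^ 2, -2 * J.t ^ 2 * J.β, -J.t ^ 2 * (J.β ^ 2 + 2 * J.q02)],
    ![-2 * J.t ^ 2 * J.α, -J.t ^ 2 * (2 * J.α * J.β + 2 * J.q11), 0],
    ![-J.t ^ 2 * (J.α ^ 2 + 2 * J.q20), 0, 0]]

/-- The coefficients of the cubic. -/
def cubicMatrix (J : TorusJet R) : Fin 4 → Fin 4 → R :=
  ![![J.t ^ 3, 3 * J.t ^ 3 * J.β, J.t ^ 3 * (3 * J.β ^ 2 + 3 * J.q02 + J.h02),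
      J.t ^ 3 * (J.β ^ 3 + J.β * (3 * J.q02 + J.h02) + J.h03)],
    ![3 * J.t ^ 3 * J.α, J.t ^ 3 * (6 * J.α * J.β + 3 * J.q11 + J.h11),
      J.t ^ 3 * (3 * J.α * J.β ^ 2 + J.α * (3 * J.q02 + J.h02) + J.β * (3 * J.q11 + J.h11) + J.h12),
      0],
    ![J.t ^ 3 * (3 * J.α ^ 2 + 3 * J.q20 + J.h20),
      J.t ^ 3 * (3 * J.α ^ 2 * J.β + J.β * (3 * J.q20 + J.h20) + J.α * (3 * J.q11 + J.h11) + J.h21),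
      0, 0],
    ![J.t ^ 3 * (J.α ^ 3 + J.α * (3 * J.q20 + J.h20) + J.h30), 0, 0, 0]]

/-- The coefficients of the pair. -/
def pair (J : TorusJet R) : CoeffIndex → R
  | .inl m => J.conicMatrix m.1.1 m.1.2
  | .inr m => J.cubicMatrix m.1.1 m.1.2

lemma pair_map (f : R →+* S) (J : TorusJet R) (i : CoeffIndex) :
    (J.map f).pair i = f (J.pair i) := by
  rcases i with ⟨⟨p, q⟩, h⟩ | ⟨⟨p, q⟩, h⟩
  · fin_cases p <;> fin_cases q <;> simp [pair, conicMatrix, map, map_ofNat]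
  · fin_cases p <;> fin_cases q <;> simp [pair, cubicMatrix, map, map_ofNat]

/-- The jet after the substitution of `y - p x` for `y` in `q`, `h₂`, `h₃`. -/
def shear (p : R) (J : TorusJet R) : TorusJet R :=
  { J with
    q20 := J.q20 - p * J.q11 + p ^ 2 * J.q02
    q11 := J.q11 - 2 * p * J.q02
    h20 := J.h20 - p * J.h11 + p ^ 2 * J.h02
    h11 := J.h11 - 2 * p * J.h02
    h30 := J.h30 - p * J.h21 + p ^ 2 * J.h12 - p ^ 3 * J.h03
    h21 := J.h21 - 2 * p * J.h12 + 3 * p ^ 2 * J.h03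
    h12 := J.h12 - 3 * p * J.h03 }

/-- The jet after the exchange of `x` and `y` in `q`, `h₂`, `h₃`. -/
def swap (J : TorusJet R) : TorusJet R :=
  { J with q20 := J.q02, q02 := J.q20, h20 := J.h02, h02 := J.h20, h30 := J.h03, h21 := J.h12,
           h12 := J.h21, h03 := J.h30 }

lemma shear_map (f : R →+* S) (p : R) (J : TorusJet R) :
    (J.shear p).map f = (J.map f).shear (f p) := by
  simp [shear, map, map_ofNat]

lemma shear_shear_neg (p : R) (J : TorusJet R) : (J.shear (-p)).shear p = J := by
  ext <;> simp only [shear] <;> ring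

lemma germ_shear (p : R) (J : TorusJet R) (x y : R) :
    (J.shear p).germ x y = J.germ x (y - p * x) := by
  simp only [germ, q, h, shear]; ring

lemma germ_swap (J : TorusJet R) (x y : R) : J.swap.germ x y = J.germ y x := by
  simp only [germ, q, h, swap]; ring

end TorusJet

lemma sum_mon_two {M : Type*} [CommRing M] (g : Fin 3 → Fin 3 → M) :
    ∑ m : Mon 2, g m.1.1 m.1.2 = g 0 0 + g 0 1 + g 0 2 + g 1 0 + g 1 1 + g 2 0 := by
  refine ((Finset.sum_subtype
    (Finset.univ.filter fun m : Fin 3 × Fin 3 => (m.1 : ℕ) + (m.2 : ℕ) ≤ 2) (by simp)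
    fun m => g m.1 m.2).symm).trans ?_
  rw [Finset.sum_filter, Fintype.sum_prod_type]
  simp [Fin.sum_univ_three]
  ring

lemma sum_mon_three {M : Type*} [CommRing M] (g : Fin 4 → Fin 4 → M) :
    ∑ m : Mon 3, g m.1.1 m.1.2 = g 0 0 + g 0 1 + g 0 2 + g 0 3 + g 1 0 + g 1 1 + g 1 2 + g 2 0
      + g 2 1 + g 3 0 := by
  refine ((Finset.sum_subtype
    (Finset.univ.filter fun m : Fin 4 × Fin 4 => (m.1 : ℕ) + (m.2 : ℕ) ≤ 3) (by simp)
    fun m => g m.1 m.2).symm).trans ?_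
  rw [Finset.sum_filter, Fintype.sum_prod_type]
  simp [Fin.sum_univ_four]
  ring

lemma planePoly_two (g : Fin 3 → Fin 3 → ℂ) : planePoly 2 (fun m => g m.1.1 m.1.2) =
    C (g 0 0) + C (g 0 1) * X 1 + C (g 0 2) * X 1 ^ 2 + C (g 1 0) * X 0 + C (g 1 1) * X 0 * X 1
      + C (g 2 0) * X 0 ^ 2 := by
  rw [planePoly, sum_mon_two fun p q => C (g p q) * X 0 ^ (p : ℕ) * X 1 ^ (q : ℕ)]
  simp

lemma planePoly_three (g : Fin 4 → Fin 4 → ℂ) : planePoly 3 (fun m => g m.1.1 m.1.2) =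
    C (g 0 0) + C (g 0 1) * X 1 + C (g 0 2) * X 1 ^ 2 + C (g 0 3) * X 1 ^ 3 + C (g 1 0) * X 0
      + C (g 1 1) * X 0 * X 1 + C (g 1 2) * X 0 * X 1 ^ 2 + C (g 2 0) * X 0 ^ 2
      + C (g 2 1) * X 0 ^ 2 * X 1 + C (g 3 0) * X 0 ^ 3 := by
  rw [planePoly, sum_mon_three fun p q => C (g p q) * X 0 ^ (p : ℕ) * X 1 ^ (q : ℕ)]
  simp

lemma conic_pair (J : TorusJet ℂ) : conic J.pair = planePoly 2 fun m => J.conicMatrix m.1.1 m.1.2 :=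
  rfl

lemma cubic_pair (J : TorusJet ℂ) : cubic J.pair = planePoly 3 fun m => J.cubicMatrix m.1.1 m.1.2 :=
  rfl

lemma eval_conic_pair (J : TorusJet ℂ) (z : Fin 2 → ℂ) : eval z (conic J.pair) =
    -J.t ^ 2 * ((1 + J.α * z 0 + J.β * z 1) ^ 2 + 2 * J.q (z 0) (z 1)) := by
  rw [conic_pair, planePoly_two]
  simp [TorusJet.conicMatrix, TorusJet.q]
  ring

lemma eval_cubic_pair (J : TorusJet ℂ) (z : Fin 2 → ℂ) : eval z (cubic J.pair) =
    J.t ^ 3 * ((1 + J.α * z 0 + J.β * z 1) ^ 3 + 3 * (1 + J.α * z 0 + J.β * z 1) * J.q (z 0) (z 1)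
      + (1 + J.α * z 0 + J.β * z 1) * (J.h20 * z 0 ^ 2 + J.h11 * z 0 * z 1 + J.h02 * z 1 ^ 2)
      + (J.h30 * z 0 ^ 3 + J.h21 * z 0 ^ 2 * z 1 + J.h12 * z 0 * z 1 ^ 2 + J.h03 * z 1 ^ 3)) := by
  rw [cubic_pair, planePoly_three]
  simp [TorusJet.cubicMatrix, TorusJet.q]
  ring

lemma eval_sextic_pair (J : TorusJet ℂ) (z : Fin 2 → ℂ) (hm : 1 + J.α * z 0 + J.β * z 1 ≠ 0) :
    eval z (sextic J.pair) = J.t ^ 6 * (1 + J.α * z 0 + J.β * z 1) ^ 6 *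
      J.germ (z 0 * (1 + J.α * z 0 + J.β * z 1)⁻¹) (z 1 * (1 + J.α * z 0 + J.β * z 1)⁻¹) := by
  rw [sextic, map_add, map_pow, map_pow, eval_conic_pair, eval_cubic_pair]
  simp only [TorusJet.germ, TorusJet.q, TorusJet.h]
  generalize 1 + J.α * z 0 + J.β * z 1 = m at hm ⊢
  field_simp
  ring

/-- The germ of the sextic of a jet. -/
lemma funGermEquiv_sextic_germ (J : TorusJet ℂ) (ht : J.t ≠ 0) :
    FunGermEquiv (fun z => eval z (sextic J.pair)) 0 (fun z => J.germ (z 0) (z 1)) 0 := by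
  have hm : AnalyticAt ℂ (fun z : Fin 2 → ℂ => 1 + J.α * z 0 + J.β * z 1) 0 :=
    analyticAt_of_contDiff (by fun_prop) 0
  have hm0 : (1 + J.α * (0 : Fin 2 → ℂ) 0 + J.β * (0 : Fin 2 → ℂ) 1) ≠ 0 := by simp
  have hi := hm.inv hm0
  refine funGermEquiv_of_coordinates (v := fun z => J.t ^ 6 * (1 + J.α * z 0 + J.β * z 1) ^ 6)
    (X := fun z => z 0 * (1 + J.α * z 0 + J.β * z 1)⁻¹ + z 1 * 0)
    (Y := fun z => z 0 * 0 + z 1 * (1 + J.α * z 0 + J.β * z 1)⁻¹)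
    hi analyticAt_const analyticAt_const hi (fun _ => rfl) (fun _ => rfl) ?_
    (analyticAt_const.mul (hm.pow 6)) ?_ ?_
  · simp
  · simpa using ht
  · filter_upwards [hm.continuousAt.eventually_ne hm0] with z hz
    rw [eval_sextic_pair J z hz]
    simp

lemma funGermEquiv_germ_shear (J : TorusJet ℂ) (p : ℂ) :
    FunGermEquiv (fun z => (J.shear p).germ (z 0) (z 1)) 0 (fun z => J.germ (z 0) (z 1)) 0 := by
  refine funGermEquiv_of_coordinates (v := fun _ => 1)
    (X := fun z => z 0 * 1 + z 1 * 0) (Y := fun z => z 0 * (-p) + z 1 * 1)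
    analyticAt_const analyticAt_const analyticAt_const analyticAt_const (fun _ => rfl)
    (fun _ => rfl) (by simp) analyticAt_const one_ne_zero (Filter.Eventually.of_forall fun z => ?_)
  simp only [TorusJet.germ_shear, Matrix.cons_val_zero, Matrix.cons_val_one]
  ring_nf

lemma funGermEquiv_germ_swap (J : TorusJet ℂ) :
    FunGermEquiv (fun z => J.swap.germ (z 0) (z 1)) 0 (fun z => J.germ (z 0) (z 1)) 0 := by
  refine funGermEquiv_of_coordinates (v := fun _ => 1)
    (X := fun z => z 0 * 0 + z 1 * 1) (Y := fun z => z 0 * 1 + z 1 * 0)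
    analyticAt_const analyticAt_const analyticAt_const analyticAt_const (fun _ => rfl)
    (fun _ => rfl) (by simp) analyticAt_const one_ne_zero (Filter.Eventually.of_forall fun z => ?_)
  simp only [TorusJet.germ_swap, Matrix.cons_val_zero, Matrix.cons_val_one]
  ring_nf

lemma eval_pderiv_sextic (c : Pair) (i : Fin 2) (z : Fin 2 → ℂ) :
    eval z (pderiv i (sextic c)) = 3 * eval z (conic c) ^ 2 * eval z (pderiv i (conic c))
      + 2 * eval z (cubic c) * eval z (pderiv i (cubic c)) := by
  rw [sextic, map_add, Derivation.leibniz_pow, Derivation.leibniz_pow]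
  simp
  ring

/-- Coefficients indexed by the monomials come from a square array, which can be written out as a
matrix. -/
lemma exists_extension {d : ℕ} (a : Mon d → ℂ) :
    ∃ g : Fin (d + 1) → Fin (d + 1) → ℂ, a = fun m => g m.1.1 m.1.2 := by
  refine ⟨fun p q => if h : (p : ℕ) + (q : ℕ) ≤ d then a ⟨(p, q), h⟩ else 0, ?_⟩
  ext ⟨⟨p, q⟩, h⟩
  have h : (p : ℕ) + (q : ℕ) ≤ d := h
  simp [h]

lemma isOuterSingularity_pair (J : TorusJet ℂ) (ht : J.t ≠ 0) : IsOuterSingularity J.pair 0 := by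
  refine ⟨⟨?_, fun i => ?_⟩, ?_⟩
  · rw [eval_sextic_pair J 0 (by simp)]
    simp [TorusJet.germ, TorusJet.q, TorusJet.h]
  · rw [eval_pderiv_sextic, conic_pair, cubic_pair, planePoly_two, planePoly_three]
    fin_cases i
    · simp [TorusJet.conicMatrix, TorusJet.cubicMatrix, pderiv_X]
      ring
    · simp [TorusJet.conicMatrix, TorusJet.cubicMatrix, pderiv_X]
      ring
  · rw [eval_conic_pair]
    simpa [TorusJet.q] using ht

/-- Every pair with an outer singularity at the origin comes from a jet. -/
lemma exists_jet_of_isOuterSingularity {c : Pair} (h : IsOuterSingularity c 0) :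
    ∃ J : TorusJet ℂ, J.t ≠ 0 ∧ c = J.pair := by
  obtain ⟨a, ha⟩ := exists_extension fun m => c (Sum.inl m)
  obtain ⟨b, hb⟩ := exists_extension fun m => c (Sum.inr m)
  obtain ⟨⟨h0, h1⟩, h2⟩ := h
  have hx := h1 0
  have hy := h1 1
  have ec : conic c = planePoly 2 fun m => a m.1.1 m.1.2 := by rw [conic, ha]
  have ed : cubic c = planePoly 3 fun m => b m.1.1 m.1.2 := by rw [cubic, hb]
  rw [eval_pderiv_sextic] at hx hy
  rw [sextic, map_add, map_pow, map_pow] at h0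
  rw [ec, planePoly_two] at h0 h2 hx hy
  rw [ed, planePoly_three] at h0 hx hy
  simp [pderiv_X] at h0 h2 hx hy
  have hb0 : b 0 0 ≠ 0 := by
    intro hb0
    rw [hb0] at h0
    exact h2 (by simpa using h0)
  have ht2 : (-(b 0 0) / a 0 0) ^ 2 = -a 0 0 := by
    field_simp
    linear_combination h0
  have ht3 : (-(b 0 0) / a 0 0) ^ 3 = b 0 0 := by
    field_simp
    linear_combination -h0
  have ex : b 1 0 = 3 * b 0 0 * (a 1 0 / (2 * a 0 0)) := by
    field_simp
    refine mul_left_cancel₀ hb0 ?_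
    linear_combination (a 0 0) * hx - 3 * (a 1 0) * h0
  have ey : b 0 1 = 3 * b 0 0 * (a 0 1 / (2 * a 0 0)) := by
    field_simp
    refine mul_left_cancel₀ hb0 ?_
    linear_combination (a 0 0) * hy - 3 * (a 0 1) * h0
  -- the forms `q`, `h₂`, `h₃` are read off degree by degree
  obtain ⟨α, hα⟩ : ∃ α, α = a 1 0 / (2 * a 0 0) := ⟨_, rfl⟩
  obtain ⟨β, hβ⟩ : ∃ β, β = a 0 1 / (2 * a 0 0) := ⟨_, rfl⟩
  obtain ⟨q20, hq20⟩ : ∃ q, q = (a 2 0 / a 0 0 - α ^ 2) / 2 := ⟨_, rfl⟩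
  obtain ⟨q11, hq11⟩ : ∃ q, q = (a 1 1 / a 0 0 - 2 * α * β) / 2 := ⟨_, rfl⟩
  obtain ⟨q02, hq02⟩ : ∃ q, q = (a 0 2 / a 0 0 - β ^ 2) / 2 := ⟨_, rfl⟩
  obtain ⟨h20, hh20⟩ : ∃ q, q = b 2 0 / b 0 0 - 3 * α ^ 2 - 3 * q20 := ⟨_, rfl⟩
  obtain ⟨h11, hh11⟩ : ∃ q, q = b 1 1 / b 0 0 - 6 * α * β - 3 * q11 := ⟨_, rfl⟩
  obtain ⟨h02, hh02⟩ : ∃ q, q = b 0 2 / b 0 0 - 3 * β ^ 2 - 3 * q02 := ⟨_, rfl⟩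
  rw [← hα] at ex
  rw [← hβ] at ey
  have ex' : a 1 0 = 2 * a 0 0 * α := by rw [hα]; field_simp
  have ey' : a 0 1 = 2 * a 0 0 * β := by rw [hβ]; field_simp
  refine ⟨⟨-(b 0 0) / a 0 0, α, β, q20, q11, q02, h20, h11, h02,
    b 3 0 / b 0 0 - (α ^ 3 + α * (3 * q20 + h20)),
    b 2 1 / b 0 0 - (3 * α ^ 2 * β + β * (3 * q20 + h20) + α * (3 * q11 + h11)),
    b 1 2 / b 0 0 - (3 * α * β ^ 2 + α * (3 * q02 + h02) + β * (3 * q11 + h11)),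
    b 0 3 / b 0 0 - (β ^ 3 + β * (3 * q02 + h02))⟩, div_ne_zero (neg_ne_zero.2 hb0) h2, ?_⟩
  have ha' := fun m => congrFun ha m
  have hb' := fun m => congrFun hb m
  ext i
  rcases i with m | m
  · rw [ha']
    obtain ⟨⟨p, r⟩, hm⟩ := m
    simp only [TorusJet.pair, TorusJet.conicMatrix, ht2]
    fin_cases p <;> fin_cases r <;> simp at hm ⊢
    · rw [ey']
    · rw [hq02]; field_simp; ring
    · rw [ex']
    · rw [hq11]; field_simp; ring
    · rw [hq20]; field_simp; ring
  · rw [hb']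
    obtain ⟨⟨p, r⟩, hm⟩ := m
    simp only [TorusJet.pair, TorusJet.cubicMatrix, ht3]
    fin_cases p <;> fin_cases r <;> simp at hm ⊢
    · rw [ey]
    · rw [hh02]; field_simp; ring
    · field_simp
    · rw [ex]
    · rw [hh11]; field_simp; ring
    · field_simp
    · rw [hh20]; field_simp; ring
    · field_simp
    · field_simp

end TorusSextic

/-! ### Sufficient conditions for the type of a jet -/

namespace TorusSextic

open MvPolynomial

namespace TorusJet

variable (J : TorusJet ℂ)

lemma funGermEquiv_A1 (h02 : J.h02 ≠ 0) (hd : J.h11 ^ 2 ≠ 4 * J.h20 * J.h02) :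
    FunGermEquiv (fun z => J.germ (z 0) (z 1)) 0 (fun z => eval z (SingType.A 1).normalForm) 0 := by
  refine funGermEquiv_A (n := 1) (M := 1)
    (A := fun z => (2 + 6 * J.q (z 0) (z 1) + J.h (z 0) (z 1)) * (J.h20 + J.h30 * z 0)
        - (3 + 8 * J.q (z 0) (z 1)) * J.q20 ^ 2 * z 0 ^ 2)
    (B := fun z => (2 + 6 * J.q (z 0) (z 1) + J.h (z 0) (z 1)) * (J.h11 + J.h21 * z 0)
        - (3 + 8 * J.q (z 0) (z 1)) * (2 * J.q20 * J.q11) * z 0 ^ 2)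
    (C := fun z => (2 + 6 * J.q (z 0) (z 1) + J.h (z 0) (z 1)) * (J.h02 + J.h12 * z 0 + J.h03 * z 1)
      - (3 + 8 * J.q (z 0) (z 1)) * ((J.q11 ^ 2 + 2 * J.q20 * J.q02) * z 0 ^ 2
        + 2 * J.q11 * J.q02 * z 0 * z 1 + J.q02 ^ 2 * z 1 ^ 2))
    le_rfl le_rfl
    (analyticAt_of_contDiff (by simp only [q, h]; fun_prop) 0)
    (analyticAt_of_contDiff (by simp only [q, h]; fun_prop) 0)
    (analyticAt_of_contDiff (by simp only [q, h]; fun_prop) 0)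
    ?_ ?_ (Filter.Eventually.of_forall fun z => ?_)
  · simpa [q, h] using h02
  · simp [q, h]
    intro h0
    apply hd
    field_simp at h0
    linear_combination -h0 / 2
  · simp only [germ, q, h]; ring

lemma funGermEquiv_A2 (h20 : J.h20 = 0) (h11 : J.h11 = 0) (h02 : J.h02 ≠ 0)
    (h30 : J.h30 ≠ 0) :
    FunGermEquiv (fun z => J.germ (z 0) (z 1)) 0 (fun z => eval z (SingType.A 2).normalForm) 0 := by
  refine funGermEquiv_A (n := 2) (M := 2)
    (A := fun z => (2 + 6 * J.q (z 0) (z 1) + J.h (z 0) (z 1)) * J.h30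
        - (3 + 8 * J.q (z 0) (z 1)) * J.q20 ^ 2 * z 0)
    (B := fun z => (2 + 6 * J.q (z 0) (z 1) + J.h (z 0) (z 1)) * J.h21
        - (3 + 8 * J.q (z 0) (z 1)) * (2 * J.q20 * J.q11) * z 0)
    (C := fun z => (2 + 6 * J.q (z 0) (z 1) + J.h (z 0) (z 1)) * (J.h02 + J.h12 * z 0 + J.h03 * z 1)
      - (3 + 8 * J.q (z 0) (z 1)) * ((J.q11 ^ 2 + 2 * J.q20 * J.q02) * z 0 ^ 2
        + 2 * J.q11 * J.q02 * z 0 * z 1 + J.q02 ^ 2 * z 1 ^ 2))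
    (by norm_num) (by norm_num)
    (analyticAt_of_contDiff (by simp only [q, h]; fun_prop) 0)
    (analyticAt_of_contDiff (by simp only [q, h]; fun_prop) 0)
    (analyticAt_of_contDiff (by simp only [q, h]; fun_prop) 0)
    ?_ ?_ (Filter.Eventually.of_forall fun z => ?_)
  · simpa [q, h] using h02
  · simpa [q, h] using h30
  · simp only [germ, q, h, h20, h11]; ring

/-- The part of weighted degree `4`, for the weights `1` of `x` and `2` of `y`, is not a square. -/
lemma funGermEquiv_A3 (h20 : J.h20 = 0) (h11 : J.h11 = 0) (h02 : J.h02 ≠ 0)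
    (h30 : J.h30 = 0) (hd : 6 * J.h02 * J.q20 ^ 2 + J.h21 ^ 2 ≠ 0) :
    FunGermEquiv (fun z => J.germ (z 0) (z 1)) 0 (fun z => eval z (SingType.A 3).normalForm) 0 := by
  refine funGermEquiv_A (n := 3) (M := 2)
    (A := fun z => -(3 + 8 * J.q (z 0) (z 1)) * J.q20 ^ 2)
    (B := fun z => (2 + 6 * J.q (z 0) (z 1) + J.h (z 0) (z 1)) * J.h21
        - (3 + 8 * J.q (z 0) (z 1)) * (2 * J.q20 * J.q11) * z 0)
    (C := fun z => (2 + 6 * J.q (z 0) (z 1) + J.h (z 0) (z 1)) * (J.h02 + J.h12 * z 0 + J.h03 * z 1)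
      - (3 + 8 * J.q (z 0) (z 1)) * ((J.q11 ^ 2 + 2 * J.q20 * J.q02) * z 0 ^ 2
        + 2 * J.q11 * J.q02 * z 0 * z 1 + J.q02 ^ 2 * z 1 ^ 2))
    (by norm_num) (by norm_num)
    (analyticAt_of_contDiff (by simp only [q]; fun_prop) 0)
    (analyticAt_of_contDiff (by simp only [q, h]; fun_prop) 0)
    (analyticAt_of_contDiff (by simp only [q, h]; fun_prop) 0)
    ?_ ?_ (Filter.Eventually.of_forall fun z => ?_)
  · simpa [q, h] using h02
  · simp [q, h]
    intro h0
    apply hd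
    field_simp at h0
    linear_combination -h0 / 2
  · simp only [germ, q, h, h20, h11, h30]; ring

lemma funGermEquiv_D4 (h20 : J.h20 = 0) (h11 : J.h11 = 0) (h02 : J.h02 = 0)
    (h30 : J.h30 = 0) (h21 : J.h21 ≠ 0) (hd : J.h12 ^ 2 ≠ 4 * J.h03 * J.h21) :
    FunGermEquiv (fun z => J.germ (z 0) (z 1)) 0 (fun z => eval z (SingType.D 4).normalForm) 0 := by
  refine (funGermEquiv_germ_swap J).symm.trans ?_
  refine TorusSextic.funGermEquiv_D4
    (A := fun z => (2 + 6 * J.q (z 1) (z 0) + J.h (z 1) (z 0)) * J.h03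
        - (3 + 8 * J.q (z 1) (z 0)) * J.q02 ^ 2 * z 0)
    (B := fun z => (2 + 6 * J.q (z 1) (z 0) + J.h (z 1) (z 0)) * J.h12
        - (3 + 8 * J.q (z 1) (z 0)) * (2 * J.q11 * J.q02) * z 0)
    (C := fun z => (2 + 6 * J.q (z 1) (z 0) + J.h (z 1) (z 0)) * J.h21
      - (3 + 8 * J.q (z 1) (z 0)) * ((J.q11 ^ 2 + 2 * J.q20 * J.q02) * z 0
        + 2 * J.q20 * J.q11 * z 1))
    (D := fun z => -(3 + 8 * J.q (z 1) (z 0)) * J.q20 ^ 2)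
    (analyticAt_of_contDiff (by simp only [q, h]; fun_prop) 0)
    (analyticAt_of_contDiff (by simp only [q, h]; fun_prop) 0)
    (analyticAt_of_contDiff (by simp only [q, h]; fun_prop) 0)
    (analyticAt_of_contDiff (by simp only [q]; fun_prop) 0)
    ?_ ?_ (Filter.Eventually.of_forall fun z => ?_)
  · simpa [q, h] using h21
  · simp only [q, h, Pi.zero_apply]
    intro h0
    apply hd
    linear_combination -h0 / 4
  · simp only [germ, q, h, swap, h20, h11, h02, h30]; ring

lemma funGermEquiv_E6 (h20 : J.h20 = 0) (h11 : J.h11 = 0) (h02 : J.h02 = 0)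
    (h30 : J.h30 = 0) (h21 : J.h21 = 0) (h12 : J.h12 = 0) (h03 : J.h03 ≠ 0) (hq : J.q20 ≠ 0) :
    FunGermEquiv (fun z => J.germ (z 0) (z 1)) 0 (fun z => eval z SingType.E6.normalForm) 0 := by
  refine TorusSextic.funGermEquiv_E6
    (A := fun z => -(3 + 8 * J.q (z 0) (z 1)) * J.q20 ^ 2)
    (B := fun z => -(3 + 8 * J.q (z 0) (z 1)) * (2 * J.q20 * J.q11))
    (C := fun z => -(3 + 8 * J.q (z 0) (z 1)) * (J.q11 ^ 2 + 2 * J.q20 * J.q02))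
    (D := fun z => (2 + 6 * J.q (z 0) (z 1) + J.h (z 0) (z 1)) * J.h03
        - (3 + 8 * J.q (z 0) (z 1)) * (2 * J.q11 * J.q02 * z 0 + J.q02 ^ 2 * z 1))
    (analyticAt_of_contDiff (by simp only [q]; fun_prop) 0)
    (analyticAt_of_contDiff (by simp only [q]; fun_prop) 0)
    (analyticAt_of_contDiff (by simp only [q]; fun_prop) 0)
    (analyticAt_of_contDiff (by simp only [q, h]; fun_prop) 0)
    ?_ ?_ (Filter.Eventually.of_forall fun z => ?_)
  · simpa [q, h] using hq
  · simpa [q, h] using h03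
  · simp only [germ, q, h, h20, h11, h02, h30, h21, h12]; ring


/-- The germ in the coordinates `x`, `Y = y - s x²` that straighten the double parabola. -/
lemma funGermEquiv_germ_parabola (s : ℂ) : FunGermEquiv (fun z => J.germ (z 0) (z 1)) 0
    (fun z => J.germ (z 0) (z 1 + s * z 0 ^ 2)) 0 := by
  refine funGermEquiv_of_coordinates (v := fun _ => 1)
    (X := fun z => z 0 * 1 + z 1 * 0) (Y := fun z => z 0 * (-s * z 0) + z 1 * 1)
    analyticAt_const analyticAt_const (analyticAt_of_contDiff (by fun_prop) 0) analyticAt_const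
    (fun _ => rfl) (fun _ => rfl) (by simp) analyticAt_const one_ne_zero
    (Filter.Eventually.of_forall fun z => ?_)
  simp only [Matrix.cons_val_zero, Matrix.cons_val_one]
  ring_nf

/-- After the substitution of `y + s x ^ 2` for `y` the double parabola, which is the part of
weighted degree `4`, becomes a multiple of `y ^ 2`, and the term in `x ^ 5` decides. -/
lemma funGermEquiv_A4 {κ s : ℂ} (h20 : J.h20 = 0) (h11 : J.h11 = 0)
    (h02 : J.h02 = -6 * κ ^ 2) (h30 : J.h30 = 0) (h21 : J.h21 = 12 * κ ^ 2 * s)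
    (q20 : J.q20 = 2 * κ * s) (hκ : κ ≠ 0) (hs : s ≠ 0) (h12 : J.h12 ≠ 6 * κ * J.q11) :
    FunGermEquiv (fun z => J.germ (z 0) (z 1)) 0 (fun z => eval z (SingType.A 4).normalForm) 0 := by
  refine (funGermEquiv_germ_parabola J s).trans ?_
  obtain ⟨Q, hQ⟩ : ∃ Q : (Fin 2 → ℂ) → ℂ, Q = fun z => J.q (z 0) (z 1 + s * z 0 ^ 2) := ⟨_, rfl⟩
  obtain ⟨H, hH⟩ : ∃ H : (Fin 2 → ℂ) → ℂ, H = fun z => J.h (z 0) (z 1 + s * z 0 ^ 2) := ⟨_, rfl⟩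
  obtain ⟨L, hL⟩ : ∃ L : (Fin 2 → ℂ) → ℂ, L = fun z => J.q11 + J.q02 * s * z 0 := ⟨_, rfl⟩
  obtain ⟨M, hM⟩ : ∃ M : (Fin 2 → ℂ) → ℂ, M = fun z => J.h12 + J.h03 * s * z 0 := ⟨_, rfl⟩
  obtain ⟨N, hN⟩ : ∃ N : (Fin 2 → ℂ) → ℂ,
    N = fun z => z 0 * L z + s * z 0 ^ 2 * J.q02 + J.q02 * z 1 := ⟨_, rfl⟩
  obtain ⟨K, hK⟩ : ∃ K : (Fin 2 → ℂ) → ℂ,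
    K = fun z => 2 * s * z 0 ^ 2 * J.h03 + (z 0 * M z + J.h03 * z 1) := ⟨_, rfl⟩
  obtain ⟨R, hR⟩ : ∃ R : (Fin 2 → ℂ) → ℂ,
    R = fun z => s ^ 2 * J.h03 * z 0 + 2 * s * M z := ⟨_, rfl⟩
  refine funGermEquiv_A (n := 4) (M := 3)
    (A := fun z => s ^ 2 * ((2 + 6 * Q z + H z) * M z - (3 + 8 * Q z) * (4 * κ * L z))
      + z 0 * (8 * κ ^ 3 * s ^ 3 - (3 + 8 * Q z) * s ^ 2 * L z ^ 2 + 4 * κ ^ 2 * s ^ 3 * L z * z 0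
        + 36 * κ ^ 4 * s ^ 4 * z 0 ^ 2 + 6 * κ ^ 2 * s ^ 4 * M z * z 0 ^ 3))
    (B := fun z => (2 + 6 * Q z + H z) * R z
      - (3 + 8 * Q z) * (4 * κ * s * (L z + s * J.q02 * z 0) + 2 * s * L z * N z)
      + 4 * κ ^ 2 * s ^ 2 * z 0 * N z + 6 * κ ^ 2 * s ^ 2 * z 0 ^ 4 * R z)
    (C := fun z => -6 * κ ^ 2 * (2 + 6 * Q z + H z) + (2 + 6 * Q z + H z) * K z
      - (3 + 8 * Q z) * (4 * κ * s * J.q02 * z 0 ^ 2 + N z ^ 2)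
      - 36 * κ ^ 4 * s ^ 2 * z 0 ^ 4 + 6 * κ ^ 2 * s ^ 2 * z 0 ^ 4 * K z)
    (by norm_num) (by norm_num)
    (analyticAt_of_contDiff (by simp only [hQ, hH, hL, hM, q, h]; fun_prop) 0)
    (analyticAt_of_contDiff (by simp only [hQ, hH, hL, hM, hN, hR, q, h]; fun_prop) 0)
    (analyticAt_of_contDiff (by simp only [hQ, hH, hL, hM, hN, hK, q, h]; fun_prop) 0)
    ?_ ?_ (Filter.Eventually.of_forall fun z => ?_)
  · simpa [hQ, hH, hL, hM, hN, hK, q, h] using hκ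
  · simp [hQ, hH, hL, hM, q, h]
    refine ⟨hs, fun h0 => h12 ?_⟩
    linear_combination h0 / 2
  · simp only [hQ, hH, hL, hM, hN, hK, hR, germ, q, h, h20, h11, h02, h30, h21, q20]; ring

/-- The case in which the term in `x ^ 5` vanishes as well, so that `x ^ 6` decides. -/
lemma funGermEquiv_A5 {κ s : ℂ} (h20 : J.h20 = 0) (h11 : J.h11 = 0)
    (h02 : J.h02 = -6 * κ ^ 2) (h30 : J.h30 = 0) (h21 : J.h21 = 12 * κ ^ 2 * s)
    (q20 : J.q20 = 2 * κ * s) (hκ : κ ≠ 0) (h12 : J.h12 = 6 * κ * J.q11)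
    (hd : 2 * s ^ 3 * (J.h03 - 6 * κ * J.q02) + 8 * κ ^ 3 * s ^ 3 ≠ 0) :
    FunGermEquiv (fun z => J.germ (z 0) (z 1)) 0 (fun z => eval z (SingType.A 5).normalForm) 0 := by
  refine (funGermEquiv_germ_parabola J s).trans ?_
  obtain ⟨Q, hQ⟩ : ∃ Q : (Fin 2 → ℂ) → ℂ, Q = fun z => J.q (z 0) (z 1 + s * z 0 ^ 2) := ⟨_, rfl⟩
  obtain ⟨H, hH⟩ : ∃ H : (Fin 2 → ℂ) → ℂ, H = fun z => J.h (z 0) (z 1 + s * z 0 ^ 2) := ⟨_, rfl⟩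
  obtain ⟨L, hL⟩ : ∃ L : (Fin 2 → ℂ) → ℂ, L = fun z => J.q11 + J.q02 * s * z 0 := ⟨_, rfl⟩
  obtain ⟨M, hM⟩ : ∃ M : (Fin 2 → ℂ) → ℂ, M = fun z => J.h12 + J.h03 * s * z 0 := ⟨_, rfl⟩
  obtain ⟨N, hN⟩ : ∃ N : (Fin 2 → ℂ) → ℂ,
    N = fun z => z 0 * L z + s * z 0 ^ 2 * J.q02 + J.q02 * z 1 := ⟨_, rfl⟩
  obtain ⟨K, hK⟩ : ∃ K : (Fin 2 → ℂ) → ℂ,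
    K = fun z => 2 * s * z 0 ^ 2 * J.h03 + (z 0 * M z + J.h03 * z 1) := ⟨_, rfl⟩
  obtain ⟨R, hR⟩ : ∃ R : (Fin 2 → ℂ) → ℂ,
    R = fun z => s ^ 2 * J.h03 * z 0 + 2 * s * M z := ⟨_, rfl⟩
  refine funGermEquiv_A (n := 5) (M := 3)
    (A := fun z => s ^ 2 * (2 * J.h03 * s - 12 * κ * J.q02 * s
        + (2 * κ * s * z 0 + s * z 0 ^ 2 * L z) * (6 * M z - 32 * κ * L z)
        + (6 * κ ^ 2 * s ^ 2 * z 0 ^ 3 + s ^ 2 * M z * z 0 ^ 4) * M z)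
      + (8 * κ ^ 3 * s ^ 3 - (3 + 8 * Q z) * s ^ 2 * L z ^ 2 + 4 * κ ^ 2 * s ^ 3 * L z * z 0
        + 36 * κ ^ 4 * s ^ 4 * z 0 ^ 2 + 6 * κ ^ 2 * s ^ 4 * M z * z 0 ^ 3))
    (B := fun z => (2 + 6 * Q z + H z) * R z
      - (3 + 8 * Q z) * (4 * κ * s * (L z + s * J.q02 * z 0) + 2 * s * L z * N z)
      + 4 * κ ^ 2 * s ^ 2 * z 0 * N z + 6 * κ ^ 2 * s ^ 2 * z 0 ^ 4 * R z
      + s ^ 2 * z 0 ^ 2 * (N z * (6 * M z - 32 * κ * L z)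
        + M z * (z 0 ^ 3 * R z + z 1 * (-6 * κ ^ 2 + K z))))
    (C := fun z => -6 * κ ^ 2 * (2 + 6 * Q z + H z) + (2 + 6 * Q z + H z) * K z
      - (3 + 8 * Q z) * (4 * κ * s * J.q02 * z 0 ^ 2 + N z ^ 2)
      - 36 * κ ^ 4 * s ^ 2 * z 0 ^ 4 + 6 * κ ^ 2 * s ^ 2 * z 0 ^ 4 * K z)
    (by norm_num) (by norm_num)
    (analyticAt_of_contDiff (by simp only [hQ, hL, hM, q]; fun_prop) 0)
    (analyticAt_of_contDiff (by simp only [hQ, hH, hL, hM, hN, hK, hR, q, h]; fun_prop) 0)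
    (analyticAt_of_contDiff (by simp only [hQ, hH, hL, hM, hN, hK, q, h]; fun_prop) 0)
    ?_ ?_ (Filter.Eventually.of_forall fun z => ?_)
  · simpa [hQ, hH, hL, hM, hN, hK, q, h] using hκ
  · simp [hQ, hH, hL, hM, hN, hK, hR, q, h, h12]
    intro h0
    apply hd
    field_simp at h0
    linear_combination h0 / 48
  · simp only [hQ, hH, hL, hM, hN, hK, hR, germ, q, h, h20, h11, h02, h30, h21, q20, h12]; ring

/-- Linear coordinates along the tangents `h12 x + h03 y = 0` and `y = 0` of the two branches reduce
the cubic part to `x y ^ 2`. -/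
lemma funGermEquiv_D5 (h20 : J.h20 = 0) (h11 : J.h11 = 0) (h02 : J.h02 = 0)
    (h30 : J.h30 = 0) (h21 : J.h21 = 0) (h12 : J.h12 ≠ 0) (hq : J.q20 ≠ 0) :
    FunGermEquiv (fun z => J.germ (z 0) (z 1)) 0 (fun z => eval z (SingType.D 5).normalForm) 0 := by
  -- the simple branch is tangent to `h12 x + h03 y`
  obtain ⟨J', hJ'⟩ : ∃ J' : TorusJet ℂ, J' = { J with
    q20 := J.q20 / J.h12 ^ 2
    q11 := J.q11 / J.h12 - 2 * J.q20 * J.h03 / J.h12 ^ 2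
    q02 := J.q02 - J.q11 * J.h03 / J.h12 + J.q20 * J.h03 ^ 2 / J.h12 ^ 2
    h12 := 1
    h03 := 0 } := ⟨_, rfl⟩
  have e20 : J'.h20 = 0 := by rw [hJ']; exact h20
  have e11 : J'.h11 = 0 := by rw [hJ']; exact h11
  have e02 : J'.h02 = 0 := by rw [hJ']; exact h02
  have e30 : J'.h30 = 0 := by rw [hJ']; exact h30
  have e21 : J'.h21 = 0 := by rw [hJ']; exact h21
  have e12 : J'.h12 = 1 := by rw [hJ']
  have e03 : J'.h03 = 0 := by rw [hJ']
  have eq : J'.q20 ≠ 0 := by rw [hJ']; exact div_ne_zero hq (pow_ne_zero 2 h12)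
  have h1 : FunGermEquiv (fun z => J.germ (z 0) (z 1)) 0 (fun z => J'.germ (z 0) (z 1)) 0 := by
    refine funGermEquiv_of_coordinates (v := fun _ => 1)
      (X := fun z => z 0 * J.h12 + z 1 * J.h03) (Y := fun z => z 0 * 0 + z 1 * 1)
      analyticAt_const analyticAt_const analyticAt_const analyticAt_const
      (fun _ => rfl) (fun _ => rfl) (by simpa using h12) analyticAt_const one_ne_zero
      (Filter.Eventually.of_forall fun z => ?_)
    have hQ : J'.q (z 0 * J.h12 + z 1 * J.h03) (z 1) = J.q (z 0) (z 1) := by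
      simp only [hJ', q]
      field_simp
      ring
    have hH : J'.h (z 0 * J.h12 + z 1 * J.h03) (z 1) = J.h (z 0) (z 1) := by
      simp only [h, e20, e11, e02, e30, e21, e12, e03, h20, h11, h02, h30, h21]
      ring
    simp only [Matrix.cons_val_zero, Matrix.cons_val_one, mul_zero, zero_add, mul_one, one_mul]
    rw [germ, germ, hQ, hH]
  refine h1.trans ?_
  refine TorusSextic.funGermEquiv_D5
    (A := fun z => -(3 + 8 * J'.q (z 0) (z 1)) * J'.q20 ^ 2)
    (B := fun z => -(3 + 8 * J'.q (z 0) (z 1)) * (2 * J'.q20 * J'.q11))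
    (C := fun z => (2 + 6 * J'.q (z 0) (z 1) + J'.h (z 0) (z 1))
      - (3 + 8 * J'.q (z 0) (z 1)) * ((J'.q11 ^ 2 + 2 * J'.q20 * J'.q02) * z 0
        + 2 * J'.q11 * J'.q02 * z 1))
    (D := fun z => -(3 + 8 * J'.q (z 0) (z 1)) * J'.q02 ^ 2)
    (analyticAt_of_contDiff (by simp only [q]; fun_prop) 0)
    (analyticAt_of_contDiff (by simp only [q]; fun_prop) 0)
    (analyticAt_of_contDiff (by simp only [q, h]; fun_prop) 0)
    (analyticAt_of_contDiff (by simp only [q]; fun_prop) 0) ?_ ?_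
    (Filter.Eventually.of_forall fun z => ?_)
  · simp [q, h]
  · simpa [q, h] using eq
  · simp only [germ, q, h, e20, e11, e02, e30, e21, e12, e03]; ring

end TorusJet

end TorusSextic

/-! ### Leading terms of pullbacks -/

namespace TorusSextic

open MvPolynomial

namespace TorusJet

/-- The germ of `J` pulls back to a unit times `g` under a local biholomorphism
`(x a + y b, x² r + y d)`, of which `a`, `b`, `r`, `d` are the values at the origin (that of the
unit being `u`). The statement concerns the restrictions to all differentiable curves `(P, Q)`. -/
def NormalPullback (J : TorusJet ℂ) (g : (Fin 2 → ℂ) → ℂ) (a b r d u : ℂ) : Prop :=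
  ∀ P Q : ℂ → ℂ, Differentiable ℂ P → Differentiable ℂ Q → P 0 = 0 → Q 0 = 0 →
    ∃ A B R D U : ℂ → ℂ, DifferentiableAt ℂ A 0 ∧ DifferentiableAt ℂ B 0 ∧
      DifferentiableAt ℂ R 0 ∧ DifferentiableAt ℂ D 0 ∧ DifferentiableAt ℂ U 0 ∧
      A 0 = a ∧ B 0 = b ∧ R 0 = r ∧ D 0 = d ∧ U 0 = u ∧
      ∀ᶠ t in 𝓝[≠] (0 : ℂ), J.germ (P t * A t + Q t * B t) (P t ^ 2 * R t + Q t * D t)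
        = U t * g ![P t, Q t]

lemma shear_zero (J : TorusJet ℂ) : J.shear 0 = J := by
  ext <;> simp [shear]

/-- Normalisation of a biholomorphism by a shear of its target. -/
lemma normalPullback_shear {J : TorusJet ℂ} {g a b a' b' u : (Fin 2 → ℂ) → ℂ}
    (ha : AnalyticAt ℂ a 0) (hb : AnalyticAt ℂ b 0) (ha' : AnalyticAt ℂ a' 0)
    (hb' : AnalyticAt ℂ b' 0) (hu : AnalyticAt ℂ u 0) (ha0 : a 0 ≠ 0)
    (hdet : a 0 * b' 0 - b 0 * a' 0 ≠ 0)
    (he : ∀ᶠ z in 𝓝 0, J.germ (z 0 * a z + z 1 * b z) (z 0 * a' z + z 1 * b' z) = u z * g z) :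
    ∃ r d, d ≠ 0 ∧ (J.shear (-(a' 0 / a 0))).NormalPullback g (a 0) (b 0) r d (u 0) := by
  obtain ⟨p, hp⟩ : ∃ p, p = a' 0 / a 0 := ⟨_, rfl⟩
  rw [← hp]
  obtain ⟨r, r', hr, hr', hrr⟩ := exists_hadamard (h := fun z => a' z - p * a z)
    (ha'.sub (analyticAt_const.mul ha))
  have hd : AnalyticAt ℂ (fun z : Fin 2 → ℂ => z 0 * r' z + (b' z - p * b z)) 0 :=
    ((analyticAt_coord 0 0).mul hr').add (hb'.sub (analyticAt_const.mul hb))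
  refine ⟨r 0, b' 0 - p * b 0, ?_, ?_⟩
  · rw [hp]
    intro h0
    field_simp at h0
    exact hdet (by linear_combination h0)
  intro P Q hP hQ hP0 hQ0
  have hγ0 : (![P 0, Q 0] : Fin 2 → ℂ) = 0 := by rw [hP0, hQ0]; ext i; fin_cases i <;> rfl
  have hγ : Differentiable ℂ (fun t => (![P t, Q t] : Fin 2 → ℂ)) := by
    rw [differentiable_pi]
    intro i
    fin_cases i
    · exact hP
    · exact hQ
  have hcomp : ∀ {f : (Fin 2 → ℂ) → ℂ}, AnalyticAt ℂ f 0 →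
      DifferentiableAt ℂ (fun t => f ![P t, Q t]) 0 := fun hf =>
    DifferentiableAt.comp (f := fun t => (![P t, Q t] : Fin 2 → ℂ)) (0 : ℂ)
      (by rw [hγ0]; exact hf.differentiableAt) (hγ 0)
  refine ⟨_, _, _, _, _, hcomp ha, hcomp hb, hcomp hr, hcomp hd, hcomp hu, by rw [hγ0], by rw [hγ0],
    by rw [hγ0], ?_, by rw [hγ0], ?_⟩
  · change (fun z : Fin 2 → ℂ => z 0 * r' z + (b' z - p * b z)) ![P 0, Q 0] = _
    rw [hγ0]
    simp
  · filter_upwards [eventually_curve he hγ.continuous hγ0,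
      eventually_curve hrr hγ.continuous hγ0] with t h1 h2
    rw [← h1, germ_shear]
    have h3 : a' 0 - p * a 0 = 0 := by rw [hp]; field_simp; ring
    rw [h3] at h2
    simp only [Matrix.cons_val_zero, Matrix.cons_val_one] at h2 ⊢
    congr 1
    linear_combination (-P t) * h2

/-- A jet whose germ is equivalent to `g` is a shear or the exchange of a normalised one. -/
lemma exists_normalPullback {J : TorusJet ℂ} {g : (Fin 2 → ℂ) → ℂ}
    (h : FunGermEquiv (fun z => J.germ (z 0) (z 1)) 0 g 0) :
    ∃ J₀ : TorusJet ℂ, (J = J₀.swap ∨ ∃ p, J = J₀.shear p) ∧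
      ∃ a b r d u, a ≠ 0 ∧ d ≠ 0 ∧ u ≠ 0 ∧ J₀.NormalPullback g a b r d u := by
  obtain ⟨φ, φ', u, hφ, hφ0, hφ', hu, hu0, he⟩ := h
  have hi : ∀ i, AnalyticAt ℂ (fun z => φ z i) 0 := fun i =>
    ((ContinuousLinearMap.proj (R := ℂ) (φ := fun _ : Fin 2 => ℂ) i).analyticAt _).comp hφ
  have had : ∀ i : Fin 2, ∃ a b : (Fin 2 → ℂ) → ℂ, AnalyticAt ℂ a 0 ∧ AnalyticAt ℂ b 0 ∧
      (∀ᶠ z in 𝓝 0, φ z i = z 0 * a z + z 1 * b z) ∧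
      ∀ v, φ' v i = a 0 * v 0 + b 0 * v 1 := by
    intro i
    obtain ⟨a, b, ha, hb, hab⟩ := exists_hadamard (hi i)
    simp only [hφ0, Pi.zero_apply, zero_add] at hab
    refine ⟨a, b, ha, hb, hab, fun v => ?_⟩
    have p0 : ∀ j : Fin 2, HasFDerivAt (fun z : Fin 2 → ℂ => z j)
        (ContinuousLinearMap.proj (R := ℂ) (φ := fun _ : Fin 2 => ℂ) j) 0 := fun j =>
      hasFDerivAt_apply j 0
    have e1 := ((p0 0).mul ha.differentiableAt.hasFDerivAt).add
      ((p0 1).mul hb.differentiableAt.hasFDerivAt)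
    have e2 : HasFDerivAt (fun z => φ z i)
        ((ContinuousLinearMap.proj (R := ℂ) (φ := fun _ : Fin 2 => ℂ) i).comp
          (φ' : (Fin 2 → ℂ) →L[ℂ] (Fin 2 → ℂ))) 0 :=
      (HasFDerivAt.comp (g := fun y : Fin 2 → ℂ => y i) 0 (hasFDerivAt_apply i (φ 0)) hφ' :)
    have e3 := e2.unique (e1.congr_of_eventuallyEq hab)
    have e4 := congrArg (fun L : (Fin 2 → ℂ) →L[ℂ] ℂ => L v) e3
    simpa using e4
  obtain ⟨a, b, ha, hb, hab, hv⟩ := had 0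
  obtain ⟨a', b', ha', hb', hab', hv'⟩ := had 1
  have inj : ∀ v : Fin 2 → ℂ, a 0 * v 0 + b 0 * v 1 = 0 → a' 0 * v 0 + b' 0 * v 1 = 0 → v = 0 := by
    intro v h0 h1
    apply φ'.injective
    rw [map_zero]
    ext i
    fin_cases i
    · exact (hv v).trans h0
    · exact (hv' v).trans h1
  have hdet : a 0 * b' 0 - b 0 * a' 0 ≠ 0 := by
    intro h0
    have h1 := inj ![b 0, -a 0] (by simp; ring) (by simp; linear_combination -h0)
    have h2 := inj ![b' 0, -a' 0] (by simp; linear_combination h0) (by simp; ring)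
    have h3 : a 0 = 0 := by simpa using congrFun h1 1
    have h4 : a' 0 = 0 := by simpa using congrFun h2 1
    have h5 := inj ![1, 0] (by simp [h3]) (by simp [h4])
    simpa using congrFun h5 0
  have he' : ∀ᶠ z in 𝓝 0, J.germ (z 0 * a z + z 1 * b z) (z 0 * a' z + z 1 * b' z) = u z * g z := by
    filter_upwards [he, hab, hab'] with z h1 h2 h3
    rw [← h1, h2, h3]
  by_cases ha0 : a 0 = 0
  · have ha0' : a' 0 ≠ 0 := fun h => hdet (by rw [ha0, h]; ring)
    obtain ⟨r, d, hd, hn⟩ := normalPullback_shear (J := J.swap) (g := g) ha' hb' ha hb hu ha0'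
      (fun h => hdet (by linear_combination -h)) (by simpa only [germ_swap] using he')
    rw [ha0, zero_div, neg_zero, shear_zero] at hn
    exact ⟨J.swap, Or.inl rfl, _, _, r, d, _, ha0', hd, hu0, hn⟩
  · obtain ⟨r, d, hd, hn⟩ := normalPullback_shear ha hb ha' hb' hu ha0 hdet he'
    exact ⟨_, Or.inr ⟨a' 0 / a 0, (shear_shear_neg _ _).symm⟩, _, _, r, d, _, ha0, hd, hu0, hn⟩

namespace NormalPullback

variable {J : TorusJet ℂ} {g : (Fin 2 → ℂ) → ℂ} {a b r d u : ℂ}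

/-- Restriction of the pullback to a line through the origin. -/
lemma line (hn : J.NormalPullback g a b r d u) (v w : ℂ) :
    ∃ X Y U : ℂ → ℂ, ContinuousAt X 0 ∧ ContinuousAt Y 0 ∧ ContinuousAt U 0 ∧
      X 0 = a * v + b * w ∧ Y 0 = d * w ∧ U 0 = u ∧
      ∀ᶠ t in 𝓝[≠] (0 : ℂ), t ≠ 0 ∧ J.germ (t * X t) (t * Y t) = U t * g ![t * v, t * w] := by
  obtain ⟨A, B, R, D, U, hA, hB, hR, hD, hU, rfl, rfl, rfl, rfl, rfl, he⟩ :=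
    hn (fun t => t * v) (fun t => t * w) (by fun_prop) (by fun_prop) (by simp) (by simp)
  have cA := hA.continuousAt
  have cB := hB.continuousAt
  have cR := hR.continuousAt
  have cD := hD.continuousAt
  refine ⟨fun t => A t * v + B t * w, fun t => t * v ^ 2 * R t + D t * w, U, by fun_prop,
    by fun_prop, hU.continuousAt, rfl, by simp, rfl, ?_⟩
  filter_upwards [he, self_mem_nhdsWithin] with t ht ht0
  refine ⟨ht0, ht ▸ ?_⟩
  ring_nf

/-- Restriction of the pullback to a parabola. -/
lemma parabola (hn : J.NormalPullback g a b r d u) (κ : ℂ) :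
    ∃ X Y U : ℂ → ℂ, DifferentiableAt ℂ X 0 ∧ DifferentiableAt ℂ Y 0 ∧ ContinuousAt U 0 ∧
      X 0 = a ∧ Y 0 = r + κ * d ∧ U 0 = u ∧
      ∀ᶠ t in 𝓝[≠] (0 : ℂ), t ≠ 0 ∧ J.germ (t * X t) (t ^ 2 * Y t) = U t * g ![t, κ * t ^ 2] := by
  obtain ⟨A, B, R, D, U, hA, hB, hR, hD, hU, rfl, rfl, rfl, rfl, rfl, he⟩ :=
    hn (fun t => t) (fun t => κ * t ^ 2) (by fun_prop) (by fun_prop) (by simp) (by simp)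
  refine ⟨fun t => A t + κ * t * B t, fun t => R t + κ * D t, U, by fun_prop,
    by fun_prop, hU.continuousAt, by simp, rfl, rfl, ?_⟩
  filter_upwards [he, self_mem_nhdsWithin] with t ht ht0
  refine ⟨ht0, ht ▸ ?_⟩
  ring_nf

/-- The quadratic part of the germ. -/
lemma quadratic (hn : J.NormalPullback g a b r d u) (v w : ℂ) {k : ℂ → ℂ} (hk : ContinuousAt k 0)
    (hg : ∀ t, g ![t * v, t * w] = t ^ 2 * k t) :
    2 * (J.h20 * (a * v + b * w) ^ 2 + J.h11 * (a * v + b * w) * (d * w) + J.h02 * (d * w) ^ 2)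
      = u * k 0 := by
  obtain ⟨X, Y, U, cX, cY, cU, hX, hY, rfl, he⟩ := hn.line v w
  obtain ⟨H, hH⟩ : ∃ H : ℂ → ℂ, H = fun t => J.h20 * X t ^ 2 + J.h11 * X t * Y t + J.h02 * Y t ^ 2
    + t * (J.h30 * X t ^ 3 + J.h21 * X t ^ 2 * Y t + J.h12 * X t * Y t ^ 2 + J.h03 * Y t ^ 3) :=
    ⟨_, rfl⟩
  have cH : ContinuousAt H 0 := by rw [hH]; fun_prop
  have := eq_at_zero_of_eventually_eq
    (f := fun t => (2 + 6 * t ^ 2 * J.q (X t) (Y t) + t ^ 2 * H t) * H t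
      - t ^ 2 * (3 + 8 * t ^ 2 * J.q (X t) (Y t)) * J.q (X t) (Y t) ^ 2)
    (g := fun t => U t * k t) (by simp only [q]; fun_prop) (by fun_prop) ?_
  · simp [hH, hX, hY] at this
    exact this
  · filter_upwards [he] with t ht
    refine mul_left_cancel₀ (pow_ne_zero 2 ht.1) ?_
    rw [mul_left_comm (t ^ 2) (U t), ← hg, ← ht.2, hH]
    simp only [germ, q, h]
    ring

/-- The cubic part of the germ, if the quadratic part vanishes. -/
lemma cubic (hn : J.NormalPullback g a b r d u) (h20 : J.h20 = 0) (h11 : J.h11 = 0)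
    (h02 : J.h02 = 0) (v w : ℂ) {k : ℂ → ℂ} (hk : ContinuousAt k 0)
    (hg : ∀ t, g ![t * v, t * w] = t ^ 3 * k t) :
    2 * J.h (a * v + b * w) (d * w) = u * k 0 := by
  obtain ⟨X, Y, U, cX, cY, cU, hX, hY, rfl, he⟩ := hn.line v w
  have := eq_at_zero_of_eventually_eq
    (f := fun t => (2 + 6 * t ^ 2 * J.q (X t) (Y t) + t ^ 3 * J.h (X t) (Y t)) * J.h (X t) (Y t)
      - t * (3 + 8 * t ^ 2 * J.q (X t) (Y t)) * J.q (X t) (Y t) ^ 2)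
    (g := fun t => U t * k t) (by simp only [q, h]; fun_prop) (by fun_prop) ?_
  · simp [hX, hY] at this
    exact this
  · filter_upwards [he] with t ht
    refine mul_left_cancel₀ (pow_ne_zero 3 ht.1) ?_
    rw [mul_left_comm (t ^ 3) (U t), ← hg, ← ht.2]
    simp only [germ, q, h, h20, h11, h02]
    ring

/-- The coefficient of `x ^ 3`, if the quadratic part is a multiple of `y ^ 2`. -/
lemma coeff_x_pow_three (hn : J.NormalPullback g a b r d u) (h20 : J.h20 = 0) (h11 : J.h11 = 0)
    {k : ℂ → ℂ} (hk : ContinuousAt k 0) (hg : ∀ t, g ![t, 0] = t ^ 3 * k t) :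
    2 * J.h30 * a ^ 3 = u * k 0 := by
  obtain ⟨X, Y, U, dX, dY, cU, rfl, hY, rfl, he⟩ := hn.parabola 0
  have cX := dX.continuousAt
  have cY := dY.continuousAt
  obtain ⟨Q, hQ⟩ : ∃ Q : ℂ → ℂ, Q = fun t => J.q20 * X t ^ 2 + t * J.q11 * X t * Y t
    + t ^ 2 * J.q02 * Y t ^ 2 := ⟨_, rfl⟩
  obtain ⟨H, hH⟩ : ∃ H : ℂ → ℂ, H = fun t => J.h30 * X t ^ 3
    + t * (J.h02 * Y t ^ 2 + J.h21 * X t ^ 2 * Y t) + t ^ 2 * J.h12 * X t * Y t ^ 2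
    + t ^ 3 * J.h03 * Y t ^ 3 := ⟨_, rfl⟩
  have cQ : ContinuousAt Q 0 := by rw [hQ]; fun_prop
  have cH : ContinuousAt H 0 := by rw [hH]; fun_prop
  have := eq_at_zero_of_eventually_eq
    (f := fun t => (2 + 6 * t ^ 2 * Q t + t ^ 3 * H t) * H t
      - t * (3 + 8 * t ^ 2 * Q t) * Q t ^ 2)
    (g := fun t => U t * k t) (by fun_prop) (by fun_prop) ?_
  · simp [hH] at this
    linear_combination this
  · filter_upwards [he] with t ht
    have ht2 := ht.2
    rw [zero_mul, hg] at ht2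
    refine mul_left_cancel₀ (pow_ne_zero 3 ht.1) ?_
    rw [mul_left_comm (t ^ 3) (U t), ← ht2, hH, hQ]
    simp only [germ, q, h, h20, h11]
    ring

/-- The part of weighted degree `4`, for the weights `1` of `x` and `2` of `y`. -/
lemma weight_four (hn : J.NormalPullback g a b r d u) (h20 : J.h20 = 0) (h11 : J.h11 = 0)
    (h30 : J.h30 = 0) (κ : ℂ)
    {k : ℂ → ℂ} (hk : ContinuousAt k 0) (hg : ∀ t, g ![t, κ * t ^ 2] = t ^ 4 * k t) :
    2 * (J.h02 * (r + κ * d) ^ 2 + J.h21 * a ^ 2 * (r + κ * d)) - 3 * J.q20 ^ 2 * a ^ 4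
      = u * k 0 := by
  obtain ⟨X, Y, U, dX, dY, cU, rfl, hY, rfl, he⟩ := hn.parabola κ
  have cX := dX.continuousAt
  have cY := dY.continuousAt
  obtain ⟨Q, hQ⟩ : ∃ Q : ℂ → ℂ, Q = fun t => J.q20 * X t ^ 2 + t * J.q11 * X t * Y t
    + t ^ 2 * J.q02 * Y t ^ 2 := ⟨_, rfl⟩
  obtain ⟨H, hH⟩ : ∃ H : ℂ → ℂ, H = fun t => J.h02 * Y t ^ 2 + J.h21 * X t ^ 2 * Y t
    + t * J.h12 * X t * Y t ^ 2 + t ^ 2 * J.h03 * Y t ^ 3 := ⟨_, rfl⟩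
  have cQ : ContinuousAt Q 0 := by rw [hQ]; fun_prop
  have cH : ContinuousAt H 0 := by rw [hH]; fun_prop
  have := eq_at_zero_of_eventually_eq
    (f := fun t => (2 + 6 * t ^ 2 * Q t + t ^ 4 * H t) * H t - (3 + 8 * t ^ 2 * Q t) * Q t ^ 2)
    (g := fun t => U t * k t) (by fun_prop) (by fun_prop) ?_
  · simp [hH, hQ, hY] at this
    linear_combination this
  · filter_upwards [he] with t ht
    have ht2 := ht.2
    rw [hg] at ht2
    refine mul_left_cancel₀ (pow_ne_zero 4 ht.1) ?_
    rw [mul_left_comm (t ^ 4) (U t), ← ht2, hH, hQ]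
    simp only [germ, q, h, h20, h11, h30]
    ring

/-- The part of weighted degree `5` along the double parabola `y = s x ^ 2`. -/
lemma weight_five (hn : J.NormalPullback g a b r d u) (h20 : J.h20 = 0) (h11 : J.h11 = 0)
    (h30 : J.h30 = 0) {s : ℂ} (h21 : J.h21 = -2 * J.h02 * s)
    (hs : 2 * J.h02 * s ^ 2 + 3 * J.q20 ^ 2 = 0) (hr : r = s * a ^ 2)
    {k : ℂ → ℂ} (hk : ContinuousAt k 0) (hg : ∀ t, g ![t, 0] = t ^ 5 * k t) :
    2 * J.h12 * a * r ^ 2 - 6 * J.q20 * J.q11 * a ^ 3 * r = u * k 0 := by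
  obtain ⟨X, Y, U, dX, dY, cU, rfl, hY, rfl, he⟩ := hn.parabola 0
  have cX := dX.continuousAt
  have cY := dY.continuousAt
  rw [zero_mul, add_zero] at hY
  -- `y - s x ^ 2 = t ^ 3 * W t` on the curve
  obtain ⟨W, cW, hW⟩ : ∃ W : ℂ → ℂ, ContinuousAt W 0 ∧ ∀ t, Y t - s * X t ^ 2 = t * W t := by
    have h1 : DifferentiableAt ℂ (fun t => Y t - s * X t ^ 2) 0 := by fun_prop
    refine ⟨dslope (fun t => Y t - s * X t ^ 2) 0, continuousAt_dslope_same.2 h1, fun t => ?_⟩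
    have h2 := sub_smul_dslope (fun t => Y t - s * X t ^ 2) 0 t
    simp only [sub_zero, smul_eq_mul, hY, hr, sub_self] at h2
    exact h2.symm
  obtain ⟨Q, hQ⟩ : ∃ Q : ℂ → ℂ, Q = fun t => J.q20 * X t ^ 2 + t * J.q11 * X t * Y t
    + t ^ 2 * J.q02 * Y t ^ 2 := ⟨_, rfl⟩
  obtain ⟨H, hH⟩ : ∃ H : ℂ → ℂ, H = fun t => J.h02 * Y t ^ 2 + J.h21 * X t ^ 2 * Y t
    + t * J.h12 * X t * Y t ^ 2 + t ^ 2 * J.h03 * Y t ^ 3 := ⟨_, rfl⟩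
  have cQ : ContinuousAt Q 0 := by rw [hQ]; fun_prop
  have cH : ContinuousAt H 0 := by rw [hH]; fun_prop
  have := eq_at_zero_of_eventually_eq
    (f := fun t => 2 * J.h12 * X t * Y t ^ 2 - 6 * J.q20 * J.q11 * X t ^ 3 * Y t
      + t * (2 * J.h02 * W t ^ 2 + 2 * J.h03 * Y t ^ 3 + (6 * Q t + t ^ 2 * H t) * H t
        - 8 * Q t ^ 3 - 6 * J.q20 * J.q02 * X t ^ 2 * Y t ^ 2
        - 3 * (J.q11 * X t * Y t + t * J.q02 * Y t ^ 2) ^ 2))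
    (g := fun t => U t * k t) (by fun_prop) (by fun_prop) ?_
  · simp [hY] at this
    linear_combination this
  · filter_upwards [he] with t ht
    have ht2 := ht.2
    rw [zero_mul, hg] at ht2
    refine mul_left_cancel₀ (pow_ne_zero 5 ht.1) ?_
    rw [mul_left_comm (t ^ 5) (U t), ← ht2, hH, hQ]
    simp only [germ, q, h, h20, h11, h30, h21]
    have e := hW t
    linear_combination (-(t ^ 4 * (2 * J.h02) * (t * W t + (Y t - s * X t ^ 2)))) * e
      + t ^ 4 * X t ^ 4 * hs

end NormalPullback
end TorusJet
end TorusSextic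

/-! ### Necessary conditions and the lower bounds -/

namespace TorusSextic

open MvPolynomial

namespace TorusJet.NormalPullback

variable {J : TorusJet ℂ} {a b r d u : ℂ}

/-- The quadratic part of the germ is that of `y ^ 2` up to a factor. -/
lemma of_A_two_le {n : ℕ} (hn : 2 ≤ n) (ha : a ≠ 0) (hd : d ≠ 0) (hu : u ≠ 0)
    (h : J.NormalPullback (fun z => eval z (SingType.A n).normalForm) a b r d u) :
    J.h20 = 0 ∧ J.h11 = 0 ∧ J.h02 ≠ 0 := by
  obtain ⟨n, rfl⟩ : ∃ k, n = k + 2 := ⟨n - 2, by omega⟩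
  have key := fun v w => h.quadratic v w (k := fun t => w ^ 2 + t ^ (n + 1) * v ^ (n + 3))
    (by fun_prop) (fun t => by simp [SingType.normalForm]; ring)
  have e1 := key 1 0
  have e2 := key 0 1
  have e3 := key 1 1
  simp at e1 e2 e3
  have h20 : J.h20 = 0 := e1.resolve_right ha
  rw [h20] at e2 e3
  have h11 : J.h11 = 0 := by
    have : J.h11 * (2 * a * d) = 0 := by linear_combination e3 - e2
    simpa [ha, hd] using this
  refine ⟨h20, h11, fun h02 => hu ?_⟩
  rw [h11, h02] at e2
  linear_combination -e2

lemma of_A_three_le {n : ℕ} (hn : 3 ≤ n) (ha : a ≠ 0) (hd : d ≠ 0) (hu : u ≠ 0)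
    (h : J.NormalPullback (fun z => eval z (SingType.A n).normalForm) a b r d u) : J.h30 = 0 := by
  obtain ⟨h20, h11, h02⟩ := of_A_two_le (by omega) ha hd hu h
  obtain ⟨n, rfl⟩ : ∃ k, n = k + 3 := ⟨n - 3, by omega⟩
  have e := h.coeff_x_pow_three h20 h11 (k := fun t => t ^ (n + 1)) (by fun_prop)
    (fun t => by simp [SingType.normalForm]; ring)
  simpa [ha] using e

/-- The weighted homogeneous part of degree `4` of a jet of type `A_n`, `n ≥ 4`, is a square. -/
lemma of_A_four_le {n : ℕ} (hn : 4 ≤ n) (ha : a ≠ 0) (hd : d ≠ 0) (hu : u ≠ 0)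
    (h : J.NormalPullback (fun z => eval z (SingType.A n).normalForm) a b r d u) :
    ∃ κ s : ℂ, J.q20 = 2 * κ * s ∧ J.h02 = -6 * κ ^ 2 ∧ J.h21 = 12 * κ ^ 2 * s ∧ r = s * a ^ 2 := by
  obtain ⟨h20, h11, h02⟩ := of_A_two_le (by omega) ha hd hu h
  have h30 := of_A_three_le (by omega) ha hd hu h
  obtain ⟨n, rfl⟩ : ∃ k, n = k + 4 := ⟨n - 4, by omega⟩
  have key := fun κ => h.weight_four h20 h11 h30 κ (k := fun t => κ ^ 2 + t ^ (n + 1))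
    (by fun_prop) (fun t => by simp [SingType.normalForm]; ring)
  have e0 := key 0
  have e1 := key 1
  have e2 := key (-1)
  simp at e0 e1 e2
  have ha2 : a ^ 2 ≠ 0 := pow_ne_zero 2 ha
  obtain ⟨s, hs⟩ : ∃ s, r = s * a ^ 2 := ⟨r / a ^ 2, by field_simp⟩
  have h21 : J.h21 = -2 * J.h02 * s := by
    refine mul_right_cancel₀ (mul_ne_zero ha2 hd) ?_
    rw [hs] at e1 e2
    linear_combination (e1 - e2) / 4
  have hq : 2 * J.h02 * s ^ 2 + 3 * J.q20 ^ 2 = 0 := by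
    refine mul_right_cancel₀ (pow_ne_zero 2 ha2) ?_
    rw [hs, h21] at e0
    linear_combination -e0
  by_cases hs0 : s = 0
  · obtain ⟨κ, hκ⟩ := IsAlgClosed.exists_pow_nat_eq (-J.h02 / 6) two_pos
    have hq0 : J.q20 = 0 := by
      rw [hs0] at hq
      simpa using hq
    refine ⟨κ, s, by rw [hq0, hs0, mul_zero], by rw [hκ]; ring, by rw [h21, hs0]; ring, hs⟩
  · refine ⟨J.q20 / (2 * s), s, by field_simp, ?_, ?_, hs⟩
    · field_simp
      linear_combination 2 * hq
    · rw [h21]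
      field_simp
      linear_combination -4 * hq

/-- In the first case `q`, `h₂` and `h₃` are divisible by `y`, and the line `y = 0` is a component
of the sextic; such jets account for a second component of the locus. -/
lemma of_A_five_le {n : ℕ} (hn : 5 ≤ n) (ha : a ≠ 0) (hd : d ≠ 0) (hu : u ≠ 0)
    (h : J.NormalPullback (fun z => eval z (SingType.A n).normalForm) a b r d u) :
    (J.q20 = 0 ∧ J.h21 = 0) ∨ ∃ κ s : ℂ, J.q20 = 2 * κ * s ∧ J.h02 = -6 * κ ^ 2 ∧
      J.h21 = 12 * κ ^ 2 * s ∧ J.h12 = 6 * κ * J.q11 := by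
  obtain ⟨h20, h11, h02⟩ := of_A_two_le (by omega) ha hd hu h
  have h30 := of_A_three_le (by omega) ha hd hu h
  obtain ⟨κ, s, e1, e2, e3, e4⟩ := of_A_four_le (by omega) ha hd hu h
  obtain ⟨n, rfl⟩ : ∃ k, n = k + 5 := ⟨n - 5, by omega⟩
  have key := h.weight_five h20 h11 h30 (s := s) (by rw [e3, e2]; ring) (by rw [e1, e2]; ring) e4
    (k := fun t => t ^ (n + 1)) (by fun_prop) (fun t => by simp [SingType.normalForm]; ring)
  have hf : s ^ 2 * a ^ 5 * (J.h12 - 6 * κ * J.q11) = 0 := by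
    rw [e4, e1] at key
    simp at key
    linear_combination key / 2
  rcases mul_eq_zero.1 hf with h0 | h0
  · have hs : s = 0 := by simpa [ha] using h0
    exact Or.inl ⟨by rw [e1, hs, mul_zero], by rw [e3, hs, mul_zero]⟩
  · exact Or.inr ⟨κ, s, e1, e2, e3, sub_eq_zero.1 h0⟩

lemma of_quadratic_eq_zero {g : (Fin 2 → ℂ) → ℂ} (ha : a ≠ 0) (hd : d ≠ 0)
    (h : J.NormalPullback g a b r d u) {k : ℂ → ℂ → ℂ → ℂ} (hk : ∀ v w, Continuous (k v w))
    (hg : ∀ v w t, g ![t * v, t * w] = t ^ 3 * k v w t) :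
    J.h20 = 0 ∧ J.h11 = 0 ∧ J.h02 = 0 := by
  have key := fun v w => h.quadratic v w (k := fun t => t * k v w t)
    (continuous_id.mul (hk v w)).continuousAt (fun t => by rw [hg]; ring)
  have e1 := key 1 0
  have e2 := key 0 1
  have e3 := key 1 1
  simp at e1 e2 e3
  have h20 : J.h20 = 0 := e1.resolve_right ha
  rw [h20] at e2 e3
  have h11 : J.h11 = 0 := by
    have : J.h11 * (a * d) = 0 := by linear_combination e3 - e2
    simpa [ha, hd] using this
  refine ⟨h20, h11, ?_⟩
  rw [h11] at e2
  simpa [hd] using e2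

/-- If the cubic part of the normal form is `y ^ 2 (l x + m y)`, then that of the germ is a
multiple of `y ^ 2`. -/
lemma of_cubic {g : (Fin 2 → ℂ) → ℂ} (ha : a ≠ 0) (hd : d ≠ 0)
    (h : J.NormalPullback g a b r d u) {k : ℂ → ℂ → ℂ → ℂ} (hk : ∀ v w, Continuous (k v w))
    (hg : ∀ v w t, g ![t * v, t * w] = t ^ 3 * k v w t) {l m : ℂ}
    (hk0 : ∀ v w, k v w 0 = w ^ 2 * (l * v + m * w)) :
    J.h30 = 0 ∧ J.h21 = 0 ∧ 2 * J.h12 * a * d ^ 2 = u * l := by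
  obtain ⟨h20, h11, h02⟩ := of_quadratic_eq_zero ha hd h hk hg
  have key := fun v w => h.cubic h20 h11 h02 v w (hk v w).continuousAt (hg v w)
  have e1 := key 1 0
  have e2 := key 0 1
  have e3 := key 1 1
  have e4 := key (-1) 1
  rw [hk0] at e1 e2 e3 e4
  simp [TorusJet.h, h20, h11, h02] at e1 e2 e3 e4
  have h30 : J.h30 = 0 := e1.resolve_right ha
  rw [h30] at e2 e3 e4
  have h21 : J.h21 = 0 := by
    have : J.h21 * (4 * a ^ 2 * d) = 0 := by linear_combination e3 + e4 - 2 * e2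
    simpa [ha, hd] using this
  refine ⟨h30, h21, ?_⟩
  rw [h21] at e2 e3
  linear_combination e3 - e2

end TorusJet.NormalPullback

lemma exists_jet_of_mem_outerLocus {σ : SingType} {c : Pair} (hc : c ∈ outerLocus σ 0) :
    ∃ J : TorusJet ℂ, c = J.pair ∧
      FunGermEquiv (fun z => J.germ (z 0) (z 1)) 0 (fun z => eval z σ.normalForm) 0 := by
  obtain ⟨J, ht, rfl⟩ := exists_jet_of_isOuterSingularity hc.1
  exact ⟨J, rfl, (funGermEquiv_sextic_germ J ht).symm.trans hc.2⟩

lemma mem_outerLocus_of_germ {σ : SingType} {J : TorusJet ℂ} (ht : J.t ≠ 0)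
    (h : FunGermEquiv (fun z => J.germ (z 0) (z 1)) 0 (fun z => eval z σ.normalForm) 0) :
    J.pair ∈ outerLocus σ 0 :=
  ⟨isOuterSingularity_pair J ht, (funGermEquiv_sextic_germ J ht).trans h⟩

/-- Lower bound for the number of conditions on the pairs of a polynomial family of jets. -/
lemma le_numConditions_jets {m : ℕ} (K : TorusJet (MvPolynomial (Fin m) ℂ)) {S : Set Pair}
    (hS : ∀ c ∈ S, ∃ s : Fin m → ℂ, c = (K.map (eval s)).pair) :
    ((16 - m : ℕ) : ℕ∞) ≤ numConditions S := by
  refine le_numConditions K.pair fun c hc => ?_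
  obtain ⟨s, rfl⟩ := hS c hc
  exact ⟨s, fun i => TorusJet.pair_map _ _ _⟩

/-- The jets in all linear positions: a jet in the family, sheared by the parameter `p`, or with its
coordinates exchanged when its tangent is vertical. -/
lemma le_numConditions_shear_swap {m : ℕ} (K : TorusJet (MvPolynomial (Fin m) ℂ))
    (p : MvPolynomial (Fin m) ℂ) {S : Set Pair}
    (hS : ∀ c ∈ S, ∃ s : Fin m → ℂ, c = (K.map (eval s)).swap.pair ∨
      c = ((K.map (eval s)).shear (eval s p)).pair) :
    ((16 - m : ℕ) : ℕ∞) ≤ numConditions S := by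
  refine le_trans (le_numConditions_union
    (S := {c | ∃ s : Fin m → ℂ, c = (K.map (eval s)).swap.pair})
    (T := {c | ∃ s : Fin m → ℂ, c = ((K.map (eval s)).shear (eval s p)).pair}) ?_ ?_)
    (numConditions_mono fun c hc => ?_)
  · exact le_numConditions_jets K.swap fun c hc => hc
  · refine le_numConditions_jets (K.shear p) fun c hc => ?_
    obtain ⟨s, hs⟩ := hc
    exact ⟨s, by rw [hs, TorusJet.shear_map]⟩
  · obtain ⟨s, hs | hs⟩ := hS c hc
    · exact Or.inl ⟨s, hs⟩
    · exact Or.inr ⟨s, hs⟩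

/-- The jets with quadratic part `h02 y ^ 2`. In this and the following families `X 0` is kept free
as the parameter of a shear. -/
noncomputable def familyA2 : TorusJet (MvPolynomial (Fin 12) ℂ) :=
  ⟨X 1, X 2, X 3, X 4, X 5, X 6, 0, 0, X 7, X 8, X 9, X 10, X 11⟩

/-- The jets with quadratic part `h02 y ^ 2` and without term in `x ^ 3`. -/
noncomputable def familyA3 : TorusJet (MvPolynomial (Fin 11) ℂ) :=
  ⟨X 1, X 2, X 3, X 4, X 5, X 6, 0, 0, X 7, 0, X 8, X 9, X 10⟩

/-- The jets of `familyA3` whose part of weighted degree `4` is a multiple of `(y - s x ^ 2) ^ 2`,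
with `X 4 = κ` and `X 5 = s`. -/
noncomputable def familyA4 : TorusJet (MvPolynomial (Fin 10) ℂ) :=
  ⟨X 1, X 2, X 3, 2 * X 4 * X 5, X 6, X 7, 0, 0, -6 * X 4 ^ 2, 0, 12 * X 4 ^ 2 * X 5, X 8, X 9⟩

/-- The jets of `familyA4` for which the term in `x ^ 5` vanishes along `y = s x ^ 2`. -/
noncomputable def familyA5 : TorusJet (MvPolynomial (Fin 9) ℂ) :=
  ⟨X 1, X 2, X 3, 2 * X 4 * X 5, X 6, X 7, 0, 0, -6 * X 4 ^ 2, 0, 12 * X 4 ^ 2 * X 5,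
    6 * X 4 * X 6, X 8⟩

/-- The jets without quadratic part for which `y = 0` is a tangent. -/
noncomputable def familyD4 : TorusJet (MvPolynomial (Fin 10) ℂ) :=
  ⟨X 1, X 2, X 3, X 4, X 5, X 6, 0, 0, 0, 0, X 7, X 8, X 9⟩

/-- The jets without quadratic part for which `y = 0` is a double tangent. -/
noncomputable def familyD5 : TorusJet (MvPolynomial (Fin 9) ℂ) :=
  ⟨X 1, X 2, X 3, X 4, X 5, X 6, 0, 0, 0, 0, 0, X 7, X 8⟩

/-- The jets without quadratic part for which `y = 0` is a triple tangent. -/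
noncomputable def familyE6 : TorusJet (MvPolynomial (Fin 8) ℂ) :=
  ⟨X 1, X 2, X 3, X 4, X 5, X 6, 0, 0, 0, 0, 0, 0, X 7⟩

open TorusJet.NormalPullback

lemma le_numConditions_A1 (S : Set Pair) (hS : S ⊆ outerLocus (.A 1) 0) :
    3 ≤ numConditions S := by
  refine le_numConditions_jets (m := 13)
    ⟨X 0, X 1, X 2, X 3, X 4, X 5, X 6, X 7, X 8, X 9, X 10, X 11, X 12⟩ fun c hc => ?_
  obtain ⟨J, rfl, -⟩ := exists_jet_of_mem_outerLocus (hS hc)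
  refine ⟨![J.t, J.α, J.β, J.q20, J.q11, J.q02, J.h20, J.h11, J.h02, J.h30, J.h21, J.h12, J.h03],
    ?_⟩
  congr 1
  ext <;> simp [TorusJet.map]

lemma le_numConditions_D4 (S : Set Pair) (hS : S ⊆ outerLocus (.D 4) 0) :
    6 ≤ numConditions S := by
  refine le_numConditions_jets (m := 10)
    ⟨X 0, X 1, X 2, X 3, X 4, X 5, 0, 0, 0, X 6, X 7, X 8, X 9⟩ fun c hc => ?_
  obtain ⟨J, rfl, hJ⟩ := exists_jet_of_mem_outerLocus (hS hc)
  obtain ⟨J₀, hs, a, b, r, d, u, ha, hd, hu, hn⟩ := TorusJet.exists_normalPullback hJ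
  obtain ⟨h20, h11, h02⟩ := of_quadratic_eq_zero ha hd hn (k := fun v w t => w ^ 2 * v + v ^ 3)
    (by fun_prop) (fun v w t => by simp [SingType.normalForm]; ring)
  have e20 : J.h20 = 0 := by
    rcases hs with rfl | ⟨p, rfl⟩ <;> simp [TorusJet.swap, TorusJet.shear, h20, h11, h02]
  have e11 : J.h11 = 0 := by
    rcases hs with rfl | ⟨p, rfl⟩ <;> simp [TorusJet.swap, TorusJet.shear, h11, h02]
  have e02 : J.h02 = 0 := by
    rcases hs with rfl | ⟨p, rfl⟩ <;> simp [TorusJet.swap, TorusJet.shear, h20, h02]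
  refine ⟨![J.t, J.α, J.β, J.q20, J.q11, J.q02, J.h30, J.h21, J.h12, J.h03], ?_⟩
  congr 1
  ext <;> simp [TorusJet.map, e20, e11, e02]

lemma le_numConditions_A2 (S : Set Pair) (hS : S ⊆ outerLocus (.A 2) 0) :
    4 ≤ numConditions S := by
  refine le_numConditions_shear_swap familyA2 (X 0) fun c hc => ?_
  obtain ⟨J, rfl, hJ⟩ := exists_jet_of_mem_outerLocus (hS hc)
  obtain ⟨J, hs, a, b, r, d, u, ha, hd, hu, hn⟩ := TorusJet.exists_normalPullback hJ
  obtain ⟨h20, h11, -⟩ := of_A_two_le (by norm_num) ha hd hu hn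
  have e : ∀ p, familyA2.map (eval ![p, J.t, J.α, J.β, J.q20, J.q11, J.q02, J.h02, J.h30, J.h21,
      J.h12, J.h03]) = J := by
    intro p
    ext <;> simp [TorusJet.map, familyA2, h20, h11]
  rcases hs with rfl | ⟨p, rfl⟩
  · exact ⟨_, Or.inl (by rw [e 0])⟩
  · exact ⟨_, Or.inr (by rw [e p]; simp)⟩

lemma le_numConditions_A3 (S : Set Pair) (hS : S ⊆ outerLocus (.A 3) 0) :
    5 ≤ numConditions S := by
  refine le_numConditions_shear_swap familyA3 (X 0) fun c hc => ?_
  obtain ⟨J, rfl, hJ⟩ := exists_jet_of_mem_outerLocus (hS hc)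
  obtain ⟨J, hs, a, b, r, d, u, ha, hd, hu, hn⟩ := TorusJet.exists_normalPullback hJ
  obtain ⟨h20, h11, -⟩ := of_A_two_le (by norm_num) ha hd hu hn
  have h30 := of_A_three_le (by norm_num) ha hd hu hn
  have e : ∀ p, familyA3.map (eval ![p, J.t, J.α, J.β, J.q20, J.q11, J.q02, J.h02, J.h21,
      J.h12, J.h03]) = J := by
    intro p
    ext <;> simp [TorusJet.map, familyA3, h20, h11, h30]
  rcases hs with rfl | ⟨p, rfl⟩
  · exact ⟨_, Or.inl (by rw [e 0])⟩
  · exact ⟨_, Or.inr (by rw [e p]; simp)⟩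

lemma le_numConditions_A4 (S : Set Pair) (hS : S ⊆ outerLocus (.A 4) 0) :
    6 ≤ numConditions S := by
  refine le_numConditions_shear_swap familyA4 (X 0) fun c hc => ?_
  obtain ⟨J, rfl, hJ⟩ := exists_jet_of_mem_outerLocus (hS hc)
  obtain ⟨J, hs, a, b, r, d, u, ha, hd, hu, hn⟩ := TorusJet.exists_normalPullback hJ
  obtain ⟨h20, h11, -⟩ := of_A_two_le (by norm_num) ha hd hu hn
  have h30 := of_A_three_le (by norm_num) ha hd hu hn
  obtain ⟨κ, s, hq, h02, h21, -⟩ := of_A_four_le (by norm_num) ha hd hu hn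
  have e : ∀ p, familyA4.map (eval ![p, J.t, J.α, J.β, κ, s, J.q11, J.q02, J.h12, J.h03]) = J := by
    intro p
    ext <;> simp [TorusJet.map, familyA4, h20, h11, h30, hq, h02, h21]
  rcases hs with rfl | ⟨p, rfl⟩
  · exact ⟨_, Or.inl (by rw [e 0])⟩
  · exact ⟨_, Or.inr (by rw [e p]; simp)⟩

lemma le_numConditions_A5 (S : Set Pair) (hS : S ⊆ outerLocus (.A 5) 0) :
    7 ≤ numConditions S := by
  -- the second family covers the jets with `q20 = h21 = 0`
  obtain ⟨K, hK⟩ : ∃ K : TorusJet (MvPolynomial (Fin 9) ℂ),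
      K = ⟨X 1, X 2, X 3, 0, X 4, X 5, 0, 0, X 6, 0, 0, X 7, X 8⟩ := ⟨_, rfl⟩
  refine le_trans (le_numConditions_union
    (S := {c | ∃ s, c = (familyA5.map (eval s)).swap.pair ∨
      c = ((familyA5.map (eval s)).shear (eval s (X 0))).pair})
    (T := {c | ∃ s, c = (K.map (eval s)).swap.pair ∨
      c = ((K.map (eval s)).shear (eval s (X 0))).pair})
    (le_numConditions_shear_swap familyA5 (X 0) fun c hc => hc)
    (le_numConditions_shear_swap K (X 0) fun c hc => hc)) (numConditions_mono fun c hc => ?_)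
  obtain ⟨J, rfl, hJ⟩ := exists_jet_of_mem_outerLocus (hS hc)
  obtain ⟨J, hs, a, b, r, d, u, ha, hd, hu, hn⟩ := TorusJet.exists_normalPullback hJ
  obtain ⟨h20, h11, -⟩ := of_A_two_le (by norm_num) ha hd hu hn
  have h30 := of_A_three_le (by norm_num) ha hd hu hn
  rcases of_A_five_le le_rfl ha hd hu hn with ⟨hq, h21⟩ | ⟨κ, s, hq, h02, h21, h12⟩
  · have e : ∀ p, K.map (eval ![p, J.t, J.α, J.β, J.q11, J.q02, J.h02, J.h12, J.h03]) = J := by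
      intro p
      ext <;> simp [TorusJet.map, hK, h20, h11, h30, hq, h21]
    refine Or.inr ?_
    rcases hs with rfl | ⟨p, rfl⟩
    · exact ⟨_, Or.inl (by rw [e 0])⟩
    · exact ⟨_, Or.inr (by rw [e p]; simp)⟩
  · have e : ∀ p, familyA5.map (eval ![p, J.t, J.α, J.β, κ, s, J.q11, J.q02, J.h03]) = J := by
      intro p
      ext <;> simp [TorusJet.map, familyA5, h20, h11, h30, hq, h02, h21, h12]
    refine Or.inl ?_
    rcases hs with rfl | ⟨p, rfl⟩
    · exact ⟨_, Or.inl (by rw [e 0])⟩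
    · exact ⟨_, Or.inr (by rw [e p]; simp)⟩

lemma le_numConditions_D5 (S : Set Pair) (hS : S ⊆ outerLocus (.D 5) 0) :
    7 ≤ numConditions S := by
  refine le_numConditions_shear_swap familyD5 (X 0) fun c hc => ?_
  obtain ⟨J, rfl, hJ⟩ := exists_jet_of_mem_outerLocus (hS hc)
  obtain ⟨J, hs, a, b, r, d, u, ha, hd, hu, hn⟩ := TorusJet.exists_normalPullback hJ
  have hg : ∀ v w t : ℂ, eval ![t * v, t * w] (SingType.D 5).normalForm
      = t ^ 3 * (w ^ 2 * v + t * v ^ 4) := fun v w t => by simp [SingType.normalForm]; ring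
  obtain ⟨h20, h11, h02⟩ := of_quadratic_eq_zero ha hd hn (k := fun v w t => w ^ 2 * v + t * v ^ 4)
    (by fun_prop) hg
  obtain ⟨h30, h21, -⟩ := of_cubic ha hd hn (k := fun v w t => w ^ 2 * v + t * v ^ 4)
    (by fun_prop) hg (l := 1) (m := 0) (fun v w => by ring)
  have e : ∀ p, familyD5.map (eval ![p, J.t, J.α, J.β, J.q20, J.q11, J.q02, J.h12, J.h03]) = J := by
    intro p
    ext <;> simp [TorusJet.map, familyD5, h20, h11, h02, h30, h21]
  rcases hs with rfl | ⟨p, rfl⟩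
  · exact ⟨_, Or.inl (by rw [e 0])⟩
  · exact ⟨_, Or.inr (by rw [e p]; simp)⟩

lemma le_numConditions_E6 (S : Set Pair) (hS : S ⊆ outerLocus .E6 0) :
    8 ≤ numConditions S := by
  refine le_numConditions_shear_swap familyE6 (X 0) fun c hc => ?_
  obtain ⟨J, rfl, hJ⟩ := exists_jet_of_mem_outerLocus (hS hc)
  obtain ⟨J, hs, a, b, r, d, u, ha, hd, hu, hn⟩ := TorusJet.exists_normalPullback hJ
  have hg : ∀ v w t : ℂ, eval ![t * v, t * w] SingType.E6.normalForm
      = t ^ 3 * (w ^ 3 + t * v ^ 4) := fun v w t => by simp [SingType.normalForm]; ring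
  obtain ⟨h20, h11, h02⟩ := of_quadratic_eq_zero ha hd hn (k := fun v w t => w ^ 3 + t * v ^ 4)
    (by fun_prop) hg
  obtain ⟨h30, h21, h12⟩ := of_cubic ha hd hn (k := fun v w t => w ^ 3 + t * v ^ 4)
    (by fun_prop) hg (l := 0) (m := 1) (fun v w => by ring)
  have h12 : J.h12 = 0 := by simpa [ha, hd] using h12
  have e : ∀ p, familyE6.map (eval ![p, J.t, J.α, J.β, J.q20, J.q11, J.q02, J.h03]) = J := by
    intro p
    ext <;> simp [TorusJet.map, familyE6, h20, h11, h02, h30, h21, h12]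
  rcases hs with rfl | ⟨p, rfl⟩
  · exact ⟨_, Or.inl (by rw [e 0])⟩
  · exact ⟨_, Or.inr (by rw [e p]; simp)⟩

end TorusSextic

/-! ### Algebraicity of the parameters -/

namespace TorusSextic

open MvPolynomial

section Algebraic

variable {R A : Type*} [CommRing R] [IsDomain R] [CommRing A] [IsDomain A] [Algebra R A]

lemma isAlgebraic_of_mul_left {a x : A} (ha0 : a ≠ 0) (ha : IsAlgebraic R a)
    (h : IsAlgebraic R (a * x)) : IsAlgebraic R x :=
  IsAlgebraic.of_mul (mem_nonZeroDivisors_of_ne_zero ha0) ha h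

lemma isAlgebraic_of_cubic {a b c d x : A} (ha0 : a ≠ 0) (ha : IsAlgebraic R a)
    (hb : IsAlgebraic R b) (hc : IsAlgebraic R c) (hd : IsAlgebraic R d)
    (h : a * x ^ 3 + b * x ^ 2 + c * x + d = 0) : IsAlgebraic R x := by
  let S := Subalgebra.algebraicClosure R A
  have hS : Algebra.IsAlgebraic R S := ⟨fun y => by
    have hy := (Subalgebra.mem_algebraicClosure R A).1 y.2
    exact (isAlgebraic_algebraMap_iff (A := A) (S := S) Subtype.val_injective).1 hy⟩
  let a' : S := ⟨a, ha⟩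
  let b' : S := ⟨b, hb⟩
  let c' : S := ⟨c, hc⟩
  let d' : S := ⟨d, hd⟩
  have : IsAlgebraic S x := by
    refine ⟨Polynomial.C a' * Polynomial.X ^ 3 + Polynomial.C b' * Polynomial.X ^ 2
      + Polynomial.C c' * Polynomial.X + Polynomial.C d', fun h0 => ha0 ?_, ?_⟩
    · have h1 := congrArg (fun p => Polynomial.coeff p 3) h0
      simp at h1
      exact congrArg Subtype.val h1
    · simp only [map_add, map_mul, map_pow, Polynomial.aeval_C, Polynomial.aeval_X]
      exact h
  exact this.restrictScalars R

namespace TorusJet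

/-- All the components of a jet are algebraic over `R`. -/
def IsAlgebraicOver (R : Type*) {A : Type*} [CommRing R] [CommRing A] [Algebra R A]
    (J : TorusJet A) : Prop :=
  ((IsAlgebraic R J.t ∧ IsAlgebraic R J.α ∧ IsAlgebraic R J.β) ∧
    IsAlgebraic R J.q20 ∧ IsAlgebraic R J.q11 ∧ IsAlgebraic R J.q02) ∧
  (IsAlgebraic R J.h20 ∧ IsAlgebraic R J.h11 ∧ IsAlgebraic R J.h02) ∧
    IsAlgebraic R J.h30 ∧ IsAlgebraic R J.h21 ∧ IsAlgebraic R J.h12 ∧ IsAlgebraic R J.h03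

/-- A jet is algebraic over the coefficients of its pair. -/
lemma isAlgebraicOver_of_pair [CharZero A] {J : TorusJet A} (ht : J.t ≠ 0)
    (h : ∀ i, IsAlgebraic R (J.pair i)) : J.IsAlgebraicOver R := by
  have nat : ∀ n : ℕ, IsAlgebraic R (n : A) := fun n => isAlgebraic_natCast n
  have two : IsAlgebraic R (2 : A) := by exact_mod_cast nat 2
  have three : IsAlgebraic R (3 : A) := by exact_mod_cast nat 3
  have six : IsAlgebraic R (6 : A) := by exact_mod_cast nat 6
  have e00 : IsAlgebraic R (-J.t ^ 2) := h (Sum.inl ⟨(0, 0), by simp⟩)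
  have t2 : IsAlgebraic R (J.t ^ 2) := by simpa using e00.neg
  have t : IsAlgebraic R J.t := IsAlgebraic.of_pow two_pos t2
  have ht2 : -J.t ^ 2 ≠ 0 := neg_ne_zero.2 (pow_ne_zero 2 ht)
  have h2t2 : -2 * J.t ^ 2 ≠ 0 := mul_ne_zero (by simp) (pow_ne_zero 2 ht)
  have a2t2 : IsAlgebraic R (-2 * J.t ^ 2) := (two.neg).mul t2
  have ht3 : J.t ^ 3 ≠ 0 := pow_ne_zero 3 ht
  have t3 : IsAlgebraic R (J.t ^ 3) := t.pow 3
  have α : IsAlgebraic R J.α :=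
    isAlgebraic_of_mul_left h2t2 a2t2 (h (Sum.inl ⟨(1, 0), by simp⟩))
  have β : IsAlgebraic R J.β :=
    isAlgebraic_of_mul_left h2t2 a2t2 (h (Sum.inl ⟨(0, 1), by simp⟩))
  have q20 : IsAlgebraic R J.q20 := by
    have e : IsAlgebraic R (J.α ^ 2 + 2 * J.q20) :=
      isAlgebraic_of_mul_left ht2 e00 (h (Sum.inl ⟨(2, 0), by simp⟩))
    exact isAlgebraic_of_mul_left two_ne_zero two (by simpa using e.sub (α.pow 2))
  have q11 : IsAlgebraic R J.q11 := by
    have e : IsAlgebraic R (2 * J.α * J.β + 2 * J.q11) :=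
      isAlgebraic_of_mul_left ht2 e00 (h (Sum.inl ⟨(1, 1), by simp⟩))
    exact isAlgebraic_of_mul_left two_ne_zero two (by simpa using e.sub ((two.mul α).mul β))
  have q02 : IsAlgebraic R J.q02 := by
    have e : IsAlgebraic R (J.β ^ 2 + 2 * J.q02) :=
      isAlgebraic_of_mul_left ht2 e00 (h (Sum.inl ⟨(0, 2), by simp⟩))
    exact isAlgebraic_of_mul_left two_ne_zero two (by simpa using e.sub (β.pow 2))
  have h20 : IsAlgebraic R J.h20 := by
    have e : IsAlgebraic R (3 * J.α ^ 2 + 3 * J.q20 + J.h20) :=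
      isAlgebraic_of_mul_left ht3 t3 (h (Sum.inr ⟨(2, 0), by simp⟩))
    simpa using e.sub ((three.mul (α.pow 2)).add (three.mul q20))
  have h11 : IsAlgebraic R J.h11 := by
    have e : IsAlgebraic R (6 * J.α * J.β + 3 * J.q11 + J.h11) :=
      isAlgebraic_of_mul_left ht3 t3 (h (Sum.inr ⟨(1, 1), by simp⟩))
    simpa using e.sub (((six.mul α).mul β).add (three.mul q11))
  have h02 : IsAlgebraic R J.h02 := by
    have e : IsAlgebraic R (3 * J.β ^ 2 + 3 * J.q02 + J.h02) :=
      isAlgebraic_of_mul_left ht3 t3 (h (Sum.inr ⟨(0, 2), by simp⟩))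
    simpa using e.sub ((three.mul (β.pow 2)).add (three.mul q02))
  have s20 := (three.mul q20).add h20
  have s11 := (three.mul q11).add h11
  have s02 := (three.mul q02).add h02
  have h30 : IsAlgebraic R J.h30 := by
    have e : IsAlgebraic R (J.α ^ 3 + J.α * (3 * J.q20 + J.h20) + J.h30) :=
      isAlgebraic_of_mul_left ht3 t3 (h (Sum.inr ⟨(3, 0), by simp⟩))
    simpa using e.sub ((α.pow 3).add (α.mul s20))
  have h21 : IsAlgebraic R J.h21 := by
    have e : IsAlgebraic R (3 * J.α ^ 2 * J.β + J.β * (3 * J.q20 + J.h20)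
        + J.α * (3 * J.q11 + J.h11) + J.h21) :=
      isAlgebraic_of_mul_left ht3 t3 (h (Sum.inr ⟨(2, 1), by simp⟩))
    simpa using e.sub ((((three.mul (α.pow 2)).mul β).add (β.mul s20)).add (α.mul s11))
  have h12 : IsAlgebraic R J.h12 := by
    have e : IsAlgebraic R (3 * J.α * J.β ^ 2 + J.α * (3 * J.q02 + J.h02)
        + J.β * (3 * J.q11 + J.h11) + J.h12) :=
      isAlgebraic_of_mul_left ht3 t3 (h (Sum.inr ⟨(1, 2), by simp⟩))
    simpa using e.sub ((((three.mul α).mul (β.pow 2)).add (α.mul s02)).add (β.mul s11))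
  have h03 : IsAlgebraic R J.h03 := by
    have e : IsAlgebraic R (J.β ^ 3 + J.β * (3 * J.q02 + J.h02) + J.h03) :=
      isAlgebraic_of_mul_left ht3 t3 (h (Sum.inr ⟨(0, 3), by simp⟩))
    simpa using e.sub ((β.pow 3).add (β.mul s02))
  exact ⟨⟨⟨t, α, β⟩, q20, q11, q02⟩, ⟨h20, h11, h02⟩, h30, h21, h12, h03⟩

lemma IsAlgebraicOver.shear {R A : Type*} [CommRing R] [IsDomain R] [CommRing A] [Algebra R A]
    {J : TorusJet A} {p : A} (hp : IsAlgebraic R p)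
    (h : J.IsAlgebraicOver R) : (J.shear p).IsAlgebraicOver R := by
  obtain ⟨⟨h1, q20, q11, q02⟩, ⟨h20, h11, h02⟩, h30, h21, h12, h03⟩ := h
  have nat : ∀ n : ℕ, IsAlgebraic R (n : A) := fun n => isAlgebraic_natCast n
  have two : IsAlgebraic R (2 : A) := by exact_mod_cast nat 2
  have three : IsAlgebraic R (3 : A) := by exact_mod_cast nat 3
  have p2 := hp.pow 2
  refine ⟨⟨h1, (q20.sub (hp.mul q11)).add (p2.mul q02), q11.sub ((two.mul hp).mul q02), q02⟩,
    ⟨(h20.sub (hp.mul h11)).add (p2.mul h02), h11.sub ((two.mul hp).mul h02), h02⟩,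
    (((h30.sub (hp.mul h21)).add (p2.mul h12)).sub ((hp.pow 3).mul h03)),
    (h21.sub ((two.mul hp).mul h12)).add ((three.mul p2).mul h03),
    h12.sub ((three.mul hp).mul h03), h03⟩

/-- The parameter of the shear is algebraic over the sheared jet if the quadratic part
is `h02 * y ^ 2` before the shear, or else if the cubic part has no term in `x ^ 3`. -/
lemma isAlgebraicOver_of_shear [CharZero A] {J : TorusJet A} {p : A}
    (h : (J.shear p).IsAlgebraicOver R)
    (hJ : (J.h11 = 0 ∧ J.h02 ≠ 0) ∨ (J.h30 = 0 ∧ J.h03 ≠ 0)) :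
    IsAlgebraic R p ∧ J.IsAlgebraicOver R := by
  have hp : IsAlgebraic R p := by
    obtain ⟨-, ⟨-, h11, h02⟩, h30, h21, h12, h03⟩ := h
    rcases hJ with ⟨e1, e2⟩ | ⟨e1, e2⟩
    · have two : IsAlgebraic R (-2 : A) := by
        have := (isAlgebraic_natCast (R := R) (A := A) 2).neg
        exact_mod_cast this
      refine isAlgebraic_of_mul_left (a := -2 * J.h02) (mul_ne_zero (by simp) e2) (two.mul h02) ?_
      have e : -2 * J.h02 * p = (J.shear p).h11 := by
        simp only [TorusJet.shear, e1]; ring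
      rw [e]
      exact h11
    · refine isAlgebraic_of_cubic (a := (J.shear p).h03) e2 h03 h12 h21 h30 ?_
      simp only [TorusJet.shear, e1]
      ring
  refine ⟨hp, ?_⟩
  have := IsAlgebraicOver.shear hp.neg h
  have e : (J.shear p).shear (-p) = J := by
    have := shear_shear_neg (-p) J
    rwa [neg_neg] at this
  rwa [e] at this

end TorusJet

end Algebraic

lemma isAlgebraic_of_forall_X {m : ℕ} {S : Subalgebra ℂ (MvPolynomial (Fin m) ℂ)}
    (h : ∀ i, IsAlgebraic S (X i : MvPolynomial (Fin m) ℂ)) (x : MvPolynomial (Fin m) ℂ) :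
    IsAlgebraic S x := by
  induction x using MvPolynomial.induction_on with
  | C a => exact isAlgebraic_algebraMap (R := S) (⟨C a, S.algebraMap_mem a⟩ : S)
  | add p q hp hq => exact hp.add hq
  | mul_X p i hp => exact hp.mul (h i)

end TorusSextic

/-! ### Irreducibility over `ℂ[x]` -/

namespace TorusSextic

open Polynomial

lemma irreducible_of_no_root {p : Polynomial (Polynomial ℂ)} (hp : p.Monic) (h3 : p.natDegree = 3)
    (h : ∀ ρ, p.eval ρ ≠ 0) : Irreducible p := by
  rw [hp.irreducible_iff_roots_eq_zero_of_degree_le_three (by omega) (by omega)]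
  refine Multiset.eq_zero_of_forall_notMem fun ρ hρ => h ρ ?_
  exact (Polynomial.mem_roots'.1 hρ).2

/-- The elliptic curve of the first base sextic has no polynomial point. -/
lemma no_polynomial_solution (v : ℂ[X]) :
    2 * v ^ 3 - 3 * X ^ 2 * v ^ 2 + 3 * (v - X ^ 2) ^ 2 ≠ 0 := by
  intro h
  have h1 : v ^ 2 ∣ (v - X ^ 2) ^ 2 := by
    refine ⟨C (3⁻¹ : ℂ) * (3 * X ^ 2 - 2 * v), ?_⟩
    have h3 : (C (3⁻¹ : ℂ)) * 3 = 1 := by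
      rw [← C_ofNat, ← C_mul]; norm_num
    linear_combination C (3⁻¹ : ℂ) * h - (v - X ^ 2) ^ 2 * h3
  have h2 : v ∣ X ^ 2 := by
    have := (IsIntegrallyClosed.pow_dvd_pow_iff two_ne_zero).1 h1
    have h3 := dvd_sub (dvd_refl v) this
    simpa using h3
  obtain ⟨k, hk, hv⟩ := (dvd_prime_pow prime_X 2).1 h2
  obtain ⟨u, hu⟩ := hv.symm
  obtain ⟨c, hc, hcu⟩ := isUnit_iff.1 u.isUnit
  rw [← hu, ← hcu] at h
  have hc0 : c ≠ 0 := hc.ne_zero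
  have ev : ∀ x : ℂ, 2 * (c * x ^ k) ^ 3 - 3 * x ^ 2 * (c * x ^ k) ^ 2
      + 3 * (c * x ^ k - x ^ 2) ^ 2 = 0 := fun x => by
    simpa using congrArg (eval x) h
  interval_cases k
  · have e0 := ev 0
    have e1 := ev 1
    have : c = -3 / 2 := by
      refine mul_left_cancel₀ (pow_ne_zero 2 hc0) ?_
      linear_combination e0 / 2
    rw [this] at e1
    norm_num at e1
  · have : (6 : ℂ) = 0 := by linear_combination ev (-1) + ev 1
    norm_num at this
  · have e0 := ev 1
    have : (c - 1) ^ 2 = 0 := by linear_combination (64 * e0 - ev 2) / 144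
    have : c = 1 := by simpa [sub_eq_zero] using this
    rw [this] at e0
    norm_num at e0

/-- The first base sextic as a monic cubic over `ℂ[x]`: a root would be a square `w ^ 2`, for which
`w = 1 + v` with `v` as in `no_polynomial_solution`. -/
lemma irreducible_cubic_base {e d : ℂ[X]} (he : e = -C (1 / 2) * (1 + 3 * X ^ 2 + 3 * X ^ 4))
    (hd : d = C (3 / 2) * (1 + X ^ 2)) :
    Irreducible ((X : Polynomial ℂ[X]) ^ 3 - (C e + C d * X) ^ 2) := by
  have hdeg : ((C e + C d * X : Polynomial ℂ[X]) ^ 2).degree < ((3 : ℕ) : WithBot ℕ) := by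
    refine lt_of_le_of_lt (b := ((2 : ℕ) : WithBot ℕ)) ?_ (by norm_num)
    compute_degree
    exact le_rfl
  have hm := monic_X_pow_sub hdeg
  refine irreducible_of_no_root hm ?_ fun ρ h => ?_
  · refine natDegree_eq_of_degree_eq_some ?_
    rw [degree_sub_eq_left_of_degree_lt (by rwa [degree_X_pow]), degree_X_pow]
  · simp only [eval_sub, eval_pow, eval_X, eval_add, eval_mul, eval_C] at h
    have h1 : ρ ^ 2 ∣ (e + d * ρ) ^ 2 := ⟨ρ, by linear_combination -h⟩
    obtain ⟨w, hw⟩ := (IsIntegrallyClosed.pow_dvd_pow_iff two_ne_zero).1 h1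
    have hC : (C (1 / 2 : ℂ)) * 2 = 1 := by rw [← C_ofNat, ← C_mul]; norm_num
    have hC' : (C (3 / 2 : ℂ)) = 3 * C (1 / 2 : ℂ) := by rw [← C_ofNat, ← C_mul]; norm_num
    have hρ : ρ ≠ 0 := by
      rintro rfl
      have h0 : e ^ 2 = 0 := by linear_combination -h
      have h0 : e = 0 := by simpa using h0
      rw [he] at h0
      have := congrArg (eval 0) h0
      simp at this
    have h2 : ρ = w ^ 2 := by
      refine mul_left_cancel₀ (pow_ne_zero 2 hρ) ?_
      rw [hw] at h
      linear_combination h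
    refine no_polynomial_solution (w - 1) ?_
    rw [h2, he, hd, hC'] at hw
    linear_combination (-2) * hw - (1 + 3 * X ^ 2 + 3 * X ^ 4 - 3 * (1 + X ^ 2) * w ^ 2) * hC

/-- A factor of the second base sextic after the substitution `x = w ^ 2 - 1`. -/
lemma irreducible_half {k : ℂ[X]}
    (hk : k = -C (1 / 16) * ((X - 1) ^ 4 * (X ^ 2 + 4 * X + 1))) :
    Irreducible ((X : Polynomial ℂ[X]) ^ 3 + C k) := by
  refine irreducible_of_no_root (monic_X_pow_add_C _ (by norm_num)) (by simp) fun ρ h => ?_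
  simp only [eval_add, eval_pow, eval_X, eval_C] at h
  have h0 : ρ.eval 1 = 0 := by
    have := congrArg (eval 1) h
    simpa [hk] using this
  obtain ⟨q, rfl⟩ := dvd_iff_isRoot.2 h0
  have hX : (X - C 1 : ℂ[X]) ≠ 0 := X_sub_C_ne_zero 1
  have hq : q ^ 3 = C (1 / 16) * ((X - 1) * (X ^ 2 + 4 * X + 1)) := by
    refine mul_left_cancel₀ (pow_ne_zero 3 hX) ?_
    rw [hk, C_1] at *
    linear_combination h
  have h1 : q.eval 1 = 0 := by
    have := congrArg (eval 1) hq
    simpa using this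
  obtain ⟨q', rfl⟩ := dvd_iff_isRoot.2 h1
  have hq' : (X - C 1) ^ 2 * q' ^ 3 = C (1 / 16) * (X ^ 2 + 4 * X + 1) := by
    refine mul_left_cancel₀ hX ?_
    rw [C_1] at *
    linear_combination hq
  have := congrArg (eval 1) hq'
  norm_num at this

/-- The second base sextic. With `x = w ^ 2 - 1` it is the product of two irreducible cubics in `y`,
which are exchanged by `w ↦ -w`. -/
lemma irreducible_sextic_base {j : ℂ[X]}
    (hj : j = 1 + C (3 / 2) * X + C (3 / 8) * X ^ 2 - C (1 / 16) * X ^ 3) :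
    Irreducible (((X : Polynomial ℂ[X]) ^ 3 + C j) ^ 2 - C ((1 + X) ^ 3)) := by
  set F : Polynomial ℂ[X] := (X ^ 3 + C j) ^ 2 - C ((1 + X) ^ 3) with hF
  have hF6 : F = X ^ 6 + (C (2 * j) * X ^ 3 + C (j ^ 2 - (1 + X) ^ 3)) := by
    rw [hF]; simp only [C_mul, C_sub, C_pow, C_ofNat]; ring
  have hdeg : (C (2 * j) * X ^ 3 + C (j ^ 2 - (1 + X) ^ 3) : Polynomial ℂ[X]).degree
      < ((6 : ℕ) : WithBot ℕ) := by
    refine lt_of_le_of_lt (b := ((3 : ℕ) : WithBot ℕ)) ?_ (by norm_num)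
    compute_degree
    exact le_rfl
  have hm : F.Monic := by rw [hF6]; exact monic_X_pow_add hdeg
  have h6 : F.natDegree = 6 := by
    rw [hF6]
    refine natDegree_eq_of_degree_eq_some ?_
    rw [degree_add_eq_left_of_degree_lt (by rwa [degree_X_pow]), degree_X_pow]
  let φ : ℂ[X] →+* ℂ[X] := compRingHom (X ^ 2 - 1)
  let σ : ℂ[X] →+* ℂ[X] := compRingHom (-X)
  have hσφ : σ.comp φ = φ := by
    ext
    · simp [σ, φ]
    · simp [σ, φ]
  have hinv : ∀ f : Polynomial ℂ[X], (f.map φ).map σ = f.map φ := fun f => by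
    rw [map_map, hσφ]
  have c2 : (C (1 / 16 : ℂ)) * 16 = 1 := by rw [← C_ofNat, ← C_mul]; norm_num
  have c3 : (C (3 / 2 : ℂ)) = 24 * C (1 / 16 : ℂ) := by rw [← C_ofNat, ← C_mul]; norm_num
  have c4 : (C (3 / 8 : ℂ)) = 6 * C (1 / 16 : ℂ) := by rw [← C_ofNat, ← C_mul]; norm_num
  obtain ⟨k, hk⟩ : ∃ k : ℂ[X], k = -C (1 / 16) * ((X - 1) ^ 4 * (X ^ 2 + 4 * X + 1)) := ⟨_, rfl⟩
  have hφj : φ j - X ^ 3 = k := by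
    rw [hk, hj, c3, c4]
    simp only [φ, map_add, map_sub, map_mul, map_pow, map_one, map_ofNat, coe_compRingHom_apply,
      X_comp, C_comp]
    linear_combination (X ^ 3 - 1) * c2
  have hk' : σ k = φ j + X ^ 3 := by
    rw [← hφj, map_sub, map_pow]
    have : σ (φ j) = φ j := RingHom.congr_fun hσφ j
    rw [this]
    simp only [σ, coe_compRingHom_apply, X_comp]
    ring
  have hφF : F.map φ = (X ^ 3 + C k) * (X ^ 3 + C (σ k)) := by
    have hv : φ ((1 + X) ^ 3) = X ^ 6 := by
      simp only [φ, map_add, map_pow, map_one, coe_compRingHom_apply, X_comp]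
      ring
    rw [hF, hk', ← hφj, Polynomial.map_sub, Polynomial.map_pow, Polynomial.map_add,
      Polynomial.map_pow, map_X, map_C, map_C, hv]
    simp only [C_add, C_sub, C_pow]
    ring
  have hp : Irreducible ((X : Polynomial ℂ[X]) ^ 3 + C k) := irreducible_half hk
  have hp' : Irreducible ((X : Polynomial ℂ[X]) ^ 3 + C (σ k)) := by
    refine irreducible_of_no_root (monic_X_pow_add_C _ (by norm_num)) (by simp) fun ρ h => ?_
    have h1 : (X ^ 3 + C k : Polynomial ℂ[X]).eval (σ ρ) = 0 := by
      have hσσ : σ.comp σ = RingHom.id _ := by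
        ext
        · simp [σ]
        · simp [σ]
      have h2 := congrArg σ h
      simp only [eval_add, eval_pow, eval_X, eval_C, map_add, map_pow, map_zero] at h2 ⊢
      have h3 : σ (σ k) = k := RingHom.congr_fun hσσ k
      rw [h3] at h2
      exact h2
    have hmk := monic_X_pow_add_C k (by norm_num : 3 ≠ 0)
    have h2 := (hmk.irreducible_iff_roots_eq_zero_of_degree_le_three (by simp) (by simp)).1 hp
    have h3 := (mem_roots hmk.ne_zero).2 h1
    rw [h2] at h3
    exact Multiset.notMem_zero _ h3
  have hne : k ≠ σ k := by
    intro h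
    rw [hk', ← hφj] at h
    have h1 : (2 : ℂ[X]) * X ^ 3 = 0 := by linear_combination -h
    have h2 := congrArg (eval 1) h1
    simp at h2
  -- a factor that comes from `ℂ[x][y]` is invariant, hence divisible by both or none of the cubics
  have key : ∀ f : Polynomial ℂ[X], f.Monic → (X ^ 3 + C k) ∣ f.map φ → 6 ≤ f.natDegree := by
    intro f hf hdvd
    have h1 : (X ^ 3 + C (σ k)) ∣ f.map φ := by
      have := Polynomial.map_dvd σ hdvd
      rw [hinv] at this
      simpa using this
    obtain ⟨g, hg⟩ := hdvd
    have h2 : (X ^ 3 + C (σ k)) ∣ g := by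
      rw [hg] at h1
      refine (hp'.prime.dvd_or_dvd h1).resolve_left fun h3 => hne ?_
      have h4 := eq_of_monic_of_associated (monic_X_pow_add_C k (by norm_num : 3 ≠ 0))
        (monic_X_pow_add_C (σ k) (by norm_num : 3 ≠ 0)) (hp'.associated_of_dvd hp h3).symm
      exact C_injective (add_left_cancel h4)
    obtain ⟨g', rfl⟩ := h2
    have h3 := hf.map φ
    have h4 : (f.map φ).natDegree = f.natDegree := hf.natDegree_map φ
    rw [← h4, hg]
    have h5 : (X ^ 3 + C k) * ((X ^ 3 + C (σ k)) * g') ≠ 0 := by rw [← hg]; exact h3.ne_zero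
    have h6 := right_ne_zero_of_mul h5
    rw [natDegree_mul hp.ne_zero h6, natDegree_mul hp'.ne_zero (right_ne_zero_of_mul h6)]
    simp
    omega
  rw [hm.irreducible_iff_natDegree]
  refine ⟨fun h => by rw [h] at h6; simp at h6, fun f g hf hg hfg => ?_⟩
  have hsum : f.natDegree + g.natDegree = 6 := by rw [← hf.natDegree_mul hg, hfg, h6]
  have hd : (X ^ 3 + C k) ∣ f.map φ * g.map φ := by
    rw [← Polynomial.map_mul, hfg, hφF]
    exact dvd_mul_right _ _
  rcases hp.prime.dvd_or_dvd hd with h | h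
  · have := key f hf h
    omega
  · have := key g hg h
    omega

end TorusSextic

/-! ### Two irreducible sextics -/

namespace TorusSextic

open MvPolynomial

/-- The polynomials in `x` and `y` as polynomials in `Y = y - r(x)` over `ℂ[x]`. -/
noncomputable def tower (r : Polynomial ℂ) :
    MvPolynomial (Fin 2) ℂ ≃ₐ[ℂ] Polynomial (Polynomial ℂ) :=
  AlgEquiv.ofAlgHom
    (aeval ![Polynomial.C Polynomial.X, Polynomial.C r + Polynomial.X])
    (Polynomial.eval₂AlgHom (Polynomial.aeval (X 0 : MvPolynomial (Fin 2) ℂ))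
      (X 1 - Polynomial.aeval (X 0) r) fun _ => Commute.all _ _)
    (by
      have hC : ∀ p : Polynomial ℂ, Polynomial.aeval (Polynomial.C Polynomial.X :
          Polynomial (Polynomial ℂ)) p = Polynomial.C p := fun p => by
        have := Polynomial.aeval_algHom_apply
          (Polynomial.CAlgHom (R := ℂ) (A := Polynomial ℂ)) Polynomial.X p
        simpa using this
      refine Polynomial.algHom_ext' ?_ ?_
      · ext
        simp
      · simp [← Polynomial.aeval_algHom_apply, hC])
    (by
      ext i
      fin_cases i
      · simp
      · simp)

lemma tower_X_zero (r : Polynomial ℂ) : tower r (X 0) = Polynomial.C Polynomial.X := by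
  simp [tower]

lemma tower_X_one (r : Polynomial ℂ) : tower r (X 1) = Polynomial.C r + Polynomial.X := by
  simp [tower]

lemma irreducible_of_tower {f : MvPolynomial (Fin 2) ℂ} (r : Polynomial ℂ)
    (h : Irreducible (tower r f)) : Irreducible f :=
  (MulEquiv.irreducible_iff (tower r)).1 h

/-- A jet in all the families for the types `A_n`, namely with `κ = 1 / 4`, `s = 1` and no shear,
whose conic is the parabola `1 + x ^ 2 + y` up to sign. -/
noncomputable def baseA : TorusJet ℂ :=
  ⟨1, 0, 1 / 2, 1 / 2, 0, -1 / 8, 0, 0, -3 / 8, 0, 3 / 4, 0, 1 / 4⟩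

/-- A jet in all the families for the types `D_k` and `E₆`, with no shear. Its conic degenerates to
the line `1 + x`, but nearby jets in the families have conics of degree `2`. -/
noncomputable def baseE : TorusJet ℂ :=
  ⟨1, 1 / 2, 0, -1 / 8, 0, 0, 0, 0, 0, 0, 0, 0, 1⟩

lemma sextic_baseA : sextic baseA.pair = -(1 + X 1 + X 0 ^ 2) ^ 3 +
    (1 + C (3 / 2) * (X 1 + X 0 ^ 2) + C (3 / 2) * X 0 ^ 2 * X 1) ^ 2 := by
  refine MvPolynomial.funext fun z => ?_
  rw [sextic, map_add, map_pow, map_pow, eval_conic_pair, eval_cubic_pair]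
  simp [baseA, TorusJet.q]
  ring

lemma sextic_baseE : sextic baseE.pair = -(1 + X 0) ^ 3 +
    (1 + C (3 / 2) * X 0 + C (3 / 8) * X 0 ^ 2 - C (1 / 16) * X 0 ^ 3 + X 1 ^ 3) ^ 2 := by
  refine MvPolynomial.funext fun z => ?_
  rw [sextic, map_add, map_pow, map_pow, eval_conic_pair, eval_cubic_pair]
  simp [baseE, TorusJet.q]
  ring

lemma tower_C (r : Polynomial ℂ) (a : ℂ) : tower r (C a) = Polynomial.C (Polynomial.C a) :=
  (tower r).commutes a

/-- In `Y = 1 + x ^ 2 + y` the sextic is `-1` times a monic cubic. -/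
lemma irreducible_baseA : Irreducible (sextic baseA.pair) := by
  refine irreducible_of_tower (-(1 + Polynomial.X ^ 2)) ?_
  refine (Associated.irreducible_iff (Associated.neg_left (Associated.refl _))).1 ?_
  convert irreducible_cubic_base rfl rfl using 1
  rw [sextic_baseA]
  simp only [map_add, map_neg, map_pow, map_mul, map_one, tower_X_zero, tower_X_one, tower_C]
  have c2 : (Polynomial.C (Polynomial.C (1 / 2 : ℂ))) * 2 = 1 := by
    rw [← Polynomial.C_ofNat, ← Polynomial.C_ofNat, ← Polynomial.C_mul, ← Polynomial.C_mul]
    norm_num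
  have c3 : (Polynomial.C (Polynomial.C (3 / 2 : ℂ))) =
      3 * Polynomial.C (Polynomial.C (1 / 2 : ℂ)) := by
    rw [← Polynomial.C_ofNat, ← Polynomial.C_ofNat, ← Polynomial.C_mul, ← Polynomial.C_mul]
    norm_num
  rw [c3]
  simp only [map_ofNat]
  generalize Polynomial.C (Polynomial.C (1 / 2 : ℂ)) = c at c2 ⊢
  generalize (Polynomial.C Polynomial.X : Polynomial (Polynomial ℂ)) = x
  generalize (Polynomial.X : Polynomial (Polynomial ℂ)) = y
  linear_combination ((1 + 3 * c * (y - 1) + 3 * c * x ^ 2 * (y - 1 - x ^ 2))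
    + (-c * (1 + 3 * x ^ 2 + 3 * x ^ 4) + 3 * c * (1 + x ^ 2) * y)) * c2

lemma irreducible_baseE : Irreducible (sextic baseE.pair) := by
  refine irreducible_of_tower 0 ?_
  convert irreducible_sextic_base rfl using 1
  rw [sextic_baseE]
  simp only [map_add, map_sub, map_neg, map_pow, map_mul, map_one, tower_X_zero, tower_X_one,
    tower_C, Polynomial.C_0]
  ring

end TorusSextic

/-! ### Openness of irreducibility -/

namespace TorusSextic

open MvPolynomial

/-- The image of a bilinear map without zero divisors is closed: up to positive factors, its
points are images of points of a product of unit spheres. -/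
lemma isClosed_range_of_homogeneous {E F G : Type*} [NormedAddCommGroup E] [NormedSpace ℂ E]
    [FiniteDimensional ℂ E] [NormedAddCommGroup F] [NormedSpace ℂ F] [FiniteDimensional ℂ F]
    [NormedAddCommGroup G] [NormedSpace ℂ G] (β : E → F → G)
    (hβ : Continuous fun p : E × F => β p.1 p.2) (hl : ∀ (a : ℂ) x y, β (a • x) y = a • β x y)
    (hr : ∀ (a : ℂ) x y, β x (a • y) = a • β x y) (h0 : ∀ x y, β x y = 0 → x = 0 ∨ y = 0) :
    IsClosed {g | ∃ x y, β x y = g} := by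
  have := FiniteDimensional.proper ℂ E
  have := FiniteDimensional.proper ℂ F
  have hsph : ∀ g, (∃ x y, β x y = g) → g ≠ 0 → ∃ (s : ℂ) (p : E × F),
      p ∈ Metric.sphere (0 : E) 1 ×ˢ Metric.sphere (0 : F) 1 ∧ g = s • β p.1 p.2 ∧
      s = (‖g‖ / ‖β p.1 p.2‖ : ℝ) := by
    rintro g ⟨x, y, rfl⟩ hg
    have hx : x ≠ 0 := by
      rintro rfl
      have := hl 0 0 y
      rw [zero_smul, zero_smul] at this
      exact hg this
    have hy : y ≠ 0 := by
      rintro rfl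
      have := hr 0 x 0
      rw [zero_smul, zero_smul] at this
      exact hg this
    have hx' := norm_ne_zero_iff.2 hx
    have hy' := norm_ne_zero_iff.2 hy
    have hg' := norm_ne_zero_iff.2 hg
    refine ⟨_, (((‖x‖⁻¹ : ℝ) : ℂ) • x, ((‖y‖⁻¹ : ℝ) : ℂ) • y), ⟨?_, ?_⟩, ?_, rfl⟩
    · simp [norm_smul, hx']
    · simp [norm_smul, hy']
    · simp only [hl, hr, smul_smul, norm_smul]
      have : ((‖β x y‖ / (‖((‖x‖⁻¹ : ℝ) : ℂ) * ((‖y‖⁻¹ : ℝ) : ℂ)‖ * ‖β x y‖) : ℝ) : ℂ)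
          * (((‖x‖⁻¹ : ℝ) : ℂ) * ((‖y‖⁻¹ : ℝ) : ℂ)) = 1 := by
        rw [norm_mul]
        norm_cast
        simp only [Real.norm_eq_abs, abs_inv, abs_norm]
        field_simp
      rw [this, one_smul]
  refine IsSeqClosed.isClosed fun u g hu hg => ?_
  by_cases hg0 : g = 0
  · refine ⟨0, 0, ?_⟩
    have := hl 0 0 0
    rw [zero_smul, zero_smul] at this
    rw [this, hg0]
  obtain ⟨N, hN⟩ := Filter.eventually_atTop.1 (hg.eventually_ne hg0)
  have hg' : Filter.Tendsto (fun n => u (n + N)) Filter.atTop (𝓝 g) :=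
    (Filter.tendsto_add_atTop_iff_nat N).2 hg
  choose s p hp hs hs' using fun n => hsph (u (n + N)) (hu _) (hN _ (Nat.le_add_left N n))
  obtain ⟨q, hq, φ, hφ, hlim⟩ :=
    ((isCompact_sphere (0 : E) 1).prod (isCompact_sphere (0 : F) 1)).tendsto_subseq hp
  have hb : Filter.Tendsto (fun n => β (p (φ n)).1 (p (φ n)).2) Filter.atTop (𝓝 (β q.1 q.2)) :=
    (hβ.tendsto q).comp hlim
  have hq0 : β q.1 q.2 ≠ 0 := by
    intro h
    rcases h0 _ _ h with h | h
    · have := hq.1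
      rw [h] at this
      simp at this
    · have := hq.2
      rw [h] at this
      simp at this
  have hgφ := hg'.comp hφ.tendsto_atTop
  have hsl : Filter.Tendsto (fun n => s (φ n)) Filter.atTop (𝓝 ((‖g‖ / ‖β q.1 q.2‖ : ℝ) : ℂ)) := by
    simp only [hs']
    exact (Complex.continuous_ofReal.tendsto _).comp
      (hgφ.norm.div hb.norm (norm_ne_zero_iff.2 hq0))
  have hfin := hsl.smul hb
  refine ⟨((‖g‖ / ‖β q.1 q.2‖ : ℝ) : ℂ) • q.1, q.2, ?_⟩
  rw [hl]
  refine tendsto_nhds_unique hfin (hgφ.congr fun n => ?_)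
  exact hs (φ n)

/-- The exponent of a monomial as a finitely supported function. -/
noncomputable def Mon.exponent {d : ℕ} (m : Mon d) : Fin 2 →₀ ℕ :=
  Finsupp.single 0 (m.1.1 : ℕ) + Finsupp.single 1 (m.1.2 : ℕ)

lemma planePoly_eq_sum (d : ℕ) (a : Mon d → ℂ) :
    planePoly d a = ∑ m : Mon d, monomial m.exponent (a m) := by
  refine Finset.sum_congr rfl fun m _ => ?_
  rw [X_pow_eq_monomial, X_pow_eq_monomial, C_mul_monomial, monomial_mul]
  simp [Mon.exponent]

lemma Mon.exponent_injective (d : ℕ) : Function.Injective (Mon.exponent (d := d)) := by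
  intro m n h
  have h0 := DFunLike.congr_fun h 0
  have h1 := DFunLike.congr_fun h 1
  simp [Mon.exponent] at h0 h1
  ext
  · exact h0
  · exact h1

lemma coeff_planePoly {d : ℕ} (a : Mon d → ℂ) (m : Mon d) :
    coeff m.exponent (planePoly d a) = a m := by
  classical
  rw [planePoly_eq_sum, coeff_sum, Finset.sum_eq_single m]
  · simp
  · intro n _ hn
    rw [coeff_monomial, if_neg fun h => hn (Mon.exponent_injective d h)]
  · simp

lemma planePoly_injective (d : ℕ) : Function.Injective (planePoly d) := fun a b h => by
  ext m
  rw [← coeff_planePoly a m, h, coeff_planePoly]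

lemma totalDegree_planePoly_le (d : ℕ) (a : Mon d → ℂ) : (planePoly d a).totalDegree ≤ d := by
  rw [planePoly_eq_sum]
  refine totalDegree_finsetSum_le fun m _ => ?_
  refine (totalDegree_monomial_le _ _).trans ?_
  rw [Mon.exponent, Finsupp.sum_add_index' (by simp) (by simp), Finsupp.sum_single_index rfl,
    Finsupp.sum_single_index rfl]
  exact m.2

/-- The coefficients of a polynomial up to degree `d`. -/
noncomputable def planeCoeff (d : ℕ) (f : MvPolynomial (Fin 2) ℂ) : Mon d → ℂ :=
  fun m => coeff m.exponent f

lemma planePoly_planeCoeff {d : ℕ} {f : MvPolynomial (Fin 2) ℂ} (hf : f.totalDegree ≤ d) :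
    planePoly d (planeCoeff d f) = f := by
  classical
  ext e
  by_cases he : e 0 + e 1 ≤ d
  · let m : Mon d := ⟨(⟨e 0, by omega⟩, ⟨e 1, by omega⟩), he⟩
    have hm : m.exponent = e := by
      ext i
      fin_cases i <;> simp [Mon.exponent, m]
    rw [← hm, coeff_planePoly, planeCoeff]
  · have hs : e.sum (fun _ k => k) = e 0 + e 1 := by
      rw [Finsupp.sum_fintype _ _ (by simp), Fin.sum_univ_two]
    have : ∀ g : MvPolynomial (Fin 2) ℂ, g.totalDegree ≤ d → coeff e g = 0 := fun g hg => by
      refine coeff_eq_zero_of_totalDegree_lt ?_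
      have : ∑ i ∈ e.support, e i = e.sum (fun _ k => k) := rfl
      omega
    rw [this _ (totalDegree_planePoly_le _ _), this _ hf]

lemma planePoly_add (d : ℕ) (a b : Mon d → ℂ) :
    planePoly d (a + b) = planePoly d a + planePoly d b := by
  simp [planePoly_eq_sum, Finset.sum_add_distrib]

lemma planePoly_smul (d : ℕ) (r : ℂ) (a : Mon d → ℂ) :
    planePoly d (r • a) = r • planePoly d a := by
  simp [planePoly_eq_sum, Finset.smul_sum, smul_monomial]

lemma totalDegree_conic_le (c : Pair) : (conic c).totalDegree ≤ 2 := totalDegree_planePoly_le _ _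

lemma totalDegree_cubic_le (c : Pair) : (cubic c).totalDegree ≤ 3 := totalDegree_planePoly_le _ _

lemma totalDegree_sextic_le (c : Pair) : (sextic c).totalDegree ≤ 6 := by
  refine (totalDegree_add _ _).trans (max_le ?_ ?_)
  · have := totalDegree_pow (conic c) 3
    have := totalDegree_conic_le c
    omega
  · have := totalDegree_pow (cubic c) 2
    have := totalDegree_cubic_le c
    omega

/-- The coefficients of a family of polynomials vary continuously. -/
def ContinuousCoeff {T : Type*} [TopologicalSpace T] (F : T → MvPolynomial (Fin 2) ℂ) : Prop :=
  ∀ e, Continuous fun c => coeff e (F c)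

lemma ContinuousCoeff.add {T : Type*} [TopologicalSpace T] {F G : T → MvPolynomial (Fin 2) ℂ}
    (hF : ContinuousCoeff F) (hG : ContinuousCoeff G) : ContinuousCoeff fun c => F c + G c :=
  fun e => by
    simp only [coeff_add]
    exact (hF e).add (hG e)

lemma ContinuousCoeff.mul {T : Type*} [TopologicalSpace T] {F G : T → MvPolynomial (Fin 2) ℂ}
    (hF : ContinuousCoeff F) (hG : ContinuousCoeff G) : ContinuousCoeff fun c => F c * G c :=
  fun e => by
    classical
    simp only [coeff_mul]
    exact continuous_finsetSum _ fun x _ => (hF x.1).mul (hG x.2)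

lemma continuousCoeff_planePoly {T : Type*} [TopologicalSpace T] {d : ℕ} {a : T → Mon d → ℂ}
    (ha : Continuous a) : ContinuousCoeff fun c => planePoly d (a c) := fun e => by
  classical
  simp only [planePoly_eq_sum, coeff_sum, coeff_monomial]
  refine continuous_finsetSum _ fun m _ => ?_
  split_ifs
  · exact (continuous_apply m).comp ha
  · exact continuous_const

lemma continuousCoeff_sextic : ContinuousCoeff sextic := by
  have h2 : ContinuousCoeff conic := continuousCoeff_planePoly (by fun_prop)
  have h3 : ContinuousCoeff cubic := continuousCoeff_planePoly (by fun_prop)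
  have : sextic = fun c => conic c * conic c * conic c + cubic c * cubic c := by
    ext1 c
    rw [sextic]
    ring
  rw [this]
  exact ((h2.mul h2).mul h2).add (h3.mul h3)

/-- The sextics of degree `6` that are irreducible are those that are not products of a polynomial
of degree at most `d` and one of degree at most `6 - d`, for `1 ≤ d ≤ 5`. -/
lemma irreducible_and_totalDegree_iff {f : MvPolynomial (Fin 2) ℂ} (hf : f.totalDegree ≤ 6) :
    f.totalDegree = 6 ∧ Irreducible f ↔
      ∀ d : Fin 5, ¬ ∃ (a : Mon (d + 1) → ℂ) (b : Mon (5 - d) → ℂ),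
        planePoly (d + 1) a * planePoly (5 - d) b = f := by
  constructor
  · rintro ⟨h6, hirr⟩ d ⟨a, b, rfl⟩
    have hd := d.2
    have h1 := totalDegree_planePoly_le (d + 1) a
    have h2 := totalDegree_planePoly_le (5 - d) b
    have h3 := totalDegree_mul (planePoly (d + 1) a) (planePoly (5 - d) b)
    rcases hirr.isUnit_or_isUnit rfl with h | h
    · have := (isUnit_iff_totalDegree_of_isReduced.1 h).2
      omega
    · have := (isUnit_iff_totalDegree_of_isReduced.1 h).2
      omega
  · intro h
    have key : ∀ g k : MvPolynomial (Fin 2) ℂ, g * k = f →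
        ∀ d : Fin 5, ¬ (g.totalDegree ≤ d + 1 ∧ k.totalDegree ≤ 5 - d) := by
      rintro g k rfl d ⟨hg, hk⟩
      exact h d ⟨planeCoeff _ g, planeCoeff _ k, by
        rw [planePoly_planeCoeff hg, planePoly_planeCoeff hk]⟩
    have h6 : f.totalDegree = 6 := by
      have := key 1 f (one_mul f) 0
      simp at this
      omega
    have hf0 : f ≠ 0 := by
      rintro rfl
      simp at h6
    refine ⟨h6, ⟨fun hu => ?_, fun g k hgk => ?_⟩⟩
    · have := (isUnit_iff_totalDegree_of_isReduced.1 hu).2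
      omega
    · have hg0 : g ≠ 0 := by rintro rfl; exact hf0 (by rw [hgk, zero_mul])
      have hk0 : k ≠ 0 := by rintro rfl; exact hf0 (by rw [hgk, mul_zero])
      have hsum : g.totalDegree + k.totalDegree = 6 := by
        rw [← totalDegree_mul_of_isDomain hg0 hk0, ← hgk, h6]
      have hunit : ∀ p : MvPolynomial (Fin 2) ℂ, p ≠ 0 → p.totalDegree = 0 → IsUnit p := by
        intro p hp h0
        rw [totalDegree_eq_zero_iff_eq_C] at h0
        rw [h0] at hp ⊢
        refine IsUnit.map C (isUnit_iff_ne_zero.2 fun h => hp ?_)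
        rw [h, C_0]
      by_contra hno
      rw [not_or] at hno
      have hg1 : g.totalDegree ≠ 0 := fun h => hno.1 (hunit g hg0 h)
      have hk1 : k.totalDegree ≠ 0 := fun h => hno.2 (hunit k hk0 h)
      refine key g k hgk.symm ⟨g.totalDegree - 1, by omega⟩ ⟨?_, ?_⟩
      · change g.totalDegree ≤ g.totalDegree - 1 + 1
        omega
      · change k.totalDegree ≤ 5 - (g.totalDegree - 1)
        omega

/-- Irreducibility in degree `6` is an open condition: the products of polynomials of given degrees
form a closed set. -/
lemma isOpen_irreducible :
    IsOpen {c : Pair | (sextic c).totalDegree = 6 ∧ Irreducible (sextic c)} := by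
  have h1 : {c : Pair | (sextic c).totalDegree = 6 ∧ Irreducible (sextic c)} =
      ⋂ d : Fin 5, {c | planeCoeff 6 (sextic c) ∈ {g : Mon 6 → ℂ | ∃ (a : Mon (d + 1) → ℂ)
        (b : Mon (5 - d) → ℂ), planeCoeff 6 (planePoly (d + 1) a * planePoly (5 - d) b) = g}}ᶜ := by
    ext c
    rw [Set.mem_ofPred_eq, irreducible_and_totalDegree_iff (totalDegree_sextic_le c),
      Set.mem_iInter]
    refine forall_congr' fun d => not_congr (exists_congr fun a => exists_congr fun b => ?_)
    refine ⟨fun h => by rw [h], fun h => ?_⟩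
    have h2 : (planePoly (d + 1) a * planePoly (5 - d) b).totalDegree ≤ 6 := by
      have := totalDegree_mul (planePoly (d + 1) a) (planePoly (5 - d) b)
      have := totalDegree_planePoly_le (d + 1) a
      have := totalDegree_planePoly_le (5 - d) b
      omega
    rw [← planePoly_planeCoeff h2, h, planePoly_planeCoeff (totalDegree_sextic_le c)]
  rw [h1]
  refine isOpen_iInter_of_finite fun d => ?_
  refine IsOpen.preimage (continuous_pi fun m => continuousCoeff_sextic _) (IsClosed.isOpen_compl
    (self := isClosed_range_of_homogeneous _ (continuous_pi fun m => ?_) ?_ ?_ ?_))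
  · exact ((continuousCoeff_planePoly continuous_fst).mul
      (continuousCoeff_planePoly continuous_snd)) m.exponent
  · intro r a b
    ext m
    simp [planeCoeff, planePoly_smul]
  · intro r a b
    ext m
    simp [planeCoeff, planePoly_smul]
  · intro a b h
    have h2 : (planePoly (d + 1) a * planePoly (5 - d) b).totalDegree ≤ 6 := by
      have := totalDegree_mul (planePoly (d + 1) a) (planePoly (5 - d) b)
      have := totalDegree_planePoly_le (d + 1) a
      have := totalDegree_planePoly_le (5 - d) b
      omega
    have h3 : ∀ k, planePoly k 0 = 0 := fun k => by simp [planePoly_eq_sum]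
    have h4 := planePoly_planeCoeff h2
    rw [h, h3] at h4
    rcases mul_eq_zero.1 h4.symm with h5 | h5
    · exact Or.inl (planePoly_injective _ (h5.trans (h3 _).symm))
    · exact Or.inr (planePoly_injective _ (h5.trans (h3 _).symm))

end TorusSextic

/-! ### Upper bounds -/

namespace TorusSextic

open MvPolynomial

lemma le_totalDegree_planePoly {d : ℕ} {a : Mon d → ℂ} {m : Mon d} (h : a m ≠ 0) :
    (m.1.1 : ℕ) + (m.1.2 : ℕ) ≤ (planePoly d a).totalDegree := by
  have h1 : m.exponent ∈ (planePoly d a).support := by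
    rwa [mem_support_iff, coeff_planePoly]
  refine le_trans (le_of_eq ?_) (le_totalDegree h1)
  rw [Mon.exponent, Finsupp.sum_add_index' (by simp) (by simp), Finsupp.sum_single_index rfl,
    Finsupp.sum_single_index rfl]

lemma totalDegree_conic_pair {J : TorusJet ℂ} (ht : J.t ≠ 0) (h : J.β ^ 2 + 2 * J.q02 ≠ 0) :
    (conic J.pair).totalDegree = 2 :=
  (totalDegree_conic_le _).antisymm
    (le_totalDegree_planePoly (d := 2) (m := ⟨(0, 2), by simp⟩)
      (show -J.t ^ 2 * (J.β ^ 2 + 2 * J.q02) ≠ 0 by simp [ht, h]))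

lemma totalDegree_cubic_pair {J : TorusJet ℂ} (ht : J.t ≠ 0)
    (h : J.β ^ 3 + J.β * (3 * J.q02 + J.h02) + J.h03 ≠ 0) : (cubic J.pair).totalDegree = 3 :=
  (totalDegree_cubic_le _).antisymm
    (le_totalDegree_planePoly (d := 3) (m := ⟨(0, 3), by simp⟩)
      (show J.t ^ 3 * (J.β ^ 3 + J.β * (3 * J.q02 + J.h02) + J.h03) ≠ 0 by simp [ht, h]))

/-- The degree of a polynomial is at least that of its restriction to a line. -/
lemma natDegree_aeval_le {R : Type*} [CommRing R] (f : MvPolynomial (Fin 2) R)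
    (g : Fin 2 → Polynomial R) (hg : ∀ i, (g i).natDegree ≤ 1) :
    (aeval g f).natDegree ≤ f.totalDegree := by
  rw [aeval_def, eval₂_eq]
  refine Polynomial.natDegree_sum_le_of_forall_le _ _ fun e he => ?_
  refine (Polynomial.natDegree_C_mul_le _ _).trans ?_
  refine (Polynomial.natDegree_prod_le _ _).trans ?_
  refine le_trans (Finset.sum_le_sum fun i _ => ?_) (le_totalDegree he)
  refine Polynomial.natDegree_pow_le.trans ?_
  simpa using Nat.mul_le_mul_left (e i) (hg i)

lemma totalDegree_baseA : (sextic baseA.pair).totalDegree = 6 := by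
  refine (totalDegree_sextic_le _).antisymm ?_
  have h := natDegree_aeval_le (sextic baseA.pair) ![Polynomial.X, 0]
    (fun i => by fin_cases i <;> simp)
  refine le_trans (le_of_eq ?_) h
  rw [sextic_baseA]
  simp
  symm
  have : (-(1 + Polynomial.X ^ 2) ^ 3 + (1 + Polynomial.C (3 / 2) * Polynomial.X ^ 2) ^ 2 :
      Polynomial ℂ) = -Polynomial.X ^ 6 + Polynomial.C (-3 / 4) * Polynomial.X ^ 4 := by
    have h2 : (Polynomial.C (3 / 2) : Polynomial ℂ) = 3 * Polynomial.C (1 / 2) := by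
      rw [← Polynomial.C_ofNat, ← Polynomial.C_mul]; norm_num
    have h3 : (Polynomial.C (-3 / 4) : Polynomial ℂ) = -3 * Polynomial.C (1 / 2) ^ 2 := by
      rw [← Polynomial.C_ofNat, ← Polynomial.C_pow, ← Polynomial.C_neg, ← Polynomial.C_mul]
      norm_num
    have h4 : (2 * Polynomial.C (1 / 2) : Polynomial ℂ) = 1 := by
      rw [← Polynomial.C_ofNat, ← Polynomial.C_mul]; norm_num
    rw [h2, h3]
    generalize (Polynomial.C (1 / 2) : Polynomial ℂ) = c at h4 ⊢
    linear_combination (3 * Polynomial.X ^ 2 + (6 * c + 3) * Polynomial.X ^ 4) * h4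
  rw [this]
  compute_degree!

lemma totalDegree_baseE : (sextic baseE.pair).totalDegree = 6 := by
  refine (totalDegree_sextic_le _).antisymm ?_
  have h := natDegree_aeval_le (sextic baseE.pair) ![0, Polynomial.X]
    (fun i => by fin_cases i <;> simp)
  refine le_trans (le_of_eq ?_) h
  rw [sextic_baseE]
  simp
  symm
  have : (-1 + (1 + Polynomial.X ^ 3) ^ 2 :
      Polynomial ℂ) = Polynomial.X ^ 6 + 2 * Polynomial.X ^ 3 := by
    ring
  rw [this]
  compute_degree!

/-- A polynomial family of jets that depends on `m` parameters effectively, has type `σ` off a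
hypersurface, and contains the jet of an irreducible sextic bounds the number of conditions. -/
lemma numConditions_le_of_family {m : ℕ} {σ : SingType} (K : TorusJet (MvPolynomial (Fin m) ℂ))
    (halg : ∀ i, IsAlgebraic (Algebra.adjoin ℂ (Set.range K.pair))
      (X i : MvPolynomial (Fin m) ℂ))
    (s₀ : Fin m → ℂ) (h6 : (sextic (K.map (eval s₀)).pair).totalDegree = 6)
    (hirr : Irreducible (sextic (K.map (eval s₀)).pair)) (N : MvPolynomial (Fin m) ℂ)
    (hN : N * (K.t * (K.β ^ 2 + 2 * K.q02) * (K.β ^ 3 + K.β * (3 * K.q02 + K.h02) + K.h03)) ≠ 0)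
    (hσ : ∀ s, eval s N ≠ 0 → FunGermEquiv
      (fun z => (K.map (eval s)).germ (z 0) (z 1)) 0 (fun z => eval z σ.normalForm) 0) :
    numConditions (irreducibleSextics ∩ outerLocus σ 0) ≤ ((16 - m : ℕ) : ℕ∞) := by
  have hcont : Continuous fun s : Fin m → ℂ => (K.map (eval s)).pair := by
    refine continuous_pi fun i => ?_
    simp only [TorusJet.pair_map]
    exact MvPolynomial.continuous_eval _
  refine numConditions_le K.pair (isAlgebraic_of_forall_X halg)
    (isOpen_irreducible.preimage hcont) ⟨s₀, h6, hirr⟩ hN fun s hs hsN => ?_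
  have e : (fun i => eval s (K.pair i)) = (K.map (eval s)).pair :=
    funext fun i => (TorusJet.pair_map _ _ _).symm
  simp only [map_mul, mul_ne_zero_iff] at hsN
  obtain ⟨h1, ⟨ht, h2⟩, h3⟩ := hsN
  have ht' : (K.map (eval s)).t ≠ 0 := ht
  rw [e]
  refine ⟨⟨totalDegree_conic_pair ht' ?_, totalDegree_cubic_pair ht' ?_, hs⟩,
    mem_outerLocus_of_germ ht' (hσ s h1)⟩
  · simpa [TorusJet.map] using h2
  · simpa [TorusJet.map] using h3

/-- `numConditions_le_of_family` for the shears by `p` of a family. -/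
lemma numConditions_le_of_shear {m : ℕ} {σ : SingType} (K : TorusJet (MvPolynomial (Fin m) ℂ))
    (p : MvPolynomial (Fin m) ℂ)
    (halg : ∀ R : Subalgebra ℂ (MvPolynomial (Fin m) ℂ), IsAlgebraic R p → K.IsAlgebraicOver R →
      ∀ i, IsAlgebraic R (X i : MvPolynomial (Fin m) ℂ))
    (hK : (K.h11 = 0 ∧ K.h02 ≠ 0) ∨ (K.h30 = 0 ∧ K.h03 ≠ 0))
    (J : TorusJet ℂ) (h6 : (sextic J.pair).totalDegree = 6) (hirr : Irreducible (sextic J.pair))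
    (s₀ : Fin m → ℂ) (hs : K.map (eval s₀) = J) (hp : eval s₀ p = 0) (N : MvPolynomial (Fin m) ℂ)
    (hN : N * (K.t * (K.β ^ 2 + 2 * K.q02) * (K.β ^ 3 + K.β * (3 * K.q02 + K.h02) + K.h03)) ≠ 0)
    (hσ : ∀ s, eval s N ≠ 0 → FunGermEquiv
      (fun z => (K.map (eval s)).germ (z 0) (z 1)) 0 (fun z => eval z σ.normalForm) 0) :
    numConditions (irreducibleSextics ∩ outerLocus σ 0) ≤ ((16 - m : ℕ) : ℕ∞) := by
  have ht : K.t ≠ 0 := fun h => hN (by rw [h]; ring)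
  have e : ((K.shear p).map (eval s₀)) = J := by
    rw [TorusJet.shear_map, hs, hp]
    simp [TorusJet.shear]
  refine numConditions_le_of_family (K.shear p) (fun i => ?_) s₀ (by rw [e]; exact h6)
    (by rw [e]; exact hirr) N hN fun s hsN => ?_
  · obtain ⟨h1, h2⟩ := TorusJet.isAlgebraicOver_of_shear
      (R := Algebra.adjoin ℂ (Set.range (K.shear p).pair)) (J := K) (p := p)
      (TorusJet.isAlgebraicOver_of_pair ht fun i => isAlgebraic_algebraMap
        (⟨_, Algebra.subset_adjoin ⟨i, rfl⟩⟩ : Algebra.adjoin ℂ (Set.range (K.shear p).pair))) hK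
    exact halg _ h1 h2 i
  · rw [TorusJet.shear_map]
    exact (funGermEquiv_germ_shear _ _).trans (hσ s hsN)

lemma ne_zero_of_eval {m : ℕ} {p : MvPolynomial (Fin m) ℂ} (s : Fin m → ℂ) (h : eval s p ≠ 0) :
    p ≠ 0 := fun h0 => h (by rw [h0, map_zero])

lemma numConditions_le_A2 : numConditions (irreducibleSextics ∩ outerLocus (.A 2) 0) ≤ 4 := by
  refine numConditions_le_of_shear familyA2 (X 0) ?_ (Or.inl ⟨rfl, X_ne_zero _⟩) baseA
    totalDegree_baseA irreducible_baseA
    ![0, 1, 0, 1 / 2, 1 / 2, 0, -1 / 8, -3 / 8, 0, 3 / 4, 0, 1 / 4] ?_ ?_ (X 7 * X 8)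
    (ne_zero_of_eval ![0, 1, 0, 0, 0, 0, 1, 1, 1, 0, 0, 1] ?_) fun s hs => ?_
  · rintro R p ⟨⟨⟨t, α, β⟩, q20, q11, q02⟩, ⟨h20, h11, h02⟩, h30, h21, h12, h03⟩ i
    fin_cases i
    exacts [p, t, α, β, q20, q11, q02, h02, h30, h21, h12, h03]
  · ext <;> simp [TorusJet.map, familyA2, baseA]
  · simp
  · simp [familyA2]
  · simp at hs
    exact TorusJet.funGermEquiv_A2 _ (by simp [familyA2, TorusJet.map])
      (by simp [familyA2, TorusJet.map]) (by simp [familyA2, TorusJet.map, hs])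
      (by simp [familyA2, TorusJet.map, hs])

/-- The parameters of the double parabola are algebraic over the coefficients of its jet. -/
lemma isAlgebraic_tacnode {R A : Type*} [CommRing R] [IsDomain R] [CommRing A] [IsDomain A]
    [CharZero A] [Algebra R A] {κ s : A} (hκ : κ ≠ 0) (h02 : IsAlgebraic R (-6 * κ ^ 2))
    (q20 : IsAlgebraic R (2 * κ * s)) : IsAlgebraic R κ ∧ IsAlgebraic R s := by
  have nat : ∀ n : ℕ, IsAlgebraic R (n : A) := fun n => isAlgebraic_natCast n
  have two : IsAlgebraic R (2 : A) := by exact_mod_cast nat 2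
  have six : IsAlgebraic R (6 : A) := by exact_mod_cast nat 6
  have h : IsAlgebraic R κ :=
    IsAlgebraic.of_pow two_pos (isAlgebraic_of_mul_left (by simp) six.neg h02)
  exact ⟨h, isAlgebraic_of_mul_left (mul_ne_zero two_ne_zero hκ) (two.mul h) q20⟩

lemma numConditions_le_A4 : numConditions (irreducibleSextics ∩ outerLocus (.A 4) 0) ≤ 6 := by
  refine numConditions_le_of_shear familyA4 (X 0) ?_
    (Or.inl ⟨rfl, mul_ne_zero (by simp) (pow_ne_zero 2 (X_ne_zero _))⟩) baseA
    totalDegree_baseA irreducible_baseA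
    ![0, 1, 0, 1 / 2, 1 / 4, 1, 0, -1 / 8, 0, 1 / 4] ?_ ?_ (X 4 * X 5 * (X 8 - 6 * X 4 * X 6))
    (ne_zero_of_eval ![0, 1, 0, 0, 1, 1, 0, 1, 1, 1] ?_) fun s hs => ?_
  · rintro R p ⟨⟨⟨t, α, β⟩, q20, q11, q02⟩, ⟨h20, h11, h02⟩, h30, h21, h12, h03⟩ i
    obtain ⟨κ, s⟩ := isAlgebraic_tacnode (X_ne_zero _) h02 q20
    fin_cases i
    exacts [p, t, α, β, κ, s, q11, q02, h12, h03]
  · ext <;> simp [TorusJet.map, familyA4, baseA] <;> norm_num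
  · simp
  · simp [familyA4]
  · simp [not_or, sub_ne_zero] at hs
    exact TorusJet.funGermEquiv_A4 (κ := s 4) (s := s 5) _ (by simp [familyA4, TorusJet.map])
      (by simp [familyA4, TorusJet.map]) (by simp [familyA4, TorusJet.map])
      (by simp [familyA4, TorusJet.map]) (by simp [familyA4, TorusJet.map])
      (by simp [familyA4, TorusJet.map]) hs.1.1 hs.1.2
      (by simpa [familyA4, TorusJet.map] using hs.2)

lemma numConditions_le_D5 : numConditions (irreducibleSextics ∩ outerLocus (.D 5) 0) ≤ 7 := by
  refine numConditions_le_of_shear familyD5 (X 0) ?_ (Or.inr ⟨rfl, X_ne_zero _⟩) baseE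
    totalDegree_baseE irreducible_baseE
    ![0, 1, 1 / 2, 0, -1 / 8, 0, 0, 0, 1] ?_ ?_ (X 7 * X 4)
    (ne_zero_of_eval ![0, 1, 0, 0, 1, 0, 1, 1, 1] ?_) fun s hs => ?_
  · rintro R p ⟨⟨⟨t, α, β⟩, q20, q11, q02⟩, ⟨h20, h11, h02⟩, h30, h21, h12, h03⟩ i
    fin_cases i
    exacts [p, t, α, β, q20, q11, q02, h12, h03]
  · ext <;> simp [TorusJet.map, familyD5, baseE]
  · simp
  · simp [familyD5]
  · simp at hs
    exact TorusJet.funGermEquiv_D5 _ (by simp [familyD5, TorusJet.map])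
      (by simp [familyD5, TorusJet.map]) (by simp [familyD5, TorusJet.map])
      (by simp [familyD5, TorusJet.map]) (by simp [familyD5, TorusJet.map])
      (by simp [familyD5, TorusJet.map, hs]) (by simp [familyD5, TorusJet.map, hs])

lemma numConditions_le_A1 : numConditions (irreducibleSextics ∩ outerLocus (.A 1) 0) ≤ 3 := by
  obtain ⟨K, hK⟩ : ∃ K : TorusJet (MvPolynomial (Fin 13) ℂ), K =
    ⟨X 0, X 1, X 2, X 3, X 4, X 5, X 6, X 7, X 8, X 9, X 10, X 11, X 12⟩ := ⟨_, rfl⟩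
  have e : K.map (eval ![1, 0, 1 / 2, 1 / 2, 0, -1 / 8, 0, 0, -3 / 8, 0, 3 / 4, 0, 1 / 4])
      = baseA := by
    ext <;> simp [TorusJet.map, hK, baseA]
  refine numConditions_le_of_family K (fun i => ?_) _ (by rw [e]; exact totalDegree_baseA)
    (by rw [e]; exact irreducible_baseA) (X 8 * (X 7 ^ 2 - 4 * X 6 * X 8))
    (ne_zero_of_eval ![1, 0, 0, 0, 0, 1, 0, 1, 1, 0, 0, 0, 1] ?_) fun s hs => ?_
  · have := TorusJet.isAlgebraicOver_of_pair (R := Algebra.adjoin ℂ (Set.range K.pair)) (J := K)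
      (by rw [hK]; exact X_ne_zero _) fun i => isAlgebraic_algebraMap
        (⟨_, Algebra.subset_adjoin ⟨i, rfl⟩⟩ : Algebra.adjoin ℂ (Set.range K.pair))
    generalize Algebra.adjoin ℂ (Set.range K.pair) = R at this ⊢
    subst hK
    obtain ⟨⟨⟨t, α, β⟩, q20, q11, q02⟩, ⟨h20, h11, h02⟩, h30, h21, h12, h03⟩ := this
    fin_cases i
    exacts [t, α, β, q20, q11, q02, h20, h11, h02, h30, h21, h12, h03]
  · simp [hK]
  · simp [sub_ne_zero] at hs
    exact TorusJet.funGermEquiv_A1 _ (by simp [hK, TorusJet.map, hs])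
      (by simpa [hK, TorusJet.map] using hs.2)

lemma numConditions_le_A3 : numConditions (irreducibleSextics ∩ outerLocus (.A 3) 0) ≤ 5 := by
  refine numConditions_le_of_shear familyA3 (X 0) ?_ (Or.inl ⟨rfl, X_ne_zero _⟩) baseA
    totalDegree_baseA irreducible_baseA
    ![0, 1, 0, 1 / 2, 1 / 2, 0, -1 / 8, -3 / 8, 3 / 4, 0, 1 / 4] ?_ ?_
    (X 7 * (6 * X 7 * X 4 ^ 2 + X 8 ^ 2))
    (ne_zero_of_eval ![0, 1, 0, 0, 0, 0, 1, 1, 1, 0, 1] ?_) fun s hs => ?_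
  · rintro R p ⟨⟨⟨t, α, β⟩, q20, q11, q02⟩, ⟨h20, h11, h02⟩, h30, h21, h12, h03⟩ i
    fin_cases i
    exacts [p, t, α, β, q20, q11, q02, h02, h21, h12, h03]
  · ext <;> simp [TorusJet.map, familyA3, baseA]
  · simp
  · simp [familyA3]
  · simp at hs
    exact TorusJet.funGermEquiv_A3 _ (by simp [familyA3, TorusJet.map])
      (by simp [familyA3, TorusJet.map]) (by simp [familyA3, TorusJet.map, hs])
      (by simp [familyA3, TorusJet.map]) (by simpa [familyA3, TorusJet.map] using hs.2)

lemma numConditions_le_A5 : numConditions (irreducibleSextics ∩ outerLocus (.A 5) 0) ≤ 7 := by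
  refine numConditions_le_of_shear familyA5 (X 0) ?_
    (Or.inl ⟨rfl, mul_ne_zero (by simp) (pow_ne_zero 2 (X_ne_zero _))⟩) baseA
    totalDegree_baseA irreducible_baseA
    ![0, 1, 0, 1 / 2, 1 / 4, 1, 0, -1 / 8, 1 / 4] ?_ ?_
    (X 4 * (2 * X 5 ^ 3 * (X 8 - 6 * X 4 * X 7) + 8 * X 4 ^ 3 * X 5 ^ 3))
    (ne_zero_of_eval ![0, 1, 0, 0, 1, 1, 0, 1, 1] ?_) fun s hs => ?_
  · rintro R p ⟨⟨⟨t, α, β⟩, q20, q11, q02⟩, ⟨h20, h11, h02⟩, h30, h21, h12, h03⟩ i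
    obtain ⟨κ, s⟩ := isAlgebraic_tacnode (X_ne_zero _) h02 q20
    fin_cases i
    exacts [p, t, α, β, κ, s, q11, q02, h03]
  · ext <;> simp [TorusJet.map, familyA5, baseA] <;> norm_num
  · simp
  · simp [familyA5]
    norm_num
  · simp at hs
    exact TorusJet.funGermEquiv_A5 (κ := s 4) (s := s 5) _ (by simp [familyA5, TorusJet.map])
      (by simp [familyA5, TorusJet.map]) (by simp [familyA5, TorusJet.map])
      (by simp [familyA5, TorusJet.map]) (by simp [familyA5, TorusJet.map])
      (by simp [familyA5, TorusJet.map]) hs.1 (by simp [familyA5, TorusJet.map])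
      (by simpa [familyA5, TorusJet.map] using hs.2)

lemma numConditions_le_D4 : numConditions (irreducibleSextics ∩ outerLocus (.D 4) 0) ≤ 6 := by
  refine numConditions_le_of_shear familyD4 (X 0) ?_ (Or.inr ⟨rfl, X_ne_zero _⟩) baseE
    totalDegree_baseE irreducible_baseE
    ![0, 1, 1 / 2, 0, -1 / 8, 0, 0, 0, 0, 1] ?_ ?_ (X 7 * (X 8 ^ 2 - 4 * X 9 * X 7))
    (ne_zero_of_eval ![0, 1, 0, 0, 0, 0, 1, 1, 0, 1] ?_) fun s hs => ?_
  · rintro R p ⟨⟨⟨t, α, β⟩, q20, q11, q02⟩, ⟨h20, h11, h02⟩, h30, h21, h12, h03⟩ i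
    fin_cases i
    exacts [p, t, α, β, q20, q11, q02, h21, h12, h03]
  · ext <;> simp [TorusJet.map, familyD4, baseE]
  · simp
  · simp [familyD4]
  · simp [sub_ne_zero] at hs
    exact TorusJet.funGermEquiv_D4 _ (by simp [familyD4, TorusJet.map])
      (by simp [familyD4, TorusJet.map]) (by simp [familyD4, TorusJet.map])
      (by simp [familyD4, TorusJet.map]) (by simp [familyD4, TorusJet.map, hs])
      (by simpa [familyD4, TorusJet.map] using hs.2)

lemma numConditions_le_E6 : numConditions (irreducibleSextics ∩ outerLocus .E6 0) ≤ 8 := by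
  refine numConditions_le_of_shear familyE6 (X 0) ?_ (Or.inr ⟨rfl, X_ne_zero _⟩) baseE
    totalDegree_baseE irreducible_baseE
    ![0, 1, 1 / 2, 0, -1 / 8, 0, 0, 1] ?_ ?_ (X 7 * X 4)
    (ne_zero_of_eval ![0, 1, 0, 0, 1, 0, 1, 1] ?_) fun s hs => ?_
  · rintro R p ⟨⟨⟨t, α, β⟩, q20, q11, q02⟩, ⟨h20, h11, h02⟩, h30, h21, h12, h03⟩ i
    fin_cases i
    exacts [p, t, α, β, q20, q11, q02, h03]
  · ext <;> simp [TorusJet.map, familyE6, baseE]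
  · simp
  · simp [familyE6]
  · simp at hs
    exact TorusJet.funGermEquiv_E6 _ (by simp [familyE6, TorusJet.map])
      (by simp [familyE6, TorusJet.map]) (by simp [familyE6, TorusJet.map])
      (by simp [familyE6, TorusJet.map]) (by simp [familyE6, TorusJet.map])
      (by simp [familyE6, TorusJet.map]) (by simp [familyE6, TorusJet.map, hs])
      (by simp [familyE6, TorusJet.map, hs])

end TorusSextic

/-! ### Translations -/

namespace TorusSextic

open MvPolynomial

/-- The substitution of `z + P` for `z`. -/
noncomputable def translate (P : Fin 2 → ℂ) :
    MvPolynomial (Fin 2) ℂ ≃ₐ[ℂ] MvPolynomial (Fin 2) ℂ :=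
  AlgEquiv.ofAlgHom (aeval fun i => X i + C (P i)) (aeval fun i => X i + C (-P i))
    (by ext i : 1; simp) (by ext i : 1; simp)

lemma eval_translate (P z : Fin 2 → ℂ) (f : MvPolynomial (Fin 2) ℂ) :
    eval z (translate P f) = eval (z + P) f := by
  change aeval z (aeval (fun i => X i + C (P i)) f) = aeval (z + P) f
  rw [← AlgHom.comp_apply, comp_aeval]
  congr 2
  ext i
  simp

lemma translate_symm (P : Fin 2 → ℂ) : (translate P).symm = translate (-P) := by
  ext i : 1
  simp [translate]

lemma pderiv_translate (P : Fin 2 → ℂ) (i : Fin 2) (f : MvPolynomial (Fin 2) ℂ) :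
    pderiv i (translate P f) = translate P (pderiv i f) := by
  induction f using MvPolynomial.induction_on with
  | C a => simp [translate]
  | add p q hp hq => simp [hp, hq]
  | mul_X p j hp =>
    have h : translate P (X j) = X j + C (P j) := by simp [translate]
    rw [map_mul, Derivation.leibniz, Derivation.leibniz, map_add, hp, h]
    by_cases hij : j = i
    · subst hij; simp [h]
    · simp [h, pderiv_X_of_ne hij]

lemma totalDegree_translate_le (P : Fin 2 → ℂ) (f : MvPolynomial (Fin 2) ℂ) :
    (translate P f).totalDegree ≤ f.totalDegree := by
  change (aeval (fun i => X i + C (P i)) f).totalDegree ≤ _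
  rw [aeval_def, eval₂_eq]
  refine totalDegree_finsetSum_le fun e he => ?_
  refine (totalDegree_mul _ _).trans ?_
  rw [algebraMap_eq, totalDegree_C, zero_add]
  refine (totalDegree_finsetProd _ _).trans ?_
  refine le_trans (Finset.sum_le_sum fun i _ => ?_) (le_totalDegree he)
  refine (totalDegree_pow _ _).trans ?_
  have : (X i + C (P i) : MvPolynomial (Fin 2) ℂ).totalDegree ≤ 1 :=
    (totalDegree_add _ _).trans (by simp)
  simpa using Nat.mul_le_mul_left (e i) this

lemma totalDegree_translate (P : Fin 2 → ℂ) (f : MvPolynomial (Fin 2) ℂ) :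
    (translate P f).totalDegree = f.totalDegree := by
  refine (totalDegree_translate_le P f).antisymm ?_
  have := totalDegree_translate_le (-P) (translate P f)
  rwa [← translate_symm, AlgEquiv.symm_apply_apply] at this

/-- The action of translations on coefficients. -/
noncomputable def translatePair (P : Fin 2 → ℂ) : Pair →ₗ[ℂ] Pair where
  toFun c := Sum.elim (planeCoeff 2 (translate P (conic c))) (planeCoeff 3 (translate P (cubic c)))
  map_add' a b := by
    have h2 : conic (a + b) = conic a + conic b := planePoly_add _ _ _
    have h3 : cubic (a + b) = cubic a + cubic b := planePoly_add _ _ _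
    ext (m | m)
    · simp [planeCoeff, h2]
    · simp [planeCoeff, h3]
  map_smul' r a := by
    have h2 : conic (r • a) = r • conic a := planePoly_smul _ _ _
    have h3 : cubic (r • a) = r • cubic a := planePoly_smul _ _ _
    ext (m | m)
    · simp [planeCoeff, h2]
    · simp [planeCoeff, h3]

lemma conic_translatePair (P : Fin 2 → ℂ) (c : Pair) :
    conic (translatePair P c) = translate P (conic c) :=
  planePoly_planeCoeff ((totalDegree_translate_le _ _).trans (totalDegree_conic_le c))

lemma cubic_translatePair (P : Fin 2 → ℂ) (c : Pair) :
    cubic (translatePair P c) = translate P (cubic c) :=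
  planePoly_planeCoeff ((totalDegree_translate_le _ _).trans (totalDegree_cubic_le c))

lemma sextic_translatePair (P : Fin 2 → ℂ) (c : Pair) :
    sextic (translatePair P c) = translate P (sextic c) := by
  simp [sextic, conic_translatePair, cubic_translatePair]

lemma translatePair_neg (P : Fin 2 → ℂ) (c : Pair) :
    translatePair (-P) (translatePair P c) = c := by
  have h2 : conic (translatePair (-P) (translatePair P c)) = conic c := by
    rw [conic_translatePair, conic_translatePair, ← translate_symm, AlgEquiv.symm_apply_apply]
  have h3 : cubic (translatePair (-P) (translatePair P c)) = cubic c := by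
    rw [cubic_translatePair, cubic_translatePair, ← translate_symm, AlgEquiv.symm_apply_apply]
  ext (m | m)
  · exact congrFun (planePoly_injective 2 h2) m
  · exact congrFun (planePoly_injective 3 h3) m

lemma translatePair_mem_irreducibleSextics (P : Fin 2 → ℂ) {c : Pair}
    (h : c ∈ irreducibleSextics) : translatePair P c ∈ irreducibleSextics := by
  obtain ⟨h2, h3, h6, hirr⟩ := h
  refine ⟨?_, ?_, ?_, ?_⟩
  · rw [conic_translatePair, totalDegree_translate, h2]
  · rw [cubic_translatePair, totalDegree_translate, h3]
  · rw [sextic_translatePair, totalDegree_translate, h6]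
  · rw [sextic_translatePair]
    exact (MulEquiv.irreducible_iff (translate P)).2 hirr

lemma funGermEquiv_translate (P Q : Fin 2 → ℂ) (f : MvPolynomial (Fin 2) ℂ) :
    FunGermEquiv (fun z => eval z f) (Q + P) (fun z => eval z (translate P f)) Q := by
  refine ⟨fun z => z + P, ContinuousLinearEquiv.refl ℂ _, fun _ => 1,
    analyticAt_id.add analyticAt_const, rfl, (hasFDerivAt_id Q).add_const P, analyticAt_const,
    one_ne_zero, Filter.Eventually.of_forall fun z => ?_⟩
  simp [eval_translate]

lemma translatePair_mem_outerLocus {σ : SingType} (P Q : Fin 2 → ℂ) {c : Pair}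
    (h : c ∈ outerLocus σ (Q + P)) : translatePair P c ∈ outerLocus σ Q := by
  obtain ⟨⟨⟨h0, h1⟩, h2⟩, h3⟩ := h
  refine ⟨⟨⟨?_, fun i => ?_⟩, ?_⟩, ?_⟩
  · rwa [sextic_translatePair, eval_translate]
  · rw [sextic_translatePair, pderiv_translate, eval_translate]
    exact h1 i
  · rwa [conic_translatePair, eval_translate]
  · rw [sextic_translatePair]
    exact (funGermEquiv_translate P Q (sextic c)).symm.trans h3

/-- A linear map of the coordinate space as a substitution in polynomials. -/
noncomputable def linearSubst {ι : Type*} [Fintype ι] [DecidableEq ι] (e : (ι → ℂ) →ₗ[ℂ] ι → ℂ) :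
    MvPolynomial ι ℂ →ₐ[ℂ] MvPolynomial ι ℂ :=
  aeval fun i => ∑ j, C (e (Pi.single j 1) i) * X j

lemma eval_linearSubst {ι : Type*} [Fintype ι] [DecidableEq ι] (e : (ι → ℂ) →ₗ[ℂ] ι → ℂ)
    (c : ι → ℂ) (p : MvPolynomial ι ℂ) : eval c (linearSubst e p) = eval (e c) p := by
  change aeval c (aeval _ p) = aeval (e c) p
  rw [← AlgHom.comp_apply, comp_aeval]
  congr 2
  ext i
  rw [LinearMap.pi_apply_eq_sum_univ e c, Finset.sum_apply, map_sum]
  refine Finset.sum_congr rfl fun j _ => ?_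
  have : (fun k => if j = k then (1 : ℂ) else 0) = Pi.single j 1 := by
    ext k
    simp [Pi.single_apply, eq_comm]
  rw [this]
  simp [mul_comm]

/-- The number of conditions does not change under linear changes of coordinates. -/
lemma numConditions_image (e e' : Pair →ₗ[ℂ] Pair) (h : ∀ c, e' (e c) = c) (h' : ∀ c, e (e' c) = c)
    (S : Set Pair) : numConditions (e '' S) = numConditions S := by
  let E : MvPolynomial CoeffIndex ℂ ≃ₐ[ℂ] MvPolynomial CoeffIndex ℂ :=
    AlgEquiv.ofAlgHom (linearSubst e) (linearSubst e')
      (AlgHom.ext fun p => MvPolynomial.funext fun c => by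
        rw [AlgHom.comp_apply, eval_linearSubst, eval_linearSubst, h, AlgHom.id_apply])
      (AlgHom.ext fun p => MvPolynomial.funext fun c => by
        rw [AlgHom.comp_apply, eval_linearSubst, eval_linearSubst, h', AlgHom.id_apply])
  have : (vanishingIdeal ℂ (e '' S) : Ideal (MvPolynomial CoeffIndex ℂ)) =
      (vanishingIdeal ℂ S).comap E.toRingEquiv := by
    ext p
    rw [Ideal.mem_comap, mem_vanishingIdeal_iff, mem_vanishingIdeal_iff, Set.forall_mem_image]
    exact forall₂_congr fun c _ => by
      rw [show aeval c (E.toRingEquiv p) = aeval (e c) p from eval_linearSubst e c p]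
  rw [numConditions, numConditions, this, E.toRingEquiv.height_comap]

/-- A translation moves `P` to the origin, where the locus is squeezed between that of the
irreducible sextics and that of all pairs. -/
lemma oCodim_eq {σ : SingType} {n : ℕ}
    (hle : numConditions (irreducibleSextics ∩ outerLocus σ 0) ≤ (n + 2 : ℕ))
    (hge : ∀ S : Set Pair, S ⊆ outerLocus σ 0 → ((n + 2 : ℕ) : ℕ∞) ≤ numConditions S)
    (P : Fin 2 → ℂ) {U : Set Pair} (hU : irreducibleSextics ⊆ U) : oCodim U σ P = n := by
  have hnum : numConditions (U ∩ outerLocus σ P) = ((n + 2 : ℕ) : ℕ∞) := by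
    rw [← numConditions_image (translatePair P) (translatePair (-P)) (translatePair_neg P)
      (fun c => by simpa using translatePair_neg (-P) c)]
    refine le_antisymm (le_trans (numConditions_mono ?_) hle) (hge _ ?_)
    · rintro c ⟨hc, hcσ⟩
      refine ⟨translatePair (-P) c, ⟨hU (translatePair_mem_irreducibleSextics _ hc),
        translatePair_mem_outerLocus (-P) P (by simpa using hcσ)⟩,
        by simpa using translatePair_neg (-P) c⟩
    · rintro _ ⟨c, ⟨-, hc⟩, rfl⟩
      exact translatePair_mem_outerLocus P 0 (by simpa using hc)
  rw [oCodim, hnum]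
  norm_cast

end TorusSextic

open TorusSextic in
theorem proposition10 (P : Fin 2 → ℂ) (U : Set Pair) (hU : irreducibleSextics ⊆ U) :
    (∀ i : ℕ, 1 ≤ i → i ≤ 5 → oCodim U (.A i) P = i) ∧
    (∀ i : ℕ, 4 ≤ i → i ≤ 5 → oCodim U (.D i) P = i) ∧
    oCodim U .E6 P = 6 ∧
    ∀ σ ∈ outerTypes, ∀ c ∈ outerLocus σ P,
      oCodim U σ P = (milnorNumber (sextic c) P : ℕ∞) := by
  have hA : ∀ i : ℕ, 1 ≤ i → i ≤ 5 → oCodim U (.A i) P = i := by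
    intro i h1 h5
    interval_cases i
    · exact oCodim_eq (n := 1) numConditions_le_A1 le_numConditions_A1 P hU
    · exact oCodim_eq (n := 2) numConditions_le_A2 le_numConditions_A2 P hU
    · exact oCodim_eq (n := 3) numConditions_le_A3 le_numConditions_A3 P hU
    · exact oCodim_eq (n := 4) numConditions_le_A4 le_numConditions_A4 P hU
    · exact oCodim_eq (n := 5) numConditions_le_A5 le_numConditions_A5 P hU
  have hD : ∀ i : ℕ, 4 ≤ i → i ≤ 5 → oCodim U (.D i) P = i := by
    intro i h1 h5
    interval_cases i
    · exact oCodim_eq (n := 4) numConditions_le_D4 le_numConditions_D4 P hU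
    · exact oCodim_eq (n := 5) numConditions_le_D5 le_numConditions_D5 P hU
  have hE : oCodim U .E6 P = 6 :=
    oCodim_eq (n := 6) numConditions_le_E6 le_numConditions_E6 P hU
  refine ⟨hA, hD, hE, ?_⟩
  rintro σ (⟨i, h1, h5, rfl⟩ | ⟨i, h1, h5, rfl⟩ | rfl) c hc
  · rw [hA i h1 h5, milnorNumber_of_germEquiv_A h1 hc.2]
  · rw [hD i h1 h5, milnorNumber_of_germEquiv_D h1 hc.2]
  · rw [hE, milnorNumber_of_germEquiv_E6 hc.2]
    rfl
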